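/- Write $\mathbb{R}^3_-=\{x\in\mathbb{R}^3: x_3<0\}$, $B^-_r(0)=\{x\in\mathbb{R}^3_-:|x|<r\}$ and $\rho(x)=(1+|x|^2)^{1/2}$. For a matrix $A\in\mathbb{R}^{3\times 3}$ let $|A|^2=\sum_{i,j}A_{ij}^2$. Let $r_0>0$, $E_0>0$ and $D_0>1$. There is a constant $c=c(r_0,E_0,D_0)>0$ with the following property. Let $C\subset\mathbb{R}^3$ be a bounded domain (non-empty, open and connected) such that (i) $\partial C$ is of Lipschitz class with constants $r_0,E_0$: for every $P\in\partial C$ there is a rigid change of coordinates under which $P=0$ and $C\cap B_{r_0}(0)=\{x\in B_{r_0}(0): x_3>\psi(x_1,x_2)\}$, where $\psi$ is a Lipschitz function on the disc $B'_{r_0}(0)\subset\mathbb{R}^2$ with $\psi(0)=0$ and $\|\psi\|_{C^{0,1}(B'_{r_0}(0))}=\sup|\psi|+\mathrm{Lip}(\psi)\le E_0$; (ii) $C\subset B^-_{2D_0}(0)$, $\operatorname{dist}(C,\{x_3=0\})\ge D_0$ and $\operatorname{diam}(C)<D_0$; (iii) the open set $\Omega=\mathbb{R}^3_-\setminus\overline{C}$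 is connected. Let $u\in H^1_w(\Omega)$, that is, $u:\Omega\to\mathbb{R}^3$ satisfies $u/\rho\in L^2(\Omega)$ and its distributional gradient $\nabla u$ belongs to $L^2(\Omega)$. Then $$\int_{\Omega}|\nabla u|^2\,dx\le c\int_{\Omega}|\widehat{\nabla}u|^2\,dx,\qquad \widehat{\nabla}u=\tfrac12\bigl(\nabla u+(\nabla u)^T\bigr).$$ -/

import Mathlib

open MeasureTheory
open scoped ContDiff NNReal

namespace ElasticCavity

/-- Three-dimensional Euclidean space. -/
abbrev E3 : Type := EuclideanSpace ℝ (Fin 3)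

/-- The plane. -/
abbrev E2 : Type := EuclideanSpace ℝ (Fin 2)

/-- The open lower half-space `x₃ < 0`. -/
def halfSpace : Set E3 := {x | x 2 < 0}

/-- The plane `x₃ = 0` bounding the half-space. -/
def boundaryPlane : Set E3 := {x | x 2 = 0}

/-- The open lower half-ball of radius `r` centred at the origin. -/
def halfBall (r : ℝ) : Set E3 := Metric.ball 0 r ∩ halfSpace

/-- The first two coordinates `x'` of a point `x`. -/
noncomputable def horizontal (x : E3) : E2 := !₂[x 0, x 1]

/-- `‖ψ‖_{C^{0,1}(s)} ≤ E`: the supremum of `|ψ|` plus the Lipschitz seminorm of `ψ` is at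
most `E`. -/
def LipschitzNormLE (ψ : E2 → ℝ) (s : Set E2) (E : ℝ) : Prop :=
  ∃ M L : ℝ≥0, (∀ x ∈ s, |ψ x| ≤ M) ∧ LipschitzOnWith L ψ s ∧ (M : ℝ) + L ≤ E

/-- The boundary of `C` is of Lipschitz class with constants `r₀`, `E₀`: near every boundary
point, after a rigid change of coordinates `T` that carries the point to the origin, `C` is the
epigraph, inside the ball of radius `r₀`, of a function of `C^{0,1}` norm at most `E₀`. -/
def HasLipschitzBoundary (r₀ E₀ : ℝ) (C : Set E3) : Prop :=
  ∀ P ∈ frontier C, ∃ (T : E3 ≃ᵃⁱ[ℝ] E3) (ψ : E2 → ℝ),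
    T P = 0 ∧ ψ 0 = 0 ∧ LipschitzNormLE ψ (Metric.ball 0 r₀) E₀ ∧
    (T '' C) ∩ Metric.ball 0 r₀ = {x ∈ Metric.ball (0 : E3) r₀ | ψ (horizontal x) < x 2}

/-- The region occupied by the elastic medium outside the cavity `C`, as an open set. -/
def exterior (C : Set E3) : Set E3 := halfSpace \ closure C

/-- The a priori assumptions on the cavity, with constants `r₀`, `E₀`, `D₀`. -/
structure IsCavity (r₀ E₀ D₀ : ℝ) (C : Set E3) : Prop where
  isOpen : IsOpen C
  isConnected : IsConnected C
  lipschitz : HasLipschitzBoundary r₀ E₀ C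
  subset_halfBall : C ⊆ halfBall (2 * D₀)
  le_dist : ∀ x ∈ C, ∀ y ∈ boundaryPlane, D₀ ≤ dist x y
  diam_lt : Metric.diam C < D₀
  exterior_connected : IsConnected (exterior C)

/-- The weight `ρ(x) = (1 + |x|²)^{1/2}`. -/
noncomputable def rho (x : E3) : ℝ := Real.sqrt (1 + ‖x‖ ^ 2)

/-- `G` is the gradient `(∇u)ᵢⱼ = ∂ⱼuᵢ` of `u` in the sense of distributions on `Ω`, where `u`
and `G` are locally integrable. -/
def HasWeakGradient (Ω : Set E3) (u : E3 → E3) (G : E3 → Matrix (Fin 3) (Fin 3) ℝ) : Prop :=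
  LocallyIntegrableOn u Ω ∧
  (∀ i j, LocallyIntegrableOn (fun x => G x i j) Ω) ∧
  ∀ φ : E3 → ℝ, ContDiff ℝ ∞ φ → HasCompactSupport φ → tsupport φ ⊆ Ω → ∀ i j,
    ∫ x in Ω, u x i * fderiv ℝ φ x (EuclideanSpace.single j 1) = - ∫ x in Ω, G x i j * φ x

/-- Membership in the weighted Sobolev space `H¹_w(Ω)`: `u / ρ ∈ L²(Ω)` and `∇u ∈ L²(Ω)`. -/
def MemWeightedH1 (Ω : Set E3) (u : E3 → E3) : Prop :=
  MemLp (fun x => (rho x)⁻¹ • u x) 2 (volume.restrict Ω) ∧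
  ∃ G : E3 → Matrix (Fin 3) (Fin 3) ℝ, HasWeakGradient Ω u G ∧
    ∀ i j, MemLp (fun x => G x i j) 2 (volume.restrict Ω)

/-- The symmetric part of a matrix. -/
noncomputable def symPart (A : Matrix (Fin 3) (Fin 3) ℝ) : Matrix (Fin 3) (Fin 3) ℝ :=
  (1 / 2 : ℝ) • (A + A.transpose)

/-- The squared norm `|A|² = A : A`. -/
def normSq (A : Matrix (Fin 3) (Fin 3) ℝ) : ℝ := ∑ i, ∑ j, A i j ^ 2

end ElasticCavity

namespace ElasticCavity

open Set Filter Topology Metric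
open scoped ENNReal

/-! Each entry g = ∂ⱼuᵢ is bounded separately by the strain energy density f = |∇̂u|². Only two
properties of g are used: g ∈ L²(Ω), and on every ball B with concentric triple 3B ⊂ Ω it differs
from a constant by at most K∫_{3B} f in mean square, with K universal. The second property is
`exists_ball_korn`; what remains is the scalar statement `exists_bound_of_isControlled` on domains
with Lipschitz charts.

Interior Korn inequality. The increment (v(x) - v(y))·(x - y) is an integral of the strain along the
segment [y, x]. Averaging provides a small simplex whose vertices have small increments among
themselves and against most other points (`exists_good_simplex`). Differences of increments recover
v up to an affine map with nearly skew linear part, so v minus that map has small L² norm and small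
strain; a cut-off and Korn's inequality in the whole space then control its gradient. Every constant
is explicit and no compactness is used. Mollification carries the result over to weak gradients.

From balls to Ω. If a map S moves each point by at most 1/16 of its distance to the complement and
does not compress volume, then ∫|g - g∘S|² ≤ C∫f (`lintegral_displacement_le`). Let S multiply the
height above a Lipschitz graph by 1 + η. Its Jacobian is 1 + η, so ∫|g∘S|² is smaller than the
integral of g² over the image by the factor (1 + η)⁻¹, and since ∫g² is finite it can be absorbed
(`lintegral_sq_le_of_push`). Thus g² on a region W is controlled by f and by g² on the set I of
points to which S carries W outside W. Far from the cavity Ω is a half-space and I is empty, so g is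
controlled by f alone; this is what excludes nonzero constants. Near a boundary point I is a layer
at positive depth.

Points of positive depth are joined to a point far below by chains of short steps. Their lengths are
not bounded uniformly in C, but a finite partition into cells, the far region being one cell, bounds
the accumulated loss by a power of the number of cells (`le_of_reflTransGen`). Hence the constant
depends only on r₀, E₀, D₀. -/

/-! ### Korn's inequality in the whole space -/

/-- The `j`-th partial derivative of a scalar function. -/
noncomputable def partialDeriv (j : Fin 3) (f : E3 → ℝ) (x : E3) : ℝ :=
  fderiv ℝ f x (EuclideanSpace.single j 1)

/-- The Jacobian matrix of a vector field given by its components. -/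
noncomputable def jacobian (v : Fin 3 → E3 → ℝ) (x : E3) : Matrix (Fin 3) (Fin 3) ℝ :=
  fun i j => partialDeriv j (v i) x

lemma jacobian_apply (v : Fin 3 → E3 → ℝ) (x : E3) (i j : Fin 3) :
    jacobian v x i j = partialDeriv j (v i) x := rfl

lemma normSq_nonneg (A : Matrix (Fin 3) (Fin 3) ℝ) : 0 ≤ normSq A :=
  Finset.sum_nonneg fun _ _ => Finset.sum_nonneg fun _ _ => sq_nonneg _

/-- For a Jacobian the last sum is the cross term that will integrate to the squared divergence. -/
lemma two_mul_normSq_symPart (A : Matrix (Fin 3) (Fin 3) ℝ) :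
    2 * normSq (symPart A) = normSq A + ∑ i, ∑ j, A i j * A j i := by
  simp only [normSq, symPart, Matrix.smul_apply, Matrix.add_apply, Matrix.transpose_apply,
    Fin.sum_univ_three, smul_eq_mul]
  ring

lemma normSq_symPart_le (A : Matrix (Fin 3) (Fin 3) ℝ) : normSq (symPart A) ≤ normSq A := by
  simp only [normSq, symPart, Matrix.smul_apply, Matrix.add_apply, Matrix.transpose_apply,
    Fin.sum_univ_three, smul_eq_mul]
  nlinarith [sq_nonneg (A 0 1 - A 1 0), sq_nonneg (A 0 2 - A 2 0), sq_nonneg (A 1 2 - A 2 1)]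

lemma sq_entry_le_normSq (A : Matrix (Fin 3) (Fin 3) ℝ) (i j : Fin 3) :
    A i j ^ 2 ≤ normSq A :=
  (Finset.single_le_sum (f := fun j => A i j ^ 2) (fun _ _ => sq_nonneg _)
    (Finset.mem_univ j)).trans
    (Finset.single_le_sum (f := fun i => ∑ j, A i j ^ 2)
      (fun _ _ => Finset.sum_nonneg fun _ _ => sq_nonneg _) (Finset.mem_univ i))

lemma contDiff_partialDeriv {f : E3 → ℝ} (hf : ContDiff ℝ ∞ f) (j : Fin 3) :
    ContDiff ℝ ∞ (partialDeriv j f) :=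
  (hf.fderiv_right (m := ∞) (by simp)).clm_apply contDiff_const

lemma continuous_partialDeriv {f : E3 → ℝ} (hf : ContDiff ℝ ∞ f) (j : Fin 3) :
    Continuous (partialDeriv j f) :=
  (contDiff_partialDeriv hf j).continuous

lemma hasCompactSupport_partialDeriv {f : E3 → ℝ} (hf : HasCompactSupport f) (j : Fin 3) :
    HasCompactSupport (partialDeriv j f) :=
  hf.fderiv_apply (𝕜 := ℝ) _

lemma partialDeriv_comm {f : E3 → ℝ} (hf : ContDiff ℝ ∞ f) (i j : Fin 3) (x : E3) :
    partialDeriv i (partialDeriv j f) x = partialDeriv j (partialDeriv i f) x := by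
  have hd : DifferentiableAt ℝ (fderiv ℝ f) x :=
    ((hf.fderiv_right (m := ∞) (by simp)).differentiable (by simp)) x
  have key : ∀ a b : Fin 3, partialDeriv a (partialDeriv b f) x =
      fderiv ℝ (fderiv ℝ f) x (EuclideanSpace.single a 1) (EuclideanSpace.single b 1) := by
    intro a b
    have : partialDeriv b f = fun y => fderiv ℝ f y (EuclideanSpace.single b 1) := rfl
    rw [this, partialDeriv, fderiv_clm_apply hd (by fun_prop)]
    simp
  rw [key, key]
  exact (hf.contDiffAt.isSymmSndFDerivAt
    (by rw [minSmoothness_of_isRCLikeNormedField]; exact WithTop.coe_le_coe.2 le_top)) _ _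

lemma integral_mul_partialDeriv {f g : E3 → ℝ} (hf : ContDiff ℝ ∞ f) (hg : ContDiff ℝ ∞ g)
    (hfc : HasCompactSupport f) (j : Fin 3) :
    ∫ x, f x * partialDeriv j g x = - ∫ x, partialDeriv j f x * g x := by
  apply integral_mul_fderiv_eq_neg_fderiv_mul_of_integrable
  · exact ((continuous_partialDeriv hf j).mul hg.continuous).integrable_of_hasCompactSupport
      (hasCompactSupport_partialDeriv hfc j).mul_right
  · exact (hf.continuous.mul (continuous_partialDeriv hg j)).integrable_of_hasCompactSupport
      hfc.mul_right
  · exact (hf.continuous.mul hg.continuous).integrable_of_hasCompactSupport hfc.mul_right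
  · exact fun x _ => hf.differentiable (by simp) x
  · exact fun x _ => hg.differentiable (by simp) x

/-- Both sides equal -∫ f ∂ᵢ∂ⱼg after one integration by parts; compact support of f alone removes
the boundary terms. -/
lemma integral_partialDeriv_mul_swap {f g : E3 → ℝ} (hf : ContDiff ℝ ∞ f) (hg : ContDiff ℝ ∞ g)
    (hfc : HasCompactSupport f) (i j : Fin 3) :
    ∫ x, partialDeriv j f x * partialDeriv i g x =
      ∫ x, partialDeriv i f x * partialDeriv j g x := by
  have h1 := integral_mul_partialDeriv hf (contDiff_partialDeriv hg i) hfc j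
  have h2 := integral_mul_partialDeriv hf (contDiff_partialDeriv hg j) hfc i
  simp_rw [partialDeriv_comm hg j i] at h1
  linarith

/-- Korn's first inequality for smooth compactly supported fields. -/
theorem integral_normSq_jacobian_le (v : Fin 3 → E3 → ℝ) (hv : ∀ i, ContDiff ℝ ∞ (v i))
    (hc : ∀ i, HasCompactSupport (v i)) :
    ∫ x, normSq (jacobian v x) ≤ 2 * ∫ x, normSq (symPart (jacobian v x)) := by
  have hint : ∀ i j k l, Integrable (fun x => partialDeriv j (v i) x * partialDeriv l (v k) x) :=
    fun i j k l => ((continuous_partialDeriv (hv i) j).mul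
      (continuous_partialDeriv (hv k) l)).integrable_of_hasCompactSupport
      (hasCompactSupport_partialDeriv (hc i) j).mul_right
  -- The cross term integrates to ∫(div v)² ≥ 0, so dropping it costs nothing beyond the factor 2.
  have hcross : ∫ x, ∑ i, ∑ j, jacobian v x i j * jacobian v x j i =
      ∫ x, (∑ i, partialDeriv i (v i) x) ^ 2 := by
    simp_rw [pow_two, Finset.sum_mul_sum, jacobian_apply]
    rw [integral_finsetSum _ fun i _ => integrable_finsetSum _ fun j _ => hint i j j i,
      integral_finsetSum _ fun i _ => integrable_finsetSum _ fun j _ => hint i i j j]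
    refine Finset.sum_congr rfl fun i _ => ?_
    rw [integral_finsetSum _ fun j _ => hint i j j i, integral_finsetSum _ fun j _ => hint i i j j]
    exact Finset.sum_congr rfl fun j _ => integral_partialDeriv_mul_swap (hv i) (hv j) (hc i) i j
  have hsq : Integrable (fun x => normSq (jacobian v x)) := by
    refine integrable_finsetSum _ fun i _ => integrable_finsetSum _ fun j _ => ?_
    simp only [pow_two, jacobian_apply]
    exact hint i j i j
  have hcr : Integrable (fun x => ∑ i, ∑ j, jacobian v x i j * jacobian v x j i) :=
    integrable_finsetSum _ fun i _ => integrable_finsetSum _ fun j _ => hint i j j i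
  rw [← integral_const_mul]
  simp_rw [two_mul_normSq_symPart]
  rw [integral_add hsq hcr, hcross]
  have : 0 ≤ ∫ x, (∑ i, partialDeriv i (v i) x) ^ 2 := integral_nonneg fun _ => sq_nonneg _
  linarith

/-! ### Increments along segments -/

/-- The increment of a vector field between two points, tested against their difference. -/
noncomputable def increment (v : Fin 3 → E3 → ℝ) (x y : E3) : ℝ :=
  ∑ i, (v i x - v i y) * (x i - y i)

/-- The skew part of A drops out of the quadratic form; what remains is Cauchy–Schwarz for the
symmetric part against h ⊗ h, whose squared norm is |h|⁴. -/
lemma sq_quadraticForm_le (A : Matrix (Fin 3) (Fin 3) ℝ) (h : E3) :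
    (∑ i, ∑ j, A i j * h i * h j) ^ 2 ≤ ‖h‖ ^ 4 * normSq (symPart A) := by
  have h1 : ∑ i, ∑ j, A i j * h i * h j =
      ∑ p : Fin 3 × Fin 3, symPart A p.1 p.2 * (h p.1 * h p.2) := by
    rw [Fintype.sum_prod_type]
    simp only [symPart, Matrix.smul_apply, Matrix.add_apply, Matrix.transpose_apply,
      Fin.sum_univ_three, smul_eq_mul]
    ring
  have h2 : ‖h‖ ^ 4 = ∑ p : Fin 3 × Fin 3, (h p.1 * h p.2) ^ 2 := by
    have : ‖h‖ ^ 4 = (‖h‖ ^ 2) ^ 2 := by ring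
    rw [this, EuclideanSpace.real_norm_sq_eq, Fintype.sum_prod_type]
    simp only [Fin.sum_univ_three]
    ring
  have h3 : normSq (symPart A) = ∑ p : Fin 3 × Fin 3, symPart A p.1 p.2 ^ 2 := by
    rw [Fintype.sum_prod_type]; rfl
  rw [h1, h2, h3, mul_comm]
  exact Finset.sum_mul_sq_le_sq_mul_sq _ _ _

lemma fderiv_apply_eq_sum (f : E3 → ℝ) (x h : E3) :
    fderiv ℝ f x h = ∑ j, partialDeriv j f x * h j := by
  conv_lhs => rw [← (EuclideanSpace.basisFun (Fin 3) ℝ).sum_repr h]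
  simp only [map_sum, map_smul, EuclideanSpace.basisFun_repr, EuclideanSpace.basisFun_apply,
    smul_eq_mul, partialDeriv]
  exact Finset.sum_congr rfl fun _ _ => mul_comm _ _

lemma continuous_normSq_symPart_jacobian {v : Fin 3 → E3 → ℝ} (hv : ∀ i, ContDiff ℝ ∞ (v i)) :
    Continuous fun x => normSq (symPart (jacobian v x)) := by
  simp only [normSq, symPart, Matrix.smul_apply, Matrix.add_apply, Matrix.transpose_apply, jacobian]
  have := fun i j => continuous_partialDeriv (hv i) j
  fun_prop

/-- Fundamental theorem of calculus for t ↦ v(y + t(x - y))·(x - y). Testing against x - y itself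
makes the derivative a quadratic form, which only sees the strain. -/
lemma increment_eq_integral {v : Fin 3 → E3 → ℝ} (hv : ∀ i, ContDiff ℝ ∞ (v i)) (x y : E3) :
    increment v x y = ∫ t in (0 : ℝ)..1,
      ∑ i, ∑ j, jacobian v (y + t • (x - y)) i j * (x - y) i * (x - y) j := by
  have hd : ∀ t ∈ uIcc (0 : ℝ) 1, HasDerivAt (fun t : ℝ => ∑ i, v i (y + t • (x - y)) * (x - y) i)
      (∑ i, ∑ j, jacobian v (y + t • (x - y)) i j * (x - y) i * (x - y) j) t := by
    intro t _
    refine HasDerivAt.fun_sum fun i _ => ?_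
    have hl : HasDerivAt (fun t : ℝ => y + t • (x - y)) (x - y) t := by
      simpa using ((hasDerivAt_id t).smul_const (x - y)).const_add y
    have := (((hv i).differentiable (by simp)) (y + t • (x - y))).hasFDerivAt.comp_hasDerivAt t hl
    have h2 := this.mul_const ((x - y) i)
    rw [fderiv_apply_eq_sum, Finset.sum_mul] at h2
    have h3 : ∑ j, jacobian v (y + t • (x - y)) i j * (x - y) i * (x - y) j =
        ∑ j, partialDeriv j (v i) (y + t • (x - y)) * (x - y) j * (x - y) i :=
      Finset.sum_congr rfl fun j _ => by rw [jacobian_apply]; ring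
    rw [h3]
    exact h2
  have hcont : Continuous fun t : ℝ =>
      ∑ i, ∑ j, jacobian v (y + t • (x - y)) i j * (x - y) i * (x - y) j := by
    have := fun i j => continuous_partialDeriv (hv i) j
    simp only [jacobian]
    fun_prop
  rw [intervalIntegral.integral_eq_sub_of_hasDerivAt hd (hcont.intervalIntegrable _ _),
    ← Finset.sum_sub_distrib]
  simp only [increment, one_smul, zero_smul, add_zero, add_sub_cancel, PiLp.sub_apply]
  exact Finset.sum_congr rfl fun i _ => by ring

/-- The strain energy density of a smooth field, as an extended nonnegative function. -/
noncomputable def strainDensity (v : Fin 3 → E3 → ℝ) (x : E3) : ℝ≥0∞ :=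
  ENNReal.ofReal (normSq (symPart (jacobian v x)))

lemma measurable_strainDensity {v : Fin 3 → E3 → ℝ} (hv : ∀ i, ContDiff ℝ ∞ (v i)) :
    Measurable (strainDensity v) :=
  (continuous_normSq_symPart_jacobian hv).measurable.ennreal_ofReal

lemma sq_increment_le {v : Fin 3 → E3 → ℝ} (hv : ∀ i, ContDiff ℝ ∞ (v i)) (x y : E3) :
    ENNReal.ofReal (increment v x y ^ 2) ≤ ENNReal.ofReal (‖x - y‖ ^ 4) *
      ∫⁻ t in Icc (0 : ℝ) 1, strainDensity v (y + t • (x - y)) := by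
  have hcont : Continuous fun t : ℝ =>
      ∑ i, ∑ j, jacobian v (y + t • (x - y)) i j * (x - y) i * (x - y) j := by
    have := fun i j => continuous_partialDeriv (hv i) j
    simp only [jacobian]
    fun_prop
  have hcont2 : Continuous fun t : ℝ => normSq (symPart (jacobian v (y + t • (x - y)))) :=
    (continuous_normSq_symPart_jacobian hv).comp (by fun_prop)
  have hreal : increment v x y ^ 2 ≤ ‖x - y‖ ^ 4 *
      ∫ t in Icc (0 : ℝ) 1, normSq (symPart (jacobian v (y + t • (x - y)))) := by
    rw [increment_eq_integral hv, intervalIntegral.integral_of_le zero_le_one,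
      ← integral_Icc_eq_integral_Ioc, ← integral_const_mul]
    have : IsProbabilityMeasure (volume.restrict (Icc (0 : ℝ) 1)) := ⟨by simp⟩
    -- Jensen's inequality for the square on the unit interval.
    refine (ConvexOn.map_integral_le (g := fun s : ℝ => s ^ 2) (even_two.convexOn_pow)
      (by fun_prop) isClosed_univ (by simp) (hcont.integrableOn_Icc)
      ((hcont.pow 2).integrableOn_Icc)).trans ?_
    exact integral_mono ((hcont.pow 2).integrableOn_Icc)
      ((hcont2.integrableOn_Icc).const_mul _) fun t => sq_quadraticForm_le _ _
  refine (ENNReal.ofReal_le_ofReal hreal).trans ?_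
  rw [ENNReal.ofReal_mul (by positivity),
    ofReal_integral_eq_lintegral_ofReal hcont2.integrableOn_Icc
      (Eventually.of_forall fun _ => normSq_nonneg _)]
  rfl

/-! ### Affine changes of variables -/

lemma lintegral_comp_add_smul (F : E3 → ℝ≥0∞) (hF : Measurable F) (a : E3) {t : ℝ} (ht : 0 < t) :
    ∫⁻ x, F (a + t • x) = ENNReal.ofReal ((t ^ 3)⁻¹) * ∫⁻ x, F x := by
  have h := Measure.map_addHaar_smul (volume : Measure E3) ht.ne'
  have h2 : ∫⁻ x, F (a + t • x) = ∫⁻ x, F (a + x) ∂(Measure.map (t • ·) (volume : Measure E3)) :=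
    (lintegral_map (f := fun x => F (a + x)) (by fun_prop) (by fun_prop)).symm
  rw [h2, h, lintegral_smul_measure, lintegral_add_left_eq_self F a]
  simp [abs_of_pos ht]

lemma lintegral_ball_comp_add_smul (F : E3 → ℝ≥0∞) (hF : Measurable F) (a : E3) {t s : ℝ}
    (ht : 0 < t) :
    ∫⁻ x in ball 0 s, F (a + t • x) = ENNReal.ofReal ((t ^ 3)⁻¹) * ∫⁻ x in ball a (t * s), F x := by
  have h := lintegral_comp_add_smul ((ball a (t * s)).indicator F)
    (hF.indicator measurableSet_ball) a ht
  rw [lintegral_indicator measurableSet_ball] at h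
  rw [← h, ← lintegral_indicator measurableSet_ball]
  refine lintegral_congr fun x => ?_
  have : x ∈ ball (0 : E3) s ↔ a + t • x ∈ ball a (t * s) := by
    rw [mem_ball_zero_iff, mem_ball, dist_eq_norm, add_sub_cancel_left, norm_smul,
      Real.norm_of_nonneg ht.le, mul_lt_mul_iff_right₀ ht]
  by_cases hx : x ∈ ball (0 : E3) s
  · rw [indicator_of_mem hx, indicator_of_mem (this.1 hx)]
  · rw [indicator_of_notMem hx, indicator_of_notMem (fun h => hx (this.2 h))]

/-- For fixed y the map x ↦ y + t(x - y) sends the ball into itself by convexity and has Jacobian t³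
≥ 1/8. -/
lemma lintegral_interpolate_le_of_half_le (F : E3 → ℝ≥0∞) (hF : Measurable F) {s t : ℝ}
    (ht : 1 / 2 ≤ t) (ht1 : t ≤ 1) :
    ∫⁻ y in ball (0 : E3) s, ∫⁻ x in ball (0 : E3) s, F (y + t • (x - y)) ≤
      8 * volume (ball (0 : E3) s) * ∫⁻ x in ball 0 s, F x := by
  have h : ∀ y ∈ ball (0 : E3) s, ∫⁻ x in ball (0 : E3) s, F (y + t • (x - y)) ≤
      8 * ∫⁻ x in ball 0 s, F x := by
    intro y hy
    have htp : 0 < t := by linarith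
    have e1 : ∀ x, y + t • (x - y) = (1 - t) • y + t • x := fun x => by module
    calc ∫⁻ x in ball (0 : E3) s, F (y + t • (x - y))
        ≤ ∫⁻ x, (ball 0 s).indicator F ((1 - t) • y + t • x) := by
          rw [← lintegral_indicator measurableSet_ball]
          refine lintegral_mono fun x => ?_
          by_cases hx : x ∈ ball (0 : E3) s
          swap
          · rw [indicator_of_notMem hx]; exact zero_le
          have : (1 - t) • y + t • x ∈ ball (0 : E3) s :=
            (convex_ball (0 : E3) s) hy hx (by linarith) htp.le (by ring)
          rw [indicator_of_mem hx, indicator_of_mem this, e1]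
      _ = ENNReal.ofReal ((t ^ 3)⁻¹) * ∫⁻ x in ball 0 s, F x := by
          rw [lintegral_comp_add_smul _ (hF.indicator measurableSet_ball) _ htp,
            lintegral_indicator measurableSet_ball]
      _ ≤ 8 * ∫⁻ x in ball 0 s, F x := by
          gcongr
          have : (t ^ 3)⁻¹ ≤ 8 := by
            rw [inv_le_comm₀ (by positivity) (by norm_num)]
            calc (8 : ℝ)⁻¹ = (1 / 2) ^ 3 := by norm_num
              _ ≤ t ^ 3 := by gcongr
          exact (ENNReal.ofReal_le_ofReal this).trans (by simp)
  refine (setLIntegral_mono measurable_const h).trans ?_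
  rw [setLIntegral_const]
  exact le_of_eq (by ring)

/-- Exchanging x and y replaces t by 1 - t, and one of the two is at least 1/2. -/
lemma lintegral_interpolate_le (F : E3 → ℝ≥0∞) (hF : Measurable F) {s t : ℝ}
    (ht : 0 ≤ t) (ht1 : t ≤ 1) :
    ∫⁻ y in ball (0 : E3) s, ∫⁻ x in ball (0 : E3) s, F (y + t • (x - y)) ≤
      8 * volume (ball (0 : E3) s) * ∫⁻ x in ball 0 s, F x := by
  rcases le_total (1 / 2) t with h | h
  · exact lintegral_interpolate_le_of_half_le F hF h ht1
  · have := lintegral_interpolate_le_of_half_le F hF (s := s) (t := 1 - t) (by linarith)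
      (by linarith)
    rw [lintegral_lintegral_swap]
    · refine le_trans (le_of_eq ?_) this
      refine lintegral_congr fun x => lintegral_congr fun y => ?_
      congr 1
      module
    · exact Measurable.aemeasurable (by fun_prop)

/-! ### Rigid approximation of smooth fields on balls -/

/-- The vertices of a small reference simplex. -/
noncomputable def simplexVertex : Option (Fin 3) → E3
  | none => 0
  | some k => EuclideanSpace.single k (1 / 2)

lemma norm_simplexVertex_le (k : Option (Fin 3)) : ‖simplexVertex k‖ ≤ 1 / 2 := by
  cases k <;> simp [simplexVertex]

lemma continuous_increment {v : Fin 3 → E3 → ℝ} (hv : ∀ i, ContDiff ℝ ∞ (v i)) :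
    Continuous fun p : E3 × E3 => increment v p.1 p.2 := by
  have := fun i => (hv i).continuous
  simp only [increment]
  fun_prop

/-- The constant is 4⁴ · 8: two points of the ball are less than 4 apart, and 8 is the interpolation
constant. -/
lemma lintegral_sq_increment_le {v : Fin 3 → E3 → ℝ} (hv : ∀ i, ContDiff ℝ ∞ (v i)) :
    ∫⁻ y in ball (0 : E3) 2, ∫⁻ x in ball (0 : E3) 2, ENNReal.ofReal (increment v x y ^ 2) ≤
      2048 * volume (ball (0 : E3) 2) * ∫⁻ x in ball 0 2, strainDensity v x := by
  have hm := measurable_strainDensity hv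
  calc _ ≤ ∫⁻ y in ball (0 : E3) 2, ∫⁻ x in ball (0 : E3) 2,
        256 * ∫⁻ t in Icc (0 : ℝ) 1, strainDensity v (y + t • (x - y)) := by
        refine setLIntegral_mono' measurableSet_ball fun y hy =>
          setLIntegral_mono' measurableSet_ball fun x hx => (sq_increment_le hv x y).trans ?_
        gcongr
        have h4 : ‖x - y‖ ≤ 4 := by
          rw [mem_ball_zero_iff] at hx hy
          linarith [norm_sub_le x y]
        have : ‖x - y‖ ^ 4 ≤ 256 := by
          calc ‖x - y‖ ^ 4 ≤ 4 ^ 4 := by gcongr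
            _ = 256 := by norm_num
        exact (ENNReal.ofReal_le_ofReal this).trans (by simp)
    _ = 256 * ∫⁻ t in Icc (0 : ℝ) 1, ∫⁻ y in ball (0 : E3) 2, ∫⁻ x in ball (0 : E3) 2,
          strainDensity v (y + t • (x - y)) := by
        have e1 : ∀ y : E3, ∫⁻ x in ball (0 : E3) 2,
            256 * ∫⁻ t in Icc (0 : ℝ) 1, strainDensity v (y + t • (x - y)) =
            256 * ∫⁻ t in Icc (0 : ℝ) 1, ∫⁻ x in ball (0 : E3) 2,
              strainDensity v (y + t • (x - y)) := by
          intro y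
          rw [lintegral_const_mul' _ _ (by simp), lintegral_lintegral_swap]
          exact Measurable.aemeasurable (by fun_prop)
        simp_rw [e1]
        rw [lintegral_const_mul' _ _ (by simp), lintegral_lintegral_swap]
        refine Measurable.aemeasurable ?_
        exact Measurable.lintegral_prod_right'
          (f := fun p : (E3 × ℝ) × E3 => strainDensity v (p.1.1 + p.1.2 • (p.2 - p.1.1)))
          (by fun_prop)
    _ ≤ 256 * ∫⁻ t in Icc (0 : ℝ) 1,
          8 * volume (ball (0 : E3) 2) * ∫⁻ x in ball 0 2, strainDensity v x := by
        gcongr 256 * ?_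
        exact setLIntegral_mono measurable_const fun t ht =>
          lintegral_interpolate_le _ hm ht.1 ht.2
    _ = _ := by
        rw [setLIntegral_const]
        simp only [Real.volume_Icc, sub_zero, ENNReal.ofReal_one, mul_one]
        ring

lemma lintegral_sq_increment_translate_le {v : Fin 3 → E3 → ℝ} (hv : ∀ i, ContDiff ℝ ∞ (v i))
    {a b : E3} (ha : ‖a‖ ≤ 1 / 2) (hb : ‖b‖ ≤ 1 / 2) :
    ∫⁻ y in ball (0 : E3) 1, ENNReal.ofReal (increment v (y + a) (y + b) ^ 2) ≤
      ∫⁻ x in ball 0 2, strainDensity v x := by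
  have hm := measurable_strainDensity hv
  calc _ ≤ ∫⁻ y in ball (0 : E3) 1, ∫⁻ t in Icc (0 : ℝ) 1,
        strainDensity v (y + (b + t • (a - b))) := by
        refine lintegral_mono fun y => (sq_increment_le hv _ _).trans ?_
        have h1 : ‖(y + a) - (y + b)‖ ^ 4 ≤ 1 := by
          rw [add_sub_add_left_eq_sub]
          exact pow_le_one₀ (norm_nonneg _) (by linarith [norm_sub_le a b])
        calc _ ≤ 1 * ∫⁻ t in Icc (0 : ℝ) 1, strainDensity v (y + b + t • (y + a - (y + b))) := by
              gcongr
              exact (ENNReal.ofReal_le_ofReal h1).trans (by simp)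
          _ = _ := by
              rw [one_mul]
              refine lintegral_congr fun t => ?_
              congr 1
              module
    _ = ∫⁻ t in Icc (0 : ℝ) 1, ∫⁻ y in ball (0 : E3) 1,
        strainDensity v (y + (b + t • (a - b))) := by
        rw [lintegral_lintegral_swap]
        exact Measurable.aemeasurable (by fun_prop)
    _ ≤ ∫⁻ t in Icc (0 : ℝ) 1, ∫⁻ x in ball 0 2, strainDensity v x := by
        refine setLIntegral_mono measurable_const fun t ht => ?_
        have hc : ‖b + t • (a - b)‖ ≤ 1 := by
          have : b + t • (a - b) ∈ closedBall (0 : E3) (1 / 2) := by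
            have := (convex_closedBall (0 : E3) (1 / 2)) (by simpa using hb) (by simpa using ha)
              (sub_nonneg.2 ht.2) ht.1 (by ring)
            convert this using 1
            module
          rw [mem_closedBall_zero_iff] at this
          linarith
        have h := lintegral_ball_comp_add_smul (strainDensity v) hm (b + t • (a - b)) (s := 1)
          one_pos
        simp only [one_smul, one_pow, inv_one, ENNReal.ofReal_one, one_mul, mul_one] at h
        simp_rw [add_comm _ (b + t • (a - b))]
        rw [h]
        exact lintegral_mono_set (ball_subset_ball' (by rw [dist_zero_right]; linarith))
    _ = _ := by rw [setLIntegral_const]; simp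

/-- Some base point in the unit ball makes the sum of all these nonnegative quantities at most its
average. There are 4 vertices and 16 ordered pairs of vertices, which gives 4 · 2048 V + 16. -/
lemma exists_good_simplex : ∃ K : ℝ≥0∞, K ≠ ⊤ ∧ ∀ v : Fin 3 → E3 → ℝ,
    (∀ i, ContDiff ℝ ∞ (v i)) → ∃ y : E3,
      (∀ k, ∫⁻ x in ball (0 : E3) 2, ENNReal.ofReal (increment v x (y + simplexVertex k) ^ 2) ≤
        K * ∫⁻ x in ball 0 2, strainDensity v x) ∧
      ∀ k l, ENNReal.ofReal (increment v (y + simplexVertex k) (y + simplexVertex l) ^ 2) ≤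
        K * ∫⁻ x in ball 0 2, strainDensity v x := by
  set V := volume (ball (0 : E3) 2) with hV
  have hV1 : volume (ball (0 : E3) 1) ≠ 0 := (measure_ball_pos _ _ one_pos).ne'
  have hV1' : volume (ball (0 : E3) 1) ≠ ⊤ := measure_ball_lt_top.ne
  have hVt : V ≠ ⊤ := measure_ball_lt_top.ne
  refine ⟨(4 * (2048 * V) + 16) / volume (ball (0 : E3) 1),
    ENNReal.div_ne_top (by finiteness) hV1, fun v hv => ?_⟩
  set I := ∫⁻ x in ball 0 2, strainDensity v x with hI
  have hc := continuous_increment hv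
  set Φ : Option (Fin 3) → E3 → ℝ≥0∞ := fun k y =>
    ∫⁻ x in ball (0 : E3) 2, ENNReal.ofReal (increment v x (y + simplexVertex k) ^ 2) with hΦ
  set Ψ : Option (Fin 3) → Option (Fin 3) → E3 → ℝ≥0∞ := fun k l y =>
    ENNReal.ofReal (increment v (y + simplexVertex k) (y + simplexVertex l) ^ 2) with hΨ
  have hΦm : ∀ k, Measurable (Φ k) := fun k =>
    Measurable.lintegral_prod_right'
      (f := fun p : E3 × E3 => ENNReal.ofReal (increment v p.2 (p.1 + simplexVertex k) ^ 2))
      (((hc.comp (f := fun p : E3 × E3 => (p.2, p.1 + simplexVertex k))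
        (by fun_prop)).pow 2).measurable.ennreal_ofReal)
  have hΨm : ∀ k l, Measurable (Ψ k l) := fun k l =>
    ((hc.comp (f := fun y : E3 => (y + simplexVertex k, y + simplexVertex l))
        (by fun_prop)).pow 2).measurable.ennreal_ofReal
  have hΦi : ∀ k, ∫⁻ y in ball (0 : E3) 1, Φ k y ≤ 2048 * V * I := by
    intro k
    refine le_trans ?_ (lintegral_sq_increment_le hv)
    have hm : Measurable fun y : E3 => ∫⁻ x in ball (0 : E3) 2,
        ENNReal.ofReal (increment v x y ^ 2) :=
      Measurable.lintegral_prod_right'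
        (f := fun p : E3 × E3 => ENNReal.ofReal (increment v p.2 p.1 ^ 2))
        (((hc.comp continuous_swap).pow 2).measurable.ennreal_ofReal)
    have h := lintegral_ball_comp_add_smul _ hm (simplexVertex k) (s := 1) one_pos
    simp only [one_smul, one_pow, inv_one, ENNReal.ofReal_one, one_mul, mul_one] at h
    simp only [hΦ]
    simp_rw [add_comm _ (simplexVertex k)]
    rw [h]
    exact lintegral_mono_set (ball_subset_ball' (by
      rw [dist_zero_right]; linarith [norm_simplexVertex_le k]))
  have hsum : ∫⁻ y in ball (0 : E3) 1, (∑ k, Φ k y + ∑ k, ∑ l, Ψ k l y) ≤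
      (4 * (2048 * V) + 16) * I := by
    rw [lintegral_add_left (Finset.measurable_sum _ fun k _ => hΦm k),
      lintegral_finsetSum _ fun k _ => hΦm k,
      lintegral_finsetSum _ fun k _ => Finset.measurable_sum _ fun l _ => hΨm k l]
    simp_rw [lintegral_finsetSum _ fun l _ => hΨm _ l]
    calc _ ≤ ∑ _k : Option (Fin 3), 2048 * V * I +
          ∑ _k : Option (Fin 3), ∑ _l : Option (Fin 3), I := by
          gcongr with k _ k _ l _
          · exact hΦi k
          · exact lintegral_sq_increment_translate_le hv (norm_simplexVertex_le k)
              (norm_simplexVertex_le l)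
      _ = _ := by simp; ring
  obtain ⟨y, -, hy⟩ := exists_le_setLAverage hV1 hV1'
    (f := fun y => ∑ k, Φ k y + ∑ k, ∑ l, Ψ k l y)
    (Measurable.aemeasurable ((Finset.measurable_sum _ fun k _ => hΦm k).add
      (Finset.measurable_sum _ fun k _ => Finset.measurable_sum _ fun l _ => hΨm k l)))
  rw [setLAverage_eq] at hy
  have hy' : ∑ k, Φ k y + ∑ k, ∑ l, Ψ k l y ≤
      (4 * (2048 * V) + 16) / volume (ball (0 : E3) 1) * I := by
    refine hy.trans ((ENNReal.div_le_div_right hsum _).trans (le_of_eq ?_))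
    rw [mul_comm, mul_div_assoc, mul_comm]
  refine ⟨y, fun k => ?_, fun k l => ?_⟩
  · exact (Finset.single_le_sum (f := fun k => Φ k y) (fun _ _ => zero_le)
      (Finset.mem_univ k)).trans (le_self_add.trans hy')
  · exact ((Finset.single_le_sum (f := fun l => Ψ k l y) (fun _ _ => zero_le)
      (Finset.mem_univ l)).trans (Finset.single_le_sum (f := fun k => ∑ l, Ψ k l y)
      (fun _ _ => zero_le) (Finset.mem_univ k))).trans (le_add_self.trans hy')

/-! ### Affine approximation and cut-off. -/

lemma lintegral_normSq_jacobian_le (v : Fin 3 → E3 → ℝ) (hv : ∀ i, ContDiff ℝ ∞ (v i))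
    (hc : ∀ i, HasCompactSupport (v i)) :
    ∫⁻ x, ENNReal.ofReal (normSq (jacobian v x)) ≤ 2 * ∫⁻ x, strainDensity v x := by
  have hint : Integrable fun x => normSq (jacobian v x) := by
    refine integrable_finsetSum _ fun i _ => integrable_finsetSum _ fun j _ => ?_
    simp only [pow_two, jacobian_apply]
    exact ((continuous_partialDeriv (hv i) j).mul
      (continuous_partialDeriv (hv i) j)).integrable_of_hasCompactSupport
      (hasCompactSupport_partialDeriv (hc i) j).mul_right
  have hint2 : Integrable fun x => normSq (symPart (jacobian v x)) :=
    hint.mono' (continuous_normSq_symPart_jacobian hv).aestronglyMeasurable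
      (Eventually.of_forall fun x => by
        rw [Real.norm_of_nonneg (normSq_nonneg _)]; exact normSq_symPart_le _)
  simp only [strainDensity]
  rw [← ofReal_integral_eq_lintegral_ofReal hint (Eventually.of_forall fun _ => normSq_nonneg _),
    ← ofReal_integral_eq_lintegral_ofReal hint2 (Eventually.of_forall fun _ => normSq_nonneg _)]
  calc _ ≤ ENNReal.ofReal (2 * ∫ x, normSq (symPart (jacobian v x))) :=
        ENNReal.ofReal_le_ofReal (integral_normSq_jacobian_le v hv hc)
    _ = _ := by rw [ENNReal.ofReal_mul (by norm_num)]; simp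

/-- The linear part of the affine interpolant of a vector field at a simplex, as obtained from
increments. -/
noncomputable def interpMatrix (v : Fin 3 → E3 → ℝ) (y : E3) : Matrix (Fin 3) (Fin 3) ℝ :=
  fun k l => -2 * (v l (y + simplexVertex (some k)) - v l (y + simplexVertex none))

/-- The difference between a vector field and its affine interpolant. -/
noncomputable def interpError (v : Fin 3 → E3 → ℝ) (y : E3) (k : Fin 3) (x : E3) : ℝ :=
  2 * (increment v x (y + simplexVertex none) - increment v x (y + simplexVertex (some k)))

/-- The term v(x)·x cancels between the two increments, leaving half of v_k(x) plus an affine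
function of x. The matrix that appears is minus the transpose of the difference-quotient Jacobian;
the two agree when the latter is skew, as for rigid motions. -/
lemma exists_interpError_eq (v : Fin 3 → E3 → ℝ) (y : E3) (k : Fin 3) : ∃ b : ℝ, ∀ x,
    interpError v y k x = v k x - ∑ l, interpMatrix v y k l * x l - b := by
  refine ⟨-2 * ∑ i, (v i (y + simplexVertex none) * (y + simplexVertex none) i -
    v i (y + simplexVertex (some k)) * (y + simplexVertex (some k)) i), fun x => ?_⟩
  fin_cases k <;>
  · simp [interpError, interpMatrix, increment, simplexVertex, Fin.sum_univ_three]
    ring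

/-- Polarization: increments along the edges of the simplex determine the symmetric part of the
linear map, so small increments force it to be nearly skew. -/
lemma symPart_interpMatrix (v : Fin 3 → E3 → ℝ) (y : E3) (k l : Fin 3) :
    symPart (interpMatrix v y) k l =
      2 * (increment v (y + simplexVertex (some k)) (y + simplexVertex (some l)) -
        increment v (y + simplexVertex (some k)) (y + simplexVertex none) -
        increment v (y + simplexVertex (some l)) (y + simplexVertex none)) := by
  fin_cases k <;> fin_cases l <;>
  · simp [symPart, interpMatrix, increment, simplexVertex, Fin.sum_univ_three]
    ring

lemma contDiff_interpError {v : Fin 3 → E3 → ℝ} (hv : ∀ i, ContDiff ℝ ∞ (v i)) (y : E3)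
    (k : Fin 3) : ContDiff ℝ ∞ (interpError v y k) := by
  have hc : ∀ i : Fin 3, ContDiff ℝ ∞ fun x : E3 => x i := fun i =>
    (EuclideanSpace.proj (𝕜 := ℝ) i).contDiff
  have h : ∀ q : E3, ContDiff ℝ ∞ fun x => increment v x q := fun q =>
    ContDiff.sum fun i _ => ((hv i).sub contDiff_const).mul ((hc i).sub contDiff_const)
  exact contDiff_const.mul ((h _).sub (h _))

lemma jacobian_interpError {v : Fin 3 → E3 → ℝ} (hv : ∀ i, ContDiff ℝ ∞ (v i)) (y x : E3) :
    jacobian (interpError v y) x = jacobian v x - interpMatrix v y := by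
  ext i j
  obtain ⟨b, hb⟩ := exists_interpError_eq v y i
  rw [Matrix.sub_apply, jacobian_apply, jacobian_apply, show interpError v y i = _ from funext hb]
  have h1 : HasFDerivAt (v i) (fderiv ℝ (v i) x) x :=
    ((hv i).differentiable (by simp) x).hasFDerivAt
  have h2 : HasFDerivAt (fun x : E3 => ∑ l, interpMatrix v y i l * x l)
      (∑ l, interpMatrix v y i l • (EuclideanSpace.proj (𝕜 := ℝ) l : E3 →L[ℝ] ℝ)) x :=
    HasFDerivAt.fun_sum fun l _ =>
      ((EuclideanSpace.proj (𝕜 := ℝ) l : E3 →L[ℝ] ℝ).hasFDerivAt).const_mul _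
  have h3 : HasFDerivAt (fun x : E3 => v i x - ∑ l, interpMatrix v y i l * x l - b)
      (fderiv ℝ (v i) x -
        ∑ l, interpMatrix v y i l • (EuclideanSpace.proj (𝕜 := ℝ) l : E3 →L[ℝ] ℝ)) x :=
    (h1.sub h2).sub_const b
  rw [partialDeriv, h3.fderiv]
  simp [partialDeriv]

lemma symPart_sub (A B : Matrix (Fin 3) (Fin 3) ℝ) : symPart (A - B) = symPart A - symPart B := by
  simp only [symPart, Matrix.transpose_sub]
  module

lemma symPart_add (A B : Matrix (Fin 3) (Fin 3) ℝ) : symPart (A + B) = symPart A + symPart B := by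
  simp only [symPart, Matrix.transpose_add]
  module

lemma symPart_smul (c : ℝ) (A : Matrix (Fin 3) (Fin 3) ℝ) : symPart (c • A) = c • symPart A := by
  simp only [symPart, Matrix.transpose_smul]
  module

lemma normSq_smul (c : ℝ) (A : Matrix (Fin 3) (Fin 3) ℝ) : normSq (c • A) = c ^ 2 * normSq A := by
  simp only [normSq, Matrix.smul_apply, smul_eq_mul, mul_pow, Finset.mul_sum]

lemma normSq_add_le (A B : Matrix (Fin 3) (Fin 3) ℝ) :
    normSq (A + B) ≤ 2 * normSq A + 2 * normSq B := by
  simp only [normSq, Finset.mul_sum, ← Finset.sum_add_distrib]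
  refine Finset.sum_le_sum fun i _ => Finset.sum_le_sum fun j _ => ?_
  rw [Matrix.add_apply]
  nlinarith [sq_nonneg (A i j - B i j)]

lemma normSq_sub_le (A B : Matrix (Fin 3) (Fin 3) ℝ) :
    normSq (A - B) ≤ 2 * normSq A + 2 * normSq B := by
  simp only [normSq, Finset.mul_sum, ← Finset.sum_add_distrib]
  refine Finset.sum_le_sum fun i _ => Finset.sum_le_sum fun j _ => ?_
  rw [Matrix.sub_apply]
  nlinarith [sq_nonneg (A i j + B i j)]

lemma jacobian_mul {χ : E3 → ℝ} {w : Fin 3 → E3 → ℝ} (hχ : ContDiff ℝ ∞ χ)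
    (hw : ∀ i, ContDiff ℝ ∞ (w i)) (x : E3) :
    jacobian (fun i x => χ x * w i x) x =
      χ x • jacobian w x + Matrix.of fun i j => partialDeriv j χ x * w i x := by
  ext i j
  simp only [jacobian_apply, Matrix.add_apply, Matrix.smul_apply, Matrix.of_apply, partialDeriv]
  rw [fderiv_fun_mul (hχ.differentiable (by simp) x) ((hw i).differentiable (by simp) x)]
  simp only [_root_.add_apply, _root_.smul_apply, smul_eq_mul]
  ring

lemma ofReal_normSq_eq (A : Matrix (Fin 3) (Fin 3) ℝ) :
    ENNReal.ofReal (normSq A) = ∑ i, ∑ j, ENNReal.ofReal (A i j ^ 2) :=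
  (ENNReal.ofReal_sum_of_nonneg (s := Finset.univ) (f := fun i => ∑ j, A i j ^ 2)
    fun _ _ => Finset.sum_nonneg fun _ _ => sq_nonneg _).trans
    (Finset.sum_congr rfl fun i _ => ENNReal.ofReal_sum_of_nonneg (s := Finset.univ)
      (f := fun j => A i j ^ 2) fun _ _ => sq_nonneg _)

lemma ofReal_normSq_le {A : Matrix (Fin 3) (Fin 3) ℝ} {c : ℝ≥0∞}
    (h : ∀ i j, ENNReal.ofReal (A i j ^ 2) ≤ c) : ENNReal.ofReal (normSq A) ≤ 9 * c := by
  rw [ofReal_normSq_eq]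
  refine (Finset.sum_le_sum fun i _ => Finset.sum_le_sum fun j _ => h i j).trans ?_
  simp only [Finset.sum_const, Finset.card_univ, Fintype.card_fin, nsmul_eq_mul]
  rw [← mul_assoc]
  norm_num

/-- A local form of Korn's inequality with a lower order term, obtained by cutting off. -/
lemma exists_korn_lower_order : ∃ K : ℝ≥0∞, K ≠ ⊤ ∧ ∀ w : Fin 3 → E3 → ℝ,
    (∀ i, ContDiff ℝ ∞ (w i)) →
    ∫⁻ x in ball 0 1, ENNReal.ofReal (normSq (jacobian w x)) ≤
      K * ((∫⁻ x in ball 0 2, strainDensity w x) +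
        ∫⁻ x in ball 0 2, ENNReal.ofReal (∑ i, w i x ^ 2)) := by
  -- The cut-off is 1 on the unit ball and supported in radius 3/2 < 2. The strain of χw is χ times
  -- the strain of w plus the symmetric part of w ⊗ ∇χ, the source of the lower order term.
  let χ : ContDiffBump (0 : E3) := ⟨1, 3 / 2, by norm_num, by norm_num⟩
  have hχ : ContDiff ℝ ∞ (χ : E3 → ℝ) := χ.contDiff
  have hcont : Continuous fun x => ∑ j, partialDeriv j χ x ^ 2 :=
    continuous_finsetSum _ fun j _ => (continuous_partialDeriv hχ j).pow 2
  obtain ⟨M, hM⟩ := (isCompact_closedBall (0 : E3) 2).bddAbove_image hcont.continuousOn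
  have hM' : ∀ x ∈ ball (0 : E3) 2, ∑ j, partialDeriv j χ x ^ 2 ≤ max M 1 := fun x hx =>
    (hM ⟨x, ball_subset_closedBall hx, rfl⟩).trans (le_max_left _ _)
  have hM1 : (1 : ℝ) ≤ max M 1 := le_max_right _ _
  refine ⟨2 * ENNReal.ofReal (2 * max M 1), by finiteness, fun w hw => ?_⟩
  set p : Fin 3 → E3 → ℝ := fun i x => χ x * w i x with hp
  have hpc : ∀ i, ContDiff ℝ ∞ (p i) := fun i => hχ.mul (hw i)
  have hps : ∀ i, HasCompactSupport (p i) := fun i => χ.hasCompactSupport.mul_right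
  have h1 : ∫⁻ x in ball 0 1, ENNReal.ofReal (normSq (jacobian w x)) =
      ∫⁻ x in ball 0 1, ENNReal.ofReal (normSq (jacobian p x)) := by
    refine setLIntegral_congr_fun measurableSet_ball fun x hx => ?_
    have : jacobian w x = jacobian p x := by
      ext i j
      have he : p i =ᶠ[𝓝 x] w i := by
        filter_upwards [isOpen_ball.mem_nhds hx] with z hz
        have : (χ : E3 → ℝ) z = 1 := χ.one_of_mem_closedBall (ball_subset_closedBall hz)
        simp only [hp, this, one_mul]
      rw [jacobian_apply, jacobian_apply, partialDeriv, partialDeriv, he.fderiv_eq]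
    simp only [this]
  have h2 : ∫⁻ x, strainDensity p x = ∫⁻ x in ball 0 2, strainDensity p x := by
    symm
    apply setLIntegral_eq_of_support_subset
    intro x hx
    by_contra hxb
    apply hx
    have : jacobian p x = 0 := by
      ext i j
      have hx' : x ∉ tsupport (p i) := fun h => by
        have h' := tsupport_mul_subset_left h
        rw [χ.tsupport_eq, mem_closedBall] at h'
        simp only [mem_ball, not_lt] at hxb
        have : χ.rOut = 3 / 2 := rfl
        exact absurd (hxb.trans (h'.trans_eq this)) (by norm_num)
      rw [jacobian_apply, partialDeriv, fderiv_of_notMem_tsupport ℝ hx']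
      simp
    simp [strainDensity, this, symPart, normSq]
  have h3 : ∀ x ∈ ball (0 : E3) 2, strainDensity p x ≤
      ENNReal.ofReal (2 * max M 1) * (strainDensity w x + ENNReal.ofReal (∑ i, w i x ^ 2)) := by
    intro x hx
    rw [strainDensity, strainDensity, ← ENNReal.ofReal_add (normSq_nonneg _)
      (Finset.sum_nonneg fun _ _ => sq_nonneg _), ← ENNReal.ofReal_mul (by positivity)]
    refine ENNReal.ofReal_le_ofReal ?_
    rw [hp, jacobian_mul hχ hw, symPart_add, symPart_smul]
    have e1 := normSq_add_le ((χ : E3 → ℝ) x • symPart (jacobian w x))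
      (symPart (Matrix.of fun i j => partialDeriv j χ x * w i x))
    rw [normSq_smul] at e1
    have e2 : (χ : E3 → ℝ) x ^ 2 ≤ 1 := pow_le_one₀ χ.nonneg χ.le_one
    have e3 := normSq_symPart_le (Matrix.of fun i j => partialDeriv j χ x * w i x)
    have e4 : normSq (Matrix.of fun i j => partialDeriv j χ x * w i x) =
        (∑ j, partialDeriv j χ x ^ 2) * ∑ i, w i x ^ 2 := by
      rw [normSq, Finset.sum_mul_sum, Finset.sum_comm]
      exact Finset.sum_congr rfl fun j _ => Finset.sum_congr rfl fun i _ => by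
        rw [Matrix.of_apply]; ring
    have hw0 : 0 ≤ ∑ i, w i x ^ 2 := Finset.sum_nonneg fun _ _ => sq_nonneg _
    have e5 := mul_le_mul_of_nonneg_right (hM' x hx) hw0
    have e6 := mul_le_mul_of_nonneg_right (e2.trans hM1) (normSq_nonneg (symPart (jacobian w x)))
    linarith
  rw [h1]
  calc _ ≤ ∫⁻ x, ENNReal.ofReal (normSq (jacobian p x)) := setLIntegral_le_lintegral _ _
    _ ≤ 2 * ∫⁻ x in ball 0 2, strainDensity p x := by
        rw [← h2]; exact lintegral_normSq_jacobian_le p hpc hps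
    _ ≤ 2 * ∫⁻ x in ball 0 2, ENNReal.ofReal (2 * max M 1) *
          (strainDensity w x + ENNReal.ofReal (∑ i, w i x ^ 2)) := by
        gcongr 2 * ?_
        exact setLIntegral_mono' measurableSet_ball h3
    _ = _ := by
        rw [lintegral_const_mul' _ _ (by finiteness),
          lintegral_add_left (measurable_strainDensity hw), mul_assoc]

/-- The cut-off inequality is applied to the interpolation error w at a good simplex. Its strain is
that of v minus the symmetric part of M, controlled by increments between vertices; its L² norm is
controlled by increments between x and the vertices. -/
lemma exists_smooth_unit_korn : ∃ K : ℝ≥0∞, K ≠ ⊤ ∧ ∀ v : Fin 3 → E3 → ℝ,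
    (∀ i, ContDiff ℝ ∞ (v i)) → ∃ M : Matrix (Fin 3) (Fin 3) ℝ, ∀ i j,
    ∫⁻ x in ball 0 1, ENNReal.ofReal ((partialDeriv j (v i) x - M i j) ^ 2) ≤
      K * ∫⁻ x in ball 0 2, strainDensity v x := by
  obtain ⟨K₁, hK₁, h₁⟩ := exists_good_simplex
  obtain ⟨K₂, hK₂, h₂⟩ := exists_korn_lower_order
  have hV : volume (ball (0 : E3) 2) ≠ ⊤ := measure_ball_lt_top.ne
  refine ⟨K₂ * (2 + 648 * K₁ * volume (ball (0 : E3) 2) + 48 * K₁), by finiteness,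
    fun v hv => ?_⟩
  obtain ⟨y, hy1, hy2⟩ := h₁ v hv
  set I := ∫⁻ x in ball 0 2, strainDensity v x with hI
  set V := volume (ball (0 : E3) 2)
  set M := interpMatrix v y with hMdef
  set w := interpError v y with hwdef
  have hw : ∀ i, ContDiff ℝ ∞ (w i) := contDiff_interpError hv y
  refine ⟨M, fun i j => ?_⟩
  have hM : ENNReal.ofReal (normSq (symPart M)) ≤ 324 * K₁ * I := by
    calc _ ≤ 9 * (36 * K₁ * I) := by
          refine ofReal_normSq_le fun k l => ?_
          rw [hMdef, symPart_interpMatrix]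
          set a := increment v (y + simplexVertex (some k)) (y + simplexVertex (some l))
          set b := increment v (y + simplexVertex (some k)) (y + simplexVertex none)
          set c := increment v (y + simplexVertex (some l)) (y + simplexVertex none)
          have : (2 * (a - b - c)) ^ 2 ≤ 12 * (a ^ 2 + b ^ 2 + c ^ 2) := by
            nlinarith [sq_nonneg (a + b), sq_nonneg (a + c), sq_nonneg (b - c)]
          refine (ENNReal.ofReal_le_ofReal this).trans ?_
          rw [ENNReal.ofReal_mul (by norm_num), ENNReal.ofReal_add (by positivity) (by positivity),
            ENNReal.ofReal_add (by positivity) (by positivity)]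
          calc _ ≤ 12 * (K₁ * I + K₁ * I + K₁ * I) := by
                gcongr
                · simp
                · exact hy2 _ _
                · exact hy2 _ _
                · exact hy2 _ _
            _ = _ := by ring
      _ = _ := by ring
  have hs : ∫⁻ x in ball 0 2, strainDensity w x ≤ 2 * I + 648 * K₁ * V * I := by
    calc _ ≤ ∫⁻ x in ball 0 2, (2 * strainDensity v x + 648 * K₁ * I) := by
          refine lintegral_mono fun x => ?_
          rw [strainDensity, hwdef, jacobian_interpError hv, symPart_sub]
          refine (ENNReal.ofReal_le_ofReal (normSq_sub_le _ _)).trans ?_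
          have := normSq_nonneg (symPart (jacobian v x))
          have := normSq_nonneg (symPart (interpMatrix v y))
          rw [ENNReal.ofReal_add (by positivity) (by positivity),
            ENNReal.ofReal_mul (by norm_num), ENNReal.ofReal_mul (by norm_num)]
          calc _ ≤ 2 * strainDensity v x + 2 * (324 * K₁ * I) := by
                gcongr
                · simp
                · exact le_rfl
                · simp
            _ = _ := by ring
      _ = _ := by
          rw [lintegral_add_right _ measurable_const, lintegral_const_mul' _ _ (by simp),
            setLIntegral_const]
          ring
  have hl : ∫⁻ x in ball 0 2, ENNReal.ofReal (∑ i, w i x ^ 2) ≤ 48 * K₁ * I := by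
    have hc := continuous_increment hv
    have hm : ∀ k, Measurable fun x =>
        ENNReal.ofReal (increment v x (y + simplexVertex k) ^ 2) := fun k =>
      ((hc.comp (f := fun x : E3 => (x, y + simplexVertex k))
        (by fun_prop)).pow 2).measurable.ennreal_ofReal
    calc _ ≤ ∫⁻ x in ball 0 2, ∑ i, 8 * (ENNReal.ofReal (increment v x (y + simplexVertex none) ^ 2)
          + ENNReal.ofReal (increment v x (y + simplexVertex (some i)) ^ 2)) := by
          refine lintegral_mono fun x => ?_
          rw [ENNReal.ofReal_sum_of_nonneg fun _ _ => sq_nonneg _]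
          refine Finset.sum_le_sum fun k _ => ?_
          rw [hwdef, interpError]
          set a := increment v x (y + simplexVertex none)
          set b := increment v x (y + simplexVertex (some k))
          have : (2 * (a - b)) ^ 2 ≤ 8 * (a ^ 2 + b ^ 2) := by nlinarith [sq_nonneg (a + b)]
          refine (ENNReal.ofReal_le_ofReal this).trans (le_of_eq ?_)
          rw [ENNReal.ofReal_mul (by norm_num), ENNReal.ofReal_add (by positivity) (by positivity)]
          simp
      _ ≤ ∑ _i : Fin 3, 8 * (K₁ * I + K₁ * I) := by
          have hm' : ∀ i : Fin 3, Measurable fun x =>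
              8 * (ENNReal.ofReal (increment v x (y + simplexVertex none) ^ 2)
                + ENNReal.ofReal (increment v x (y + simplexVertex (some i)) ^ 2)) :=
            fun i => ((hm none).add (hm (some i))).const_mul _
          rw [lintegral_finsetSum _ fun i _ => hm' i]
          refine Finset.sum_le_sum fun k _ => ?_
          rw [lintegral_const_mul' _ _ (by simp), lintegral_add_left (hm none)]
          gcongr
          · exact hy1 _
          · exact hy1 _
      _ = _ := by simp; ring
  calc ∫⁻ x in ball 0 1, ENNReal.ofReal ((partialDeriv j (v i) x - M i j) ^ 2)
      ≤ ∫⁻ x in ball 0 1, ENNReal.ofReal (normSq (jacobian w x)) := by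
        refine lintegral_mono fun x => ENNReal.ofReal_le_ofReal ?_
        have := sq_entry_le_normSq (jacobian w x) i j
        rw [hwdef, jacobian_interpError hv] at this ⊢
        exact this
    _ ≤ _ := h₂ w hw
    _ ≤ K₂ * ((2 * I + 648 * K₁ * V * I) + 48 * K₁ * I) := by gcongr
    _ = _ := by ring

/-- The interior form of Korn's second inequality, for smooth fields. -/
lemma exists_smooth_ball_korn : ∃ K : ℝ≥0∞, K ≠ ⊤ ∧ ∀ v : Fin 3 → E3 → ℝ,
    (∀ i, ContDiff ℝ ∞ (v i)) → ∀ (z : E3) (r : ℝ), 0 < r → ∀ i j, ∃ a : ℝ,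
    ∫⁻ x in ball z r, ENNReal.ofReal ((partialDeriv j (v i) x - a) ^ 2) ≤
      K * ∫⁻ x in ball z (2 * r), strainDensity v x := by
  obtain ⟨K, hK, h⟩ := exists_smooth_unit_korn
  refine ⟨K, hK, fun v hv z r hr i j => ?_⟩
  -- The factor r⁻¹ keeps the Jacobian unchanged under rescaling, so both integrals acquire the same
  -- factor r⁻³.
  set v' : Fin 3 → E3 → ℝ := fun i x => r⁻¹ * v i (z + r • x) with hv'
  have hd : ∀ i x, HasFDerivAt (v' i) (fderiv ℝ (v i) (z + r • x)) x := by
    intro i x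
    have h1 : HasFDerivAt (fun x : E3 => z + r • x) (r • ContinuousLinearMap.id ℝ E3) x :=
      ((hasFDerivAt_id x).const_smul r).const_add z
    have h2 := ((((hv i).differentiable (by simp)) (z + r • x)).hasFDerivAt.comp x h1).const_mul r⁻¹
    have h3 : fderiv ℝ (v i) (z + r • x) =
        r⁻¹ • (fderiv ℝ (v i) (z + r • x)).comp (r • ContinuousLinearMap.id ℝ E3) := by
      ext w
      simp [hr.ne']
    rw [h3]
    exact h2
  have hj : ∀ x, jacobian v' x = jacobian v (z + r • x) := by
    intro x
    ext i j
    rw [jacobian_apply, jacobian_apply, partialDeriv, partialDeriv, (hd i x).fderiv]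
  have hsm : ∀ i, ContDiff ℝ ∞ (v' i) := fun i =>
    contDiff_const.mul ((hv i).comp (by fun_prop))
  obtain ⟨M, hM⟩ := h v' hsm
  refine ⟨M i j, ?_⟩
  have hMij := hM i j
  have e1 : ∀ x, partialDeriv j (v' i) x = partialDeriv j (v i) (z + r • x) := fun x => by
    rw [← jacobian_apply, hj, jacobian_apply]
  have e2 : ∀ x, strainDensity v' x = strainDensity v (z + r • x) := fun x => by
    rw [strainDensity, hj, strainDensity]
  simp_rw [e1, e2] at hMij
  have hc := continuous_partialDeriv (hv i) j
  rw [lintegral_ball_comp_add_smul (fun x => ENNReal.ofReal ((partialDeriv j (v i) x - M i j) ^ 2))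
      (by fun_prop) z hr,
    lintegral_ball_comp_add_smul (strainDensity v) (measurable_strainDensity hv) z hr,
    mul_left_comm, mul_one, mul_comm r 2] at hMij
  exact (ENNReal.mul_le_mul_iff_right (by simpa using by positivity) (by simp)).1 hMij

/-! ### Mollification -/

/-- The mollification of a function by a normalized bump function. -/
noncomputable def mollify (φ : ContDiffBump (0 : E3)) (h : E3 → ℝ) (x : E3) : ℝ :=
  ∫ y, h y * φ.normed volume (x - y)

open scoped Convolution in
lemma mollify_eq_convolution (φ : ContDiffBump (0 : E3)) (h : E3 → ℝ) :
    mollify φ h = (φ.normed volume ⋆[ContinuousLinearMap.lsmul ℝ ℝ, volume] h) := by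
  rw [← convolution_flip]
  ext x
  simp [mollify, convolution, mul_comm]

open scoped Convolution in
lemma mollify_eq_convolution_flip (φ : ContDiffBump (0 : E3)) (h : E3 → ℝ) :
    mollify φ h = (h ⋆[(ContinuousLinearMap.lsmul ℝ ℝ).flip, volume] φ.normed volume) := by
  rw [mollify_eq_convolution, convolution_flip]

lemma contDiff_mollify (φ : ContDiffBump (0 : E3)) {h : E3 → ℝ} (hh : Integrable h) :
    ContDiff ℝ ∞ (mollify φ h) := by
  rw [mollify_eq_convolution_flip]
  exact φ.hasCompactSupport_normed.contDiff_convolution_right (n := ⊤) _ hh.locallyIntegrable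
    φ.contDiff_normed

lemma partialDeriv_mollify (φ : ContDiffBump (0 : E3)) {h : E3 → ℝ} (hh : Integrable h)
    (j : Fin 3) (x : E3) :
    partialDeriv j (mollify φ h) x = ∫ y, h y * partialDeriv j (φ.normed volume) (x - y) := by
  have h1 := φ.hasCompactSupport_normed.hasFDerivAt_convolution_right (μ := (volume : Measure E3))
    (ContinuousLinearMap.lsmul ℝ ℝ).flip hh.locallyIntegrable
    (φ.contDiff_normed (μ := volume) (n := 1)) x
  rw [partialDeriv, mollify_eq_convolution_flip, h1.fderiv, convolution_precompR_apply]
  · simp [convolution, partialDeriv, mul_comm]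
  · exact hh.locallyIntegrable
  · exact φ.hasCompactSupport_normed.fderiv ℝ
  · exact (φ.contDiff_normed (μ := volume) (n := 1)).continuous_fderiv one_ne_zero

/-- Mollification commutes with weak differentiation away from the boundary. -/
lemma partialDeriv_mollify_indicator {Ω : Set E3} {u : E3 → E3}
    {G : E3 → Matrix (Fin 3) (Fin 3) ℝ} (hG : HasWeakGradient Ω u G) {A : Set E3}
    (hA : IsCompact A) (hAΩ : A ⊆ Ω) (φ : ContDiffBump (0 : E3)) {x : E3}
    (hx : closedBall x φ.rOut ⊆ A) (i j : Fin 3) :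
    partialDeriv j (mollify φ (A.indicator fun y => u y i)) x =
      mollify φ (A.indicator fun y => G y i j) x := by
  have hui : Integrable (A.indicator fun y => u y i) := by
    rw [integrable_indicator_iff hA.measurableSet]
    exact (EuclideanSpace.proj (𝕜 := ℝ) i : E3 →L[ℝ] ℝ).integrable_comp
      (hG.1.integrableOn_compact_subset hAΩ hA)
  rw [partialDeriv_mollify φ hui, mollify]
  set ψ := φ.normed (volume : Measure E3) with hψ
  have hψs : ContDiff ℝ ∞ ψ := φ.contDiff_normed
  -- The test function for the weak derivative. Differentiating in y instead of x gives a sign,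
  -- which cancels the one in the definition of the weak gradient.
  set η : E3 → ℝ := fun y => ψ (x - y) with hη
  have hηs : ContDiff ℝ ∞ η := hψs.comp (contDiff_const.sub contDiff_id)
  have hηt : tsupport η ⊆ A := by
    refine Subset.trans (closure_minimal ?_ isClosed_closedBall) hx
    intro y hy
    have : x - y ∈ Function.support ψ := hy
    rw [hψ, φ.support_normed_eq, mem_ball_zero_iff] at this
    rw [mem_closedBall, dist_comm, dist_eq_norm]
    exact this.le
  have hηd : ∀ y, partialDeriv j ψ (x - y) = - partialDeriv j η y := by
    intro y
    have h1 : HasFDerivAt (fun y : E3 => x - y) (-ContinuousLinearMap.id ℝ E3) y :=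
      (hasFDerivAt_id y).const_sub x
    have h2 : HasFDerivAt η ((fderiv ℝ ψ (x - y)).comp (-ContinuousLinearMap.id ℝ E3)) y :=
      ((hψs.differentiable (by simp)) (x - y)).hasFDerivAt.comp y h1
    rw [partialDeriv, partialDeriv, h2.fderiv]
    simp
  have hw := hG.2.2 η hηs (hA.of_isClosed_subset (isClosed_tsupport _) hηt) (hηt.trans hAΩ) i j
  have z1 : ∀ y ∉ A, partialDeriv j η y = 0 := fun y hy => by
    rw [partialDeriv, fderiv_of_notMem_tsupport ℝ fun h => hy (hηt h)]; simp
  have z2 : ∀ y ∉ A, η y = 0 := fun y hy => image_eq_zero_of_notMem_tsupport fun h => hy (hηt h)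
  have e1 : ∫ y in Ω, u y i * fderiv ℝ η y (EuclideanSpace.single j 1) =
      ∫ y, A.indicator (fun y => u y i) y * partialDeriv j η y := by
    rw [setIntegral_eq_integral_of_forall_compl_eq_zero]
    · refine integral_congr_ae (Eventually.of_forall fun y => ?_)
      by_cases hy : y ∈ A
      · simp only [indicator_of_mem hy, partialDeriv]
      · have := z1 y hy
        simp only [indicator_of_notMem hy]
        rw [partialDeriv] at this
        rw [this]; simp
    · intro y hy
      have := z1 y (fun h => hy (hAΩ h))
      rw [partialDeriv] at this
      rw [this, mul_zero]
  have e2 : ∫ y in Ω, G y i j * η y = ∫ y, A.indicator (fun y => G y i j) y * η y := by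
    rw [setIntegral_eq_integral_of_forall_compl_eq_zero]
    · refine integral_congr_ae (Eventually.of_forall fun y => ?_)
      by_cases hy : y ∈ A
      · simp only [indicator_of_mem hy]
      · simp only [indicator_of_notMem hy, z2 y hy]; simp
    · intro y hy
      rw [z2 y (fun h => hy (hAΩ h)), mul_zero]
  rw [e1, e2] at hw
  simp_rw [hηd, mul_neg]
  rw [integral_neg, hw, neg_neg]

/-- Cauchy–Schwarz for the factors √a and √a · b. With a a kernel of mass 1 it shows that
mollification does not increase L² norms. -/
lemma sq_lintegral_mul_le {α : Type*} [MeasurableSpace α] {μ : Measure α} {a b : α → ℝ≥0∞}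
    (ha : AEMeasurable a μ) (hb : AEMeasurable b μ) :
    (∫⁻ x, a x * b x ∂μ) ^ 2 ≤ (∫⁻ x, a x ∂μ) * ∫⁻ x, a x * b x ^ 2 ∂μ := by
  have h := ENNReal.lintegral_mul_le_Lp_mul_Lq μ Real.HolderConjugate.two_two
    (f := fun x => a x ^ (1 / 2 : ℝ)) (g := fun x => a x ^ (1 / 2 : ℝ) * b x)
    (ha.pow_const _) ((ha.pow_const _).mul hb)
  have hs : ∀ c : ℝ≥0∞, c ^ (1 / 2 : ℝ) * c ^ (1 / 2 : ℝ) = c := fun c => by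
    rw [← ENNReal.rpow_add_of_nonneg _ _ (by norm_num) (by norm_num)]; norm_num
  have hs2 : ∀ c : ℝ≥0∞, (c ^ (1 / 2 : ℝ)) ^ (2 : ℝ) = c := fun c => by
    rw [← ENNReal.rpow_mul]; norm_num
  have e1 : ∀ x, ((fun x => a x ^ (1 / 2 : ℝ)) * fun x => a x ^ (1 / 2 : ℝ) * b x) x =
      a x * b x := fun x => by
    simp only [Pi.mul_apply]; rw [← mul_assoc, hs]
  have e2 : ∀ x, (a x ^ (1 / 2 : ℝ) * b x) ^ (2 : ℝ) = a x * b x ^ 2 := fun x => by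
    rw [ENNReal.mul_rpow_of_nonneg _ _ (by norm_num), hs2, ENNReal.rpow_two]
  simp_rw [e1, e2, hs2] at h
  calc _ ≤ ((∫⁻ x, a x ∂μ) ^ (1 / 2 : ℝ) * (∫⁻ x, a x * b x ^ 2 ∂μ) ^ (1 / 2 : ℝ)) ^ 2 := by gcongr
    _ = _ := by rw [mul_pow, pow_two, pow_two, hs, hs]

lemma lintegral_ofReal_normed (φ : ContDiffBump (0 : E3)) :
    ∫⁻ y, ENNReal.ofReal (φ.normed volume y) = 1 := by
  rw [← ofReal_integral_eq_lintegral_ofReal φ.integrable_normed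
    (Eventually.of_forall fun _ => φ.nonneg_normed _), φ.integral_normed, ENNReal.ofReal_one]

lemma ofReal_sq_eq_enorm_sq (a : ℝ) : ENNReal.ofReal (a ^ 2) = ‖a‖ₑ ^ 2 := by
  rw [← sq_abs, ENNReal.ofReal_pow (abs_nonneg a), Real.enorm_eq_ofReal_abs]

lemma sq_mollify_le (φ : ContDiffBump (0 : E3)) {h : E3 → ℝ} (hh : Integrable h) (x : E3) :
    ENNReal.ofReal (mollify φ h x ^ 2) ≤
      ∫⁻ y, ENNReal.ofReal (φ.normed volume (x - y)) * ENNReal.ofReal (h y ^ 2) := by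
  have hc : Continuous (φ.normed (volume : Measure E3)) := φ.continuous_normed
  have h1 : ‖mollify φ h x‖ₑ ≤ ∫⁻ y, ENNReal.ofReal (φ.normed volume (x - y)) * ‖h y‖ₑ := by
    refine (enorm_integral_le_lintegral_enorm _).trans (le_of_eq (lintegral_congr fun y => ?_))
    rw [enorm_mul, mul_comm, Real.enorm_of_nonneg (φ.nonneg_normed _)]
  have h2 := sq_lintegral_mul_le (μ := (volume : Measure E3))
    (a := fun y => ENNReal.ofReal (φ.normed volume (x - y))) (b := fun y => ‖h y‖ₑ)
    (Measurable.aemeasurable (by fun_prop)) hh.aestronglyMeasurable.enorm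
  have h3 : ∫⁻ y, ENNReal.ofReal (φ.normed volume (x - y)) = 1 := by
    rw [lintegral_sub_left_eq_self (fun y => ENNReal.ofReal (φ.normed volume y)) x,
      lintegral_ofReal_normed]
  rw [h3, one_mul] at h2
  simp_rw [ofReal_sq_eq_enorm_sq]
  exact (by gcongr : ‖mollify φ h x‖ₑ ^ 2 ≤ _).trans h2

lemma lintegral_sq_mollify_le (φ : ContDiffBump (0 : E3)) {h : E3 → ℝ} (hh : Integrable h) :
    ∫⁻ x, ENNReal.ofReal (mollify φ h x ^ 2) ≤ ∫⁻ y, ENNReal.ofReal (h y ^ 2) := by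
  have hc : Continuous (φ.normed (volume : Measure E3)) := φ.continuous_normed
  refine (lintegral_mono fun x => sq_mollify_le φ hh x).trans ?_
  rw [lintegral_lintegral_swap]
  · refine le_of_eq (lintegral_congr fun y => ?_)
    have hm : Measurable fun x => ENNReal.ofReal (φ.normed volume (x - y)) := by fun_prop
    rw [lintegral_mul_const _ hm,
      lintegral_sub_right_eq_self (fun y => ENNReal.ofReal (φ.normed volume y)) y,
      lintegral_ofReal_normed, one_mul]
  · have hm : Measurable fun p : E3 × E3 =>
        ENNReal.ofReal (φ.normed volume (p.1 - p.2)) := by fun_prop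
    refine hm.aemeasurable.mul ?_
    exact ((hh.aestronglyMeasurable.comp_snd).aemeasurable.pow_const 2).ennreal_ofReal

/-! ### Korn's inequality on interior balls -/

/-- The oscillation of a sequence of continuous functions passes to almost everywhere limits. -/
lemma exists_osc_le_of_tendsto {B : Set E3} (hB0 : volume B ≠ 0)
    (hBt : volume B ≠ ⊤) {c : ℕ → E3 → ℝ} (hc : ∀ n, Continuous (c n)) {g : E3 → ℝ}
    (hlim : ∀ᵐ x ∂(volume.restrict B), Tendsto (fun n => c n x) atTop (𝓝 (g x)))
    {F : ℝ≥0∞} (hF : ∀ᶠ n in atTop, ∃ a : ℝ, ∫⁻ x in B, ENNReal.ofReal ((c n x - a) ^ 2) ≤ F) :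
    ∃ a : ℝ, ∫⁻ x in B, ENNReal.ofReal ((g x - a) ^ 2) ≤ 4 * F := by
  -- The constants a vary with n and need not converge. Double differences c n y - c n x do not
  -- involve them, and a good value of c n x takes their place.
  set H : E3 → ℝ≥0∞ := fun x =>
    liminf (fun n => ∫⁻ y in B, ENNReal.ofReal ((c n y - c n x) ^ 2)) atTop with hH
  have hm : ∀ n, Measurable fun x => ∫⁻ y in B, ENNReal.ofReal ((c n y - c n x) ^ 2) := fun n => by
    have := hc n
    exact Measurable.lintegral_prod_right'
      (f := fun p : E3 × E3 => ENNReal.ofReal ((c n p.2 - c n p.1) ^ 2)) (by fun_prop)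
  have hHm : Measurable H := Measurable.liminf hm
  have hdbl : ∀ᶠ n in atTop,
      ∫⁻ x in B, ∫⁻ y in B, ENNReal.ofReal ((c n y - c n x) ^ 2) ≤ 4 * volume B * F := by
    filter_upwards [hF] with n hn
    obtain ⟨a, ha⟩ := hn
    have := hc n
    calc _ ≤ ∫⁻ x in B, ∫⁻ y in B, 2 * (ENNReal.ofReal ((c n y - a) ^ 2) +
          ENNReal.ofReal ((c n x - a) ^ 2)) := by
          refine lintegral_mono fun x => lintegral_mono fun y => ?_
          have h2 : (2 : ℝ≥0∞) = ENNReal.ofReal 2 := by simp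
          rw [← ENNReal.ofReal_add (sq_nonneg _) (sq_nonneg _), h2,
            ← ENNReal.ofReal_mul (by norm_num)]
          refine ENNReal.ofReal_le_ofReal ?_
          nlinarith [sq_nonneg (c n y - a + (c n x - a))]
      _ = ∫⁻ x in B, 2 * ((∫⁻ y in B, ENNReal.ofReal ((c n y - a) ^ 2)) +
          volume B * ENNReal.ofReal ((c n x - a) ^ 2)) := by
          refine lintegral_congr fun x => ?_
          rw [lintegral_const_mul' _ _ (by simp), lintegral_add_right _ measurable_const,
            setLIntegral_const, mul_comm (ENNReal.ofReal _)]
      _ = 2 * (volume B * (∫⁻ y in B, ENNReal.ofReal ((c n y - a) ^ 2)) +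
          volume B * ∫⁻ y in B, ENNReal.ofReal ((c n y - a) ^ 2)) := by
          rw [lintegral_const_mul' _ _ (by simp), lintegral_add_left measurable_const,
            setLIntegral_const, lintegral_const_mul' _ _ hBt, mul_comm (volume B)]
      _ ≤ 2 * (volume B * F + volume B * F) := by gcongr
      _ = _ := by ring
  have hHi : ∫⁻ x in B, H x ≤ 4 * volume B * F := by
    refine (lintegral_liminf_le hm).trans ?_
    exact liminf_le_of_frequently_le' hdbl.frequently
  have : IsFiniteMeasure (volume.restrict B) := ⟨by simpa using hBt.lt_top⟩
  -- A point of convergence at which H is at most its average over B; the limit g x then serves as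
  -- the constant, by Fatou's lemma.
  obtain ⟨x, hxN, hx⟩ := exists_notMem_null_le_laverage (μ := volume.restrict B)
    (f := H) (N := {x | ¬ Tendsto (fun n => c n x) atTop (𝓝 (g x))})
    (by rwa [Ne, Measure.restrict_eq_zero]) hHm.aemeasurable hlim
  have hxt : Tendsto (fun n => c n x) atTop (𝓝 (g x)) := by simpa using hxN
  refine ⟨g x, ?_⟩
  have hH4 : H x ≤ 4 * F := by
    rw [setLAverage_eq] at hx
    refine hx.trans ((ENNReal.div_le_div_right hHi _).trans (le_of_eq ?_))
    rw [mul_right_comm, ENNReal.mul_div_cancel_right hB0 hBt]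
  refine le_trans ?_ hH4
  calc ∫⁻ y in B, ENNReal.ofReal ((g y - g x) ^ 2)
      = ∫⁻ y in B, liminf (fun n => ENNReal.ofReal ((c n y - c n x) ^ 2)) atTop := by
        refine lintegral_congr_ae ?_
        filter_upwards [hlim] with y hy
        exact ((ENNReal.tendsto_ofReal ((hy.sub hxt).pow 2)).liminf_eq).symm
    _ ≤ H x := by
        refine lintegral_liminf_le fun n => ?_
        have := hc n
        fun_prop

/-- The interior form of Korn's second inequality, for weakly differentiable fields. -/
theorem exists_ball_korn : ∃ K : ℝ≥0∞, K ≠ ⊤ ∧ ∀ (Ω : Set E3) (u : E3 → E3)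
    (G : E3 → Matrix (Fin 3) (Fin 3) ℝ), HasWeakGradient Ω u G → ∀ (z : E3) (r : ℝ), 0 < r →
    closedBall z (3 * r) ⊆ Ω → ∀ i j, ∃ a : ℝ,
    ∫⁻ x in ball z r, ENNReal.ofReal ((G x i j - a) ^ 2) ≤
      K * ∫⁻ x in closedBall z (3 * r), ENNReal.ofReal (normSq (symPart (G x))) := by
  obtain ⟨K, hK, h⟩ := exists_smooth_ball_korn
  refine ⟨4 * K, by finiteness, fun Ω u G hG z r hr hzΩ i j => ?_⟩
  set A := closedBall z (3 * r) with hA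
  have hAc : IsCompact A := isCompact_closedBall _ _
  -- Outer radii r/(n+1) ≤ r keep the mollification at points of `ball z (2 * r)` inside A; inner
  -- radii of half the size give the bounded ratio needed for almost everywhere convergence.
  let φ : ℕ → ContDiffBump (0 : E3) := fun n =>
    ⟨r / (2 * ((n : ℝ) + 1)), r / ((n : ℝ) + 1), by positivity, by
      rw [div_lt_div_iff_of_pos_left hr (by positivity) (by positivity)]
      nlinarith [(n.cast_nonneg : (0 : ℝ) ≤ n)]⟩
  have hφout : ∀ n, (φ n).rOut = r / ((n : ℝ) + 1) := fun n => rfl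
  have hφle : ∀ n, (φ n).rOut ≤ r := fun n => by
    rw [hφout]; exact div_le_self hr.le (by linarith [(n.cast_nonneg : (0 : ℝ) ≤ n)])
  have hφ0 : Tendsto (fun n => (φ n).rOut) atTop (𝓝 0) := by
    simp_rw [hφout]
    simpa [div_eq_mul_one_div r] using tendsto_one_div_add_atTop_nhds_zero_nat.const_mul r
  have hφK : ∀ᶠ n in atTop, (φ n).rOut ≤ 2 * (φ n).rIn := Eventually.of_forall fun n => by
    have : (φ n).rIn = r / (2 * ((n : ℝ) + 1)) := rfl
    rw [this, hφout]
    refine le_of_eq ?_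
    field_simp
  have hui : ∀ i, Integrable (A.indicator fun y => u y i) := fun i => by
    rw [integrable_indicator_iff hAc.measurableSet]
    exact (EuclideanSpace.proj (𝕜 := ℝ) i : E3 →L[ℝ] ℝ).integrable_comp
      (hG.1.integrableOn_compact_subset hzΩ hAc)
  have hGi : ∀ i j, Integrable (A.indicator fun y => G y i j) := fun i j => by
    rw [integrable_indicator_iff hAc.measurableSet]
    exact (hG.2.1 i j).integrableOn_compact_subset hzΩ hAc
  set v : ℕ → Fin 3 → E3 → ℝ := fun n i => mollify (φ n) (A.indicator fun y => u y i) with hv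
  have hvs : ∀ n i, ContDiff ℝ ∞ (v n i) := fun n i => contDiff_mollify _ (hui i)
  have hder : ∀ n, ∀ x ∈ ball z (2 * r), ∀ i j,
      partialDeriv j (v n i) x = mollify (φ n) (A.indicator fun y => G y i j) x := by
    intro n x hx i j
    refine partialDeriv_mollify_indicator hG hAc hzΩ (φ n) ?_ i j
    refine closedBall_subset_closedBall' ?_
    have := hφle n
    rw [mem_ball] at hx
    linarith
  -- Taking the symmetric part commutes with mollification, so the strain of the mollified field is
  -- bounded in L² by the strain itself.
  set e : Fin 3 → Fin 3 → E3 → ℝ := fun i j => A.indicator fun y => symPart (G y) i j with he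
  have hei : ∀ i j, Integrable (e i j) := fun i j => by
    have : e i j = fun y => (1 / 2 : ℝ) *
        ((A.indicator fun y => G y i j) y + (A.indicator fun y => G y j i) y) := by
      ext y
      by_cases hy : y ∈ A <;> simp [he, hy, symPart]
    rw [this]
    exact ((hGi i j).add (hGi j i)).const_mul _
  have hstrain : ∀ n, ∀ x ∈ ball z (2 * r), strainDensity (v n) x =
      ∑ i, ∑ j, ENNReal.ofReal (mollify (φ n) (e i j) x ^ 2) := by
    intro n x hx
    have h1 : ∀ i j, symPart (jacobian (v n) x) i j = mollify (φ n) (e i j) x := by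
      intro i j
      have hint : ∀ i j, Integrable fun y =>
          A.indicator (fun y => G y i j) y * (φ n).normed volume (x - y) := fun i j => by
        have hcn : Continuous ((φ n).normed (volume : Measure E3)) := (φ n).continuous_normed
        obtain ⟨C, hC⟩ := (φ n).hasCompactSupport_normed.exists_bound_of_continuous hcn
        exact (hGi i j).mul_bdd (c := C)
          (by fun_prop) (Eventually.of_forall fun y => hC _)
      simp only [symPart, Matrix.smul_apply, Matrix.add_apply, Matrix.transpose_apply,
        jacobian_apply, smul_eq_mul]
      rw [hder n x hx, hder n x hx, mollify, mollify, mollify, ← integral_add (hint i j) (hint j i),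
        ← integral_const_mul]
      refine integral_congr_ae (Eventually.of_forall fun y => ?_)
      by_cases hy : y ∈ A
      · simp only [he, indicator_of_mem hy, symPart, Matrix.smul_apply, Matrix.add_apply,
          Matrix.transpose_apply, smul_eq_mul]
        ring
      · simp only [he, indicator_of_notMem hy]
        ring
    rw [strainDensity, ofReal_normSq_eq]
    exact Finset.sum_congr rfl fun i _ => Finset.sum_congr rfl fun j _ => by rw [h1]
  have hbound : ∀ n, ∫⁻ x in ball z (2 * r), strainDensity (v n) x ≤
      ∫⁻ x in A, ENNReal.ofReal (normSq (symPart (G x))) := by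
    intro n
    have hmm : ∀ i j, Measurable fun x => ENNReal.ofReal (mollify (φ n) (e i j) x ^ 2) :=
      fun i j => ((contDiff_mollify (φ n) (hei i j)).continuous.pow 2).measurable.ennreal_ofReal
    have hem : ∀ i j, AEMeasurable (fun x => ENNReal.ofReal (e i j x ^ 2)) := fun i j =>
      ((hei i j).aestronglyMeasurable.aemeasurable.pow_const 2).ennreal_ofReal
    calc _ = ∫⁻ x in ball z (2 * r), ∑ i, ∑ j, ENNReal.ofReal (mollify (φ n) (e i j) x ^ 2) :=
          setLIntegral_congr_fun measurableSet_ball (hstrain n)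
      _ ≤ ∫⁻ x, ∑ i, ∑ j, ENNReal.ofReal (mollify (φ n) (e i j) x ^ 2) :=
          setLIntegral_le_lintegral _ _
      _ = ∑ i, ∑ j, ∫⁻ x, ENNReal.ofReal (mollify (φ n) (e i j) x ^ 2) := by
          rw [lintegral_finsetSum _ fun i _ => Finset.measurable_sum _ fun j _ => hmm i j]
          exact Finset.sum_congr rfl fun i _ => lintegral_finsetSum _ fun j _ => hmm i j
      _ ≤ ∑ i, ∑ j, ∫⁻ x, ENNReal.ofReal (e i j x ^ 2) :=
          Finset.sum_le_sum fun i _ => Finset.sum_le_sum fun j _ =>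
            lintegral_sq_mollify_le (φ n) (hei i j)
      _ = ∫⁻ x, ∑ i, ∑ j, ENNReal.ofReal (e i j x ^ 2) := by
          rw [lintegral_finsetSum' _ fun i _ => Finset.aemeasurable_fun_sum _ fun j _ => hem i j]
          exact Finset.sum_congr rfl fun i _ => (lintegral_finsetSum' _ fun j _ => hem i j).symm
      _ = _ := by
          rw [← lintegral_indicator hAc.measurableSet]
          refine lintegral_congr fun x => ?_
          by_cases hx : x ∈ A
          · simp only [he, indicator_of_mem hx]
            rw [ofReal_normSq_eq]
          · simp [he, indicator_of_notMem hx]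
  rw [mul_assoc]
  refine exists_osc_le_of_tendsto (measure_ball_pos _ _ hr).ne'
    measure_ball_lt_top.ne (c := fun n => partialDeriv j (v n i))
    (fun n => continuous_partialDeriv (hvs n i) j) ?_ (Eventually.of_forall fun n => ?_)
  · rw [ae_restrict_iff' measurableSet_ball]
    filter_upwards [ContDiffBump.ae_convolution_tendsto_right_of_locallyIntegrable hφ0 hφK
      (hGi i j).locallyIntegrable] with x hx hxb
    have hxA : x ∈ A := ball_subset_closedBall (ball_subset_ball (by linarith) hxb)
    rw [indicator_of_mem hxA] at hx
    refine hx.congr fun n => ?_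
    rw [hder n x (ball_subset_ball (by linarith) hxb), mollify_eq_convolution]
  · obtain ⟨a, ha⟩ := h (v n) (hvs n) z r hr i j
    exact ⟨a, ha.trans (mul_le_mul_right (hbound n) K)⟩

/-! ### Oscillation bounds and displacements -/

/-- On every ball well inside `Ω`, the mean square oscillation of `g` is controlled by `f`. -/
def OscBound (Ω : Set E3) (g : E3 → ℝ) (f : E3 → ℝ≥0∞) (K : ℝ≥0∞) : Prop :=
  ∀ (z : E3) (r : ℝ), 0 < r → closedBall z (3 * r) ⊆ Ω → ∃ a : ℝ,
    ∫⁻ x in ball z r, ENNReal.ofReal ((g x - a) ^ 2) ≤ K * ∫⁻ x in closedBall z (3 * r), f x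

/-- The distance to the complement of `Ω`. -/
noncomputable def depth (Ω : Set E3) (x : E3) : ℝ := infDist x Ωᶜ

lemma depth_nonneg (Ω : Set E3) (x : E3) : 0 ≤ depth Ω x := infDist_nonneg

lemma depth_le_add (Ω : Set E3) (x y : E3) : depth Ω x ≤ depth Ω y + dist x y :=
  infDist_le_infDist_add_dist

lemma continuous_depth (Ω : Set E3) : Continuous (depth Ω) := continuous_infDist_pt _

lemma depth_pos {Ω : Set E3} (hΩ : IsOpen Ω) (hne : Ωᶜ.Nonempty) {x : E3} (hx : x ∈ Ω) :
    0 < depth Ω x :=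
  (hΩ.isClosed_compl.notMem_iff_infDist_pos hne).1 (by simpa using hx)

lemma closedBall_subset_of_lt_depth {Ω : Set E3} {x : E3} {r : ℝ} (hr : r < depth Ω x) :
    closedBall x r ⊆ Ω := by
  intro y hy
  by_contra hyn
  have : depth Ω x ≤ dist x y := infDist_le_dist_of_mem hyn
  rw [mem_closedBall, dist_comm] at hy
  linarith

lemma mem_of_depth_pos {Ω : Set E3} {x : E3} (h : 0 < depth Ω x) : x ∈ Ω :=
  closedBall_subset_of_lt_depth h (mem_closedBall_self le_rfl)

lemma volume_ball_eq (x : E3) {r : ℝ} (hr : 0 ≤ r) :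
    volume (ball x r) = ENNReal.ofReal (r ^ 3) * volume (ball (0 : E3) 1) := by
  rw [Measure.addHaar_ball _ _ hr]; simp

lemma volume_closedBall_eq (x : E3) {r : ℝ} (hr : 0 ≤ r) :
    volume (closedBall x r) = ENNReal.ofReal (r ^ 3) * volume (ball (0 : E3) 1) := by
  rw [Measure.addHaar_closedBall _ _ hr]; simp

lemma ofReal_sq_sub_le (a b c : ℝ) : ENNReal.ofReal ((a - b) ^ 2) ≤
    2 * ENNReal.ofReal ((a - c) ^ 2) + 2 * ENNReal.ofReal ((b - c) ^ 2) := by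
  have h2 : (2 : ℝ≥0∞) = ENNReal.ofReal 2 := by simp
  rw [h2, ← ENNReal.ofReal_mul (by norm_num), ← ENNReal.ofReal_mul (by norm_num),
    ← ENNReal.ofReal_add (by positivity) (by positivity)]
  refine ENNReal.ofReal_le_ofReal ?_
  nlinarith [sq_nonneg (a - c + (b - c))]

section Displacement

variable {Ω : Set E3} {g : E3 → ℝ} {f : E3 → ℝ≥0∞} {K : ℝ≥0∞} {W : Set E3} {S : E3 → E3}

/-- For x within 1/16 of its depth from z, the depths of x and z are comparable, and both x and S x
lie in the ball of radius a quarter of the depth of z. Both values of g are compared with the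
constant of that ball. -/
lemma lintegral_displacement_local_le (hg : Measurable g) (hosc : OscBound Ω g f K)
    (hWm : MeasurableSet W)
    (hS : ∀ x ∈ W, dist (S x) x ≤ depth Ω x / 16)
    (hSv : ∀ h : E3 → ℝ≥0∞, Measurable h → ∫⁻ x in W, h (S x) ≤ ∫⁻ x, h x)
    {z : E3} (hz : 0 < depth Ω z) :
    ∫⁻ x in W ∩ {x | dist x z < depth Ω x / 16}, ENNReal.ofReal ((g x - g (S x)) ^ 2) ≤
      4 * K * ∫⁻ y in closedBall z (3 / 4 * depth Ω z), f y := by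
  obtain ⟨a, ha⟩ := hosc z (depth Ω z / 4) (by positivity)
    (closedBall_subset_of_lt_depth (by linarith))
  rw [show 3 * (depth Ω z / 4) = 3 / 4 * depth Ω z by ring] at ha
  set N := W ∩ {x | dist x z < depth Ω x / 16} with hN
  have hNm : MeasurableSet N := hWm.inter
    (measurableSet_lt (by fun_prop) ((continuous_depth Ω).measurable.div_const _))
  set B := ball z (depth Ω z / 4)
  have hNB : ∀ x ∈ N, x ∈ B ∧ S x ∈ B := by
    rintro x ⟨hxW, hx⟩
    have hx' : dist x z < depth Ω x / 16 := hx
    have h1 := hS x hxW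
    have h2 := depth_le_add Ω x z
    have h3 := dist_triangle (S x) x z
    exact ⟨by rw [mem_ball]; linarith, by rw [mem_ball]; linarith⟩
  set h : E3 → ℝ≥0∞ := fun x => ENNReal.ofReal ((g x - a) ^ 2) with hh
  have hhm : Measurable h := by fun_prop
  have i1 : ∫⁻ x in N, h x ≤ ∫⁻ x in B, h x := lintegral_mono_set fun x hx => (hNB x hx).1
  have i2 : ∫⁻ x in N, h (S x) ≤ ∫⁻ x in B, h x := by
    calc ∫⁻ x in N, h (S x) ≤ ∫⁻ x in N, B.indicator h (S x) := by
          refine setLIntegral_mono' hNm fun x hx => ?_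
          rw [indicator_of_mem (hNB x hx).2]
      _ ≤ ∫⁻ x in W, B.indicator h (S x) := lintegral_mono_set inter_subset_left
      _ ≤ ∫⁻ x, B.indicator h x := hSv _ (hhm.indicator measurableSet_ball)
      _ = _ := lintegral_indicator measurableSet_ball _
  calc _ ≤ ∫⁻ x in N, (2 * h x + 2 * h (S x)) := lintegral_mono fun x => ofReal_sq_sub_le _ _ _
    _ = 2 * (∫⁻ x in N, h x) + 2 * ∫⁻ x in N, h (S x) := by
        rw [lintegral_add_left (hhm.const_mul _), lintegral_const_mul' _ _ (by simp),
          lintegral_const_mul' _ _ (by simp)]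
    _ ≤ 2 * (K * ∫⁻ y in closedBall z (3 / 4 * depth Ω z), f y) +
        2 * (K * ∫⁻ y in closedBall z (3 / 4 * depth Ω z), f y) := by
        gcongr
        · exact i1.trans ha
        · exact i2.trans ha
    _ = _ := by ring

/-- Moving points by a small fraction of their depth changes `g` in mean square by at most the
total mass of `f`. -/
lemma lintegral_displacement_le (hΩ : IsOpen Ω) (hne : Ωᶜ.Nonempty) (hg : Measurable g)
    (hf : Measurable f) (hosc : OscBound Ω g f K) (hWm : MeasurableSet W) (hWΩ : W ⊆ Ω)
    (hSm : Measurable S) (hS : ∀ x ∈ W, dist (S x) x ≤ depth Ω x / 16)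
    (hSv : ∀ h : E3 → ℝ≥0∞, Measurable h → ∫⁻ x in W, h (S x) ≤ ∫⁻ x, h x) :
    ∫⁻ x in W, ENNReal.ofReal ((g x - g (S x)) ^ 2) ≤
      4096 * 4 * 1728 * K * ∫⁻ y in Ω, f y := by
  set β := volume (ball (0 : E3) 1) with hβ
  have hβ0 : β ≠ 0 := (measure_ball_pos _ _ one_pos).ne'
  have hβt : β ≠ ⊤ := measure_ball_lt_top.ne
  have hdm : Measurable (depth Ω) := (continuous_depth Ω).measurable
  set F : E3 → ℝ≥0∞ := fun x => ENNReal.ofReal ((g x - g (S x)) ^ 2) with hF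
  have hFm : Measurable F := ((hg.sub (hg.comp hSm)).pow_const 2).ennreal_ofReal
  -- A continuous substitute for a Whitney covering: the local estimates are averaged over all
  -- centres z with weight depth⁻³. In place of w, the larger w' can be evaluated at z, because
  -- there the depth is at most twice that of x.
  set w : E3 → ℝ≥0∞ := fun x => (ENNReal.ofReal (depth Ω x ^ 3))⁻¹ with hw
  have hwm : Measurable w := by fun_prop
  set w' : E3 → ℝ≥0∞ := fun x => (ENNReal.ofReal ((depth Ω x / 2) ^ 3))⁻¹ with hw'
  have hwm' : Measurable w' := by fun_prop
  set N : E3 → Set E3 := fun z => W ∩ {x | dist x z < depth Ω x / 16} with hN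
  have hNm : ∀ z, MeasurableSet (N z) := fun z => hWm.inter
    (measurableSet_lt (by fun_prop) (hdm.div_const _))
  have hPm : MeasurableSet {p : E3 × E3 | p.1 ∈ W ∧ dist p.1 p.2 < depth Ω p.1 / 16} :=
    (measurable_fst hWm).inter (measurableSet_lt (f := fun p : E3 × E3 => dist p.1 p.2)
      (g := fun p : E3 × E3 => depth Ω p.1 / 16) (by fun_prop) (by fun_prop))
  set P := {p : E3 × E3 | p.1 ∈ W ∧ dist p.1 p.2 < depth Ω p.1 / 16} with hP
  -- A ball of radius depth/16 has volume β · depth³/4096, so integrating over its centres recovers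
  -- F exactly.
  have s1 : ∫⁻ x in W, F x =
      4096 * β⁻¹ * ∫⁻ x, ∫⁻ z, P.indicator (fun p => F p.1 * w p.1) (x, z) := by
    rw [← lintegral_const_mul' _ _ (by finiteness), ← lintegral_indicator hWm]
    refine lintegral_congr fun x => ?_
    by_cases hx : x ∈ W
    · have hd := depth_pos hΩ hne (hWΩ hx)
      have e1 : ∀ z, P.indicator (fun p => F p.1 * w p.1) (x, z) =
          (ball x (depth Ω x / 16)).indicator (fun _ => F x * w x) z := by
        intro z
        by_cases hz : z ∈ ball x (depth Ω x / 16)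
        · rw [indicator_of_mem hz, indicator_of_mem]
          exact ⟨hx, by rwa [mem_ball, dist_comm] at hz⟩
        · rw [indicator_of_notMem hz, indicator_of_notMem]
          rintro ⟨-, h⟩
          exact hz (by rwa [mem_ball, dist_comm])
      simp_rw [e1]
      rw [indicator_of_mem hx, lintegral_indicator measurableSet_ball, setLIntegral_const,
        volume_ball_eq x (by positivity), div_pow, div_eq_inv_mul,
        ENNReal.ofReal_mul (by positivity)]
      have h1 : ENNReal.ofReal (16 ^ 3 : ℝ)⁻¹ = 4096⁻¹ := by
        rw [ENNReal.ofReal_inv_of_pos (by norm_num)]; norm_num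
      have h2 : w x * ENNReal.ofReal (depth Ω x ^ 3) = 1 :=
        ENNReal.inv_mul_cancel (by simpa using by positivity) (by simp)
      rw [h1]
      calc F x = F x * (4096 * 4096⁻¹) * (β⁻¹ * β) * (w x * ENNReal.ofReal (depth Ω x ^ 3)) := by
            rw [h2, ENNReal.inv_mul_cancel hβ0 hβt, ENNReal.mul_inv_cancel (by simp) (by simp)]
            simp
        _ = _ := by ring
    · rw [indicator_of_notMem hx]
      have : ∀ z, P.indicator (fun p => F p.1 * w p.1) (x, z) = 0 := fun z =>
        indicator_of_notMem (fun h => hx h.1) _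
      simp [this]
  have hsw : ∫⁻ x, ∫⁻ z, P.indicator (fun p => F p.1 * w p.1) (x, z) =
      ∫⁻ z, ∫⁻ x in N z, F x * w x := by
    rw [lintegral_lintegral_swap]
    · refine lintegral_congr fun z => ?_
      rw [← lintegral_indicator (hNm z)]
      rfl
    · exact (Measurable.indicator (by fun_prop) hPm).aemeasurable
  have s2 : ∀ z, ∫⁻ x in N z, F x * w x ≤ 4 * K * ∫⁻ y,
      {p : E3 × E3 | 0 < depth Ω p.1 ∧ dist p.2 p.1 ≤ 3 / 4 * depth Ω p.1}.indicator
        (fun p => w' p.1 * f p.2) (z, y) := by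
    intro z
    rcases (depth_nonneg Ω z).eq_or_lt with h0 | hz
    · have : N z = ∅ := by
        refine eq_empty_of_forall_notMem fun x hx => ?_
        have h1 : dist x z < depth Ω x / 16 := hx.2
        have := depth_pos hΩ hne (hWΩ hx.1)
        have := depth_le_add Ω x z
        linarith
      simp [this]
    · have e1 : ∀ y, {p : E3 × E3 | 0 < depth Ω p.1 ∧ dist p.2 p.1 ≤ 3 / 4 * depth Ω p.1}.indicator
          (fun p => w' p.1 * f p.2) (z, y) =
          (closedBall z (3 / 4 * depth Ω z)).indicator (fun y => w' z * f y) y := by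
        intro y
        by_cases hy : y ∈ closedBall z (3 / 4 * depth Ω z)
        · rw [indicator_of_mem hy, indicator_of_mem]
          exact ⟨hz, hy⟩
        · rw [indicator_of_notMem hy, indicator_of_notMem]
          exact fun h => hy h.2
      simp_rw [e1]
      have hw't : w' z ≠ ⊤ := ENNReal.inv_ne_top.2 (by simpa using by positivity)
      rw [lintegral_indicator measurableSet_closedBall, lintegral_const_mul' _ _ hw't]
      calc _ ≤ ∫⁻ x in N z, w' z * F x := by
            refine setLIntegral_mono' (hNm z) fun x hx => ?_
            rw [mul_comm]
            gcongr ?_ * F x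
            simp only [hw']
            gcongr (ENNReal.ofReal ?_)⁻¹
            gcongr ?_ ^ 3
            have h1 : dist x z < depth Ω x / 16 := hx.2
            have h2 := depth_le_add Ω z x
            rw [dist_comm] at h2
            have h3 := depth_nonneg Ω x
            linarith
        _ = w' z * ∫⁻ x in N z, F x := lintegral_const_mul' _ _ hw't
        _ ≤ w' z * (4 * K * ∫⁻ y in closedBall z (3 / 4 * depth Ω z), f y) := by
            gcongr
            exact lintegral_displacement_local_le hg hosc hWm hS hSv hz
        _ = _ := by ring
  have hQm : MeasurableSet
      {p : E3 × E3 | 0 < depth Ω p.1 ∧ dist p.2 p.1 ≤ 3 / 4 * depth Ω p.1} :=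
    (measurableSet_lt (f := fun _ : E3 × E3 => (0 : ℝ)) (g := fun p : E3 × E3 => depth Ω p.1)
      (by fun_prop) (by fun_prop)).inter
      (measurableSet_le (f := fun p : E3 × E3 => dist p.2 p.1)
        (g := fun p : E3 × E3 => 3 / 4 * depth Ω p.1) (by fun_prop) (by fun_prop))
  -- Bounded overlap: a centre z whose ball reaches y has depth at most 4 times that of y, lies
  -- within 3 times the depth of y, and has weight at most (depth y / 4)⁻³. Hence 1728 = 3³ · 4³.
  have s3 : ∫⁻ z, ∫⁻ y,
      {p : E3 × E3 | 0 < depth Ω p.1 ∧ dist p.2 p.1 ≤ 3 / 4 * depth Ω p.1}.indicator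
        (fun p => w' p.1 * f p.2) (z, y) ≤ 1728 * β * ∫⁻ y in Ω, f y := by
    have hQi : Measurable fun p : E3 × E3 =>
        {p : E3 × E3 | 0 < depth Ω p.1 ∧ dist p.2 p.1 ≤ 3 / 4 * depth Ω p.1}.indicator
          (fun p => w' p.1 * f p.2) p := Measurable.indicator (by fun_prop) hQm
    rw [lintegral_lintegral_swap hQi.aemeasurable,
      ← lintegral_const_mul' _ _ (by finiteness), ← lintegral_indicator hΩ.measurableSet]
    refine lintegral_mono fun y => ?_
    by_cases hy : y ∈ Ω
    · have hd := depth_pos hΩ hne hy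
      rw [indicator_of_mem hy]
      calc _ ≤ ∫⁻ z in closedBall y (3 * depth Ω y),
            (ENNReal.ofReal ((depth Ω y / 4) ^ 3))⁻¹ * f y := by
            rw [← lintegral_indicator measurableSet_closedBall]
            refine lintegral_mono fun z => ?_
            by_cases hz : (z, y) ∈ {p : E3 × E3 | 0 < depth Ω p.1 ∧
                dist p.2 p.1 ≤ 3 / 4 * depth Ω p.1}
            · have hz1 : 0 < depth Ω z := hz.1
              have hz2 : dist y z ≤ 3 / 4 * depth Ω z := hz.2
              have h1 := depth_le_add Ω z y
              have h2 := depth_le_add Ω y z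
              rw [dist_comm z y] at h1
              rw [indicator_of_mem hz, indicator_of_mem]
              · gcongr ?_ * f y
                simp only
                gcongr (ENNReal.ofReal ?_)⁻¹
                gcongr ?_ ^ 3
                linarith
              · rw [mem_closedBall, dist_comm]; linarith
            · rw [indicator_of_notMem hz]; exact zero_le
        _ = 1728 * β * f y := by
            rw [setLIntegral_const, volume_closedBall_eq y (by positivity)]
            have h1 : (3 * depth Ω y) ^ 3 = 1728 * (depth Ω y / 4) ^ 3 := by ring
            rw [h1, ENNReal.ofReal_mul (by norm_num)]
            have h2 : (ENNReal.ofReal ((depth Ω y / 4) ^ 3))⁻¹ *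
                ENNReal.ofReal ((depth Ω y / 4) ^ 3) = 1 :=
              ENNReal.inv_mul_cancel (by simpa using by positivity) (by simp)
            calc _ = ((ENNReal.ofReal ((depth Ω y / 4) ^ 3))⁻¹ *
                  ENNReal.ofReal ((depth Ω y / 4) ^ 3)) *
                  (ENNReal.ofReal 1728 * β * f y) := by ring
              _ = _ := by rw [h2, one_mul]; simp
    · rw [indicator_of_notMem hy]
      have : ∀ z, {p : E3 × E3 | 0 < depth Ω p.1 ∧ dist p.2 p.1 ≤ 3 / 4 * depth Ω p.1}.indicator
          (fun p => w' p.1 * f p.2) (z, y) = 0 := by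
        intro z
        refine indicator_of_notMem ?_ _
        rintro ⟨h1, h2⟩
        simp only at h1 h2
        exact hy (closedBall_subset_of_lt_depth (by linarith) h2)
      simp [this]
  rw [s1, hsw]
  calc _ ≤ 4096 * β⁻¹ * ∫⁻ z, 4 * K * ∫⁻ y,
        {p : E3 × E3 | 0 < depth Ω p.1 ∧ dist p.2 p.1 ≤ 3 / 4 * depth Ω p.1}.indicator
          (fun p => w' p.1 * f p.2) (z, y) := by
        gcongr 4096 * β⁻¹ * ?_
        exact lintegral_mono s2
    _ ≤ 4096 * β⁻¹ * (4 * K * (1728 * β * ∫⁻ y in Ω, f y)) := by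
        gcongr
        rw [lintegral_const_mul]
        · gcongr
        · exact Measurable.lintegral_prod_right' (Measurable.indicator (by fun_prop) hQm)
    _ = (β⁻¹ * β) * (4096 * 4 * 1728 * K * ∫⁻ y in Ω, f y) := by ring
    _ = _ := by rw [ENNReal.inv_mul_cancel hβ0 hβt, one_mul]

end Displacement

/-! ### Height functions -/

/-- `ζ` is a Lipschitz height above a graph in the direction of the unit vector `ν`. -/
structure IsHeight (Λ : ℝ) (ν : E3) (ζ : E3 → ℝ) : Prop where
  norm_eq : ‖ν‖ = 1
  lipschitz : ∀ x y, |ζ x - ζ y| ≤ Λ * dist x y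
  shift : ∀ x s, ζ (x + s • ν) = ζ x + s

namespace IsHeight

variable {Λ : ℝ} {ν : E3} {ζ : E3 → ℝ}

lemma one_le (h : IsHeight Λ ν ζ) : 1 ≤ Λ := by
  have h1 := h.lipschitz (0 + (1 : ℝ) • ν) 0
  rw [h.shift] at h1
  simpa [h.norm_eq] using h1

lemma continuous (h : IsHeight Λ ν ζ) : Continuous ζ :=
  (LipschitzWith.of_dist_le_mul (K := Λ.toNNReal) fun x y => by
    rw [Real.dist_eq, Real.coe_toNNReal _ (zero_le_one.trans h.one_le)]
    exact h.lipschitz x y).continuous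

end IsHeight

/-- The map that multiplies heights by `1 + η`. -/
noncomputable def push (η : ℝ) (ν : E3) (ζ : E3 → ℝ) (x : E3) : E3 := x + (η * ζ x) • ν

section Push

variable {Λ η : ℝ} {ν : E3} {ζ : E3 → ℝ}

lemma continuous_push (hζ : IsHeight Λ ν ζ) (η : ℝ) : Continuous (push η ν ζ) := by
  have := hζ.continuous
  unfold push
  fun_prop

lemma height_push (hζ : IsHeight Λ ν ζ) (η : ℝ) (x : E3) :
    ζ (push η ν ζ x) = (1 + η) * ζ x := by
  rw [push, hζ.shift]; ring

lemma dist_push (hζ : IsHeight Λ ν ζ) (hη : 0 ≤ η) {x : E3} (hx : 0 ≤ ζ x) :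
    dist (push η ν ζ x) x = η * ζ x := by
  rw [push, dist_eq_norm, add_sub_cancel_left, norm_smul, hζ.norm_eq, mul_one,
    Real.norm_of_nonneg (mul_nonneg hη hx)]

lemma lintegral_comp_add_mul (F : ℝ → ℝ≥0∞) (hF : Measurable F) (a : ℝ) {t : ℝ} (ht : 0 < t) :
    ∫⁻ s, F (a + t * s) = ENNReal.ofReal t⁻¹ * ∫⁻ s, F s := by
  have h := Measure.map_addHaar_smul (volume : Measure ℝ) ht.ne'
  have h2 : ∫⁻ s, F (a + t * s) = ∫⁻ s, F (a + s) ∂(Measure.map (t • ·) (volume : Measure ℝ)) :=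
    (lintegral_map (f := fun s => F (a + s)) (by fun_prop) (by fun_prop)).symm
  rw [h2, h, lintegral_smul_measure, lintegral_add_left_eq_self F a]
  simp [abs_of_pos ht]

/-- Derivatives of the merely Lipschitz ζ are avoided: insert 1 = ∫ k(ζ x - s) ds, translate by sν,
and change variables only along the line in direction ν. On the right, η survives only in the factor
in front. -/
lemma lintegral_push_eq_slices (hζ : IsHeight Λ ν ζ) (hη : 0 ≤ η) {h : E3 → ℝ≥0∞}
    (hh : Measurable h) :
    ∫⁻ x, h (push η ν ζ x) = ENNReal.ofReal (1 + η)⁻¹ *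
      ∫⁻ x, (Icc (0 : ℝ) 1).indicator 1 (ζ x) * ∫⁻ s : ℝ, h (x + s • ν) := by
  have hζm : Measurable ζ := hζ.continuous.measurable
  have hpm : Measurable (push η ν ζ) := (continuous_push hζ η).measurable
  set k : ℝ → ℝ≥0∞ := (Icc (0 : ℝ) 1).indicator 1 with hk
  have hkm : Measurable k := measurable_one.indicator measurableSet_Icc
  have hk1 : ∀ a : ℝ, ∫⁻ s, k (a - s) = 1 := fun a => by
    rw [lintegral_sub_left_eq_self k a, hk, lintegral_indicator_one measurableSet_Icc]; simp
  calc ∫⁻ x, h (push η ν ζ x) = ∫⁻ x, ∫⁻ s : ℝ, k (ζ x - s) * h (push η ν ζ x) := by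
        refine lintegral_congr fun x => ?_
        rw [lintegral_mul_const _ (by fun_prop), hk1, one_mul]
    _ = ∫⁻ s : ℝ, ∫⁻ x, k (ζ x - s) * h (push η ν ζ x) :=
        lintegral_lintegral_swap (Measurable.aemeasurable (by fun_prop))
    _ = ∫⁻ s : ℝ, ∫⁻ x, k (ζ x) * h (x + (η * ζ x + (1 + η) * s) • ν) := by
        refine lintegral_congr fun s => ?_
        rw [← lintegral_add_right_eq_self _ (s • ν)]
        refine lintegral_congr fun x => ?_
        rw [hζ.shift, add_sub_cancel_right, push, hζ.shift]
        congr 2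
        module
    _ = ∫⁻ x, ∫⁻ s : ℝ, k (ζ x) * h (x + (η * ζ x + (1 + η) * s) • ν) :=
        lintegral_lintegral_swap (Measurable.aemeasurable (by fun_prop))
    _ = ∫⁻ x, ENNReal.ofReal (1 + η)⁻¹ * (k (ζ x) * ∫⁻ s : ℝ, h (x + s • ν)) := by
        refine lintegral_congr fun x => ?_
        rw [lintegral_const_mul _ (by fun_prop),
          lintegral_comp_add_mul (fun s => h (x + s • ν)) (by fun_prop) _ (by linarith)]
        ring
    _ = _ := lintegral_const_mul' _ _ (by simp)

/-- Multiplying heights by `1 + η` multiplies volumes by `1 + η`. -/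
lemma lintegral_push (hζ : IsHeight Λ ν ζ) (hη : 0 ≤ η) {h : E3 → ℝ≥0∞} (hh : Measurable h) :
    ∫⁻ x, h (push η ν ζ x) = ENNReal.ofReal (1 + η)⁻¹ * ∫⁻ x, h x := by
  -- The case η = 0 identifies the slice integral with ∫ h.
  have h0 := lintegral_push_eq_slices hζ le_rfl hh
  simp only [push, zero_mul, zero_smul, add_zero, inv_one, ENNReal.ofReal_one, one_mul] at h0
  rw [lintegral_push_eq_slices hζ hη hh, ← h0]

end Push

/-! ### Absorption -/

/-- Subtract qX from both sides, which is legitimate only because X is finite. -/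
lemma ennreal_absorb {X A Y : ℝ≥0∞} (hX : X ≠ ⊤) {q : ℝ} (hq : 0 ≤ q) (hq1 : q < 1)
    (h : X ≤ A + ENNReal.ofReal q * (X + Y)) : X ≤ ENNReal.ofReal (1 - q)⁻¹ * (A + Y) := by
  have hpos : 0 < (1 - q)⁻¹ := inv_pos.2 (by linarith)
  have hne : ENNReal.ofReal (1 - q)⁻¹ ≠ 0 := by simpa using by linarith
  by_cases hA : A = ⊤
  · simp [hA, ENNReal.mul_top hne]
  by_cases hY : Y = ⊤
  · simp [hY, ENNReal.mul_top hne]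
  lift X to ℝ≥0 using hX
  lift A to ℝ≥0 using hA
  lift Y to ℝ≥0 using hY
  rw [ENNReal.ofReal, ← ENNReal.coe_add, ← ENNReal.coe_mul, ← ENNReal.coe_add,
    ENNReal.coe_le_coe, ← NNReal.coe_le_coe] at h
  rw [ENNReal.ofReal, ← ENNReal.coe_add, ← ENNReal.coe_mul, ENNReal.coe_le_coe,
    ← NNReal.coe_le_coe]
  push_cast at h ⊢
  rw [Real.coe_toNNReal _ hq] at h
  rw [Real.coe_toNNReal _ hpos.le, inv_mul_eq_div, le_div_iff₀ (by linarith)]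
  nlinarith [Y.coe_nonneg, A.coe_nonneg]

/-- The constant in the absorption estimate. -/
noncomputable def absorbConst (η : ℝ) (K : ℝ≥0∞) : ℝ≥0∞ :=
  ENNReal.ofReal (1 - (1 + η / 2) * (1 + η)⁻¹)⁻¹ *
    (ENNReal.ofReal (1 + 2 / η) * (4096 * 4 * 1728 * K) + 1)

lemma absorbConst_ne_top {η : ℝ} {K : ℝ≥0∞} (hK : K ≠ ⊤) : absorbConst η K ≠ ⊤ := by
  unfold absorbConst
  finiteness

section Absorb

variable {Ω : Set E3} {g : E3 → ℝ} {f : E3 → ℝ≥0∞} {K : ℝ≥0∞} {Λ η : ℝ} {ν : E3} {ζ : E3 → ℝ}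

/-- Pushing expands volume by 1 + η, hence shrinks the integral of g² by the same factor, while g
changes little along the push. The part of ∫_W g² that comes back is absorbed; only what escapes
into I remains. -/
lemma lintegral_sq_le_of_push (hΩ : IsOpen Ω) (hne : Ωᶜ.Nonempty) (hg : Measurable g)
    (hf : Measurable f) (hosc : OscBound Ω g f K) (hfin : ∫⁻ x in Ω, ENNReal.ofReal (g x ^ 2) ≠ ⊤)
    (hζ : IsHeight Λ ν ζ) (hη : 0 < η) {W I : Set E3} (hWm : MeasurableSet W)
    (hWΩ : W ⊆ Ω) (hIm : MeasurableSet I) (hWI : ∀ x ∈ W, push η ν ζ x ∈ W ∪ I)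
    (hζ0 : ∀ x ∈ W, 0 ≤ ζ x) (hd : ∀ x ∈ W, η * ζ x ≤ depth Ω x / 16) :
    ∫⁻ x in W, ENNReal.ofReal (g x ^ 2) ≤ absorbConst η K *
      ((∫⁻ x in Ω, f x) + ∫⁻ x in I, ENNReal.ofReal (g x ^ 2)) := by
  set S := push η ν ζ with hS
  have hSm : Measurable S := (continuous_push hζ η).measurable
  have hinv : (1 + η)⁻¹ ≤ 1 := inv_le_one_of_one_le₀ (by linarith)
  have hsc : ∀ h : E3 → ℝ≥0∞, Measurable h →
      ∫⁻ x in W, h (S x) ≤ ENNReal.ofReal (1 + η)⁻¹ * ∫⁻ x, h x := fun h hh =>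
    (setLIntegral_le_lintegral _ _).trans (lintegral_push hζ hη.le hh).le
  have hdisp := lintegral_displacement_le hΩ hne hg hf hosc hWm hWΩ hSm
    (fun x hx => (dist_push hζ hη.le (hζ0 x hx)).trans_le (hd x hx))
    (fun h hh => (hsc h hh).trans (by
      calc _ ≤ 1 * ∫⁻ x, h x := by
            gcongr
            exact (ENNReal.ofReal_le_ofReal hinv).trans (by simp)
        _ = _ := one_mul _))
  set G : E3 → ℝ≥0∞ := fun x => ENNReal.ofReal (g x ^ 2) with hG
  have hGm : Measurable G := by fun_prop
  have hmoved : ∫⁻ x in W, G (S x) ≤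
      ENNReal.ofReal (1 + η)⁻¹ * ((∫⁻ x in W, G x) + ∫⁻ x in I, G x) := by
    calc _ ≤ ∫⁻ x in W, (W ∪ I).indicator G (S x) := by
          refine setLIntegral_mono' hWm fun x hx => ?_
          rw [indicator_of_mem (hWI x hx)]
      _ ≤ ENNReal.ofReal (1 + η)⁻¹ * ∫⁻ x, (W ∪ I).indicator G x :=
          hsc _ (hGm.indicator (hWm.union hIm))
      _ ≤ _ := by
          rw [lintegral_indicator (hWm.union hIm)]
          gcongr
          exact lintegral_union_le _ _ _
  set F := ∫⁻ x in Ω, f x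
  have hXfin : ∫⁻ x in W, G x ≠ ⊤ := ne_top_of_le_ne_top hfin (lintegral_mono_set hWΩ)
  -- Young's inequality (a + b)² ≤ (1 + 2/η)a² + (1 + η/2)b², weighted so that (1 + η/2)/(1 + η)
  -- stays below 1.
  have hmain : ∫⁻ x in W, G x ≤ ENNReal.ofReal (1 + 2 / η) * (4096 * 4 * 1728 * K * F) +
      ENNReal.ofReal ((1 + η / 2) * (1 + η)⁻¹) * ((∫⁻ x in W, G x) + ∫⁻ x in I, G x) := by
    calc ∫⁻ x in W, G x ≤ ∫⁻ x in W, (ENNReal.ofReal (1 + 2 / η) *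
          ENNReal.ofReal ((g x - g (S x)) ^ 2) + ENNReal.ofReal (1 + η / 2) * G (S x)) := by
          refine lintegral_mono fun x => ?_
          simp only [hG]
          rw [← ENNReal.ofReal_mul (by positivity), ← ENNReal.ofReal_mul (by positivity),
            ← ENNReal.ofReal_add (by positivity) (by positivity)]
          refine ENNReal.ofReal_le_ofReal ?_
          set a := g x - g (S x)
          set b := g (S x)
          have e1 : g x = a + b := by simp [a, b]
          have e2 : (1 + 2 / η) * a ^ 2 + (1 + η / 2) * b ^ 2 - (a + b) ^ 2 =
              (2 * a - η * b) ^ 2 / (2 * η) := by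
            field_simp; ring
          have e3 : 0 ≤ (2 * a - η * b) ^ 2 / (2 * η) := by positivity
          rw [e1]
          linarith
      _ = ENNReal.ofReal (1 + 2 / η) * (∫⁻ x in W, ENNReal.ofReal ((g x - g (S x)) ^ 2)) +
          ENNReal.ofReal (1 + η / 2) * ∫⁻ x in W, G (S x) := by
          have hGS : Measurable fun x => ENNReal.ofReal (1 + η / 2) * G (S x) :=
            (hGm.comp hSm).const_mul _
          rw [lintegral_add_right _ hGS,
            lintegral_const_mul' _ _ (by simp), lintegral_const_mul' _ _ (by simp)]
      _ ≤ ENNReal.ofReal (1 + 2 / η) * (4096 * 4 * 1728 * K * F) + ENNReal.ofReal (1 + η / 2) *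
          (ENNReal.ofReal (1 + η)⁻¹ * ((∫⁻ x in W, G x) + ∫⁻ x in I, G x)) := by gcongr
      _ = _ := by rw [ENNReal.ofReal_mul (by positivity)]; ring
  have hq : (1 + η / 2) * (1 + η)⁻¹ < 1 := by
    rw [← div_eq_mul_inv, div_lt_one (by linarith)]; linarith
  refine (ennreal_absorb hXfin (by positivity) hq hmain).trans ?_
  rw [absorbConst, mul_assoc (ENNReal.ofReal (1 - (1 + η / 2) * (1 + η)⁻¹)⁻¹)]
  refine mul_le_mul' le_rfl ?_
  set Y := ∫⁻ x in I, G x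
  set a := ENNReal.ofReal (1 + 2 / η)
  calc a * (4096 * 4 * 1728 * K * F) + Y
      ≤ a * (4096 * 4 * 1728 * K * F) + Y + (a * (4096 * 4 * 1728 * K) * Y + F) := le_self_add
    _ = (a * (4096 * 4 * 1728 * K) + 1) * (F + Y) := by ring

/-! ### The region far from the obstacle. -/

lemma le_depth_far (hH : Ω ⊆ halfSpace) {R : ℝ} (hfar : ∀ x ∈ halfSpace, R ≤ ‖x‖ → x ∈ Ω) {x : E3}
    (hx3 : 2 * R ≤ ‖x‖) : - x 2 / 2 ≤ depth Ω x := by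
  have hne : Ωᶜ.Nonempty := ⟨0, fun h => by simpa [halfSpace] using hH h⟩
  have habs : |x 2| ≤ ‖x‖ := by rw [← Real.norm_eq_abs]; exact PiLp.norm_apply_le x 2
  refine (le_infDist hne).2 fun y hy => ?_
  have h3 := neg_abs_le (x 2)
  -- Inside the half-space the complement lies within radius R, hence at distance at least ‖x‖/2
  -- from x; the rest of the complement is at least as far as the bounding plane.
  by_cases hy2 : y 2 < 0
  · have hyR : ‖y‖ < R := by
      by_contra hcon
      exact hy (hfar y hy2 (not_lt.1 hcon))
    have := norm_sub_norm_le x y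
    rw [dist_eq_norm]
    linarith
  · have h1 : |x 2 - y 2| ≤ dist x y := by
      rw [dist_eq_norm, ← Real.norm_eq_abs]
      exact PiLp.norm_apply_le (x - y) 2
    have h2 := neg_abs_le (x 2 - y 2)
    have h4 : 0 ≤ dist x y := dist_nonneg
    linarith

/-- The estimate far away from the obstacle, where the domain is a half-space. -/
lemma lintegral_sq_far_le (hΩ : IsOpen Ω) (hg : Measurable g)
    (hf : Measurable f) (hosc : OscBound Ω g f K) (hfin : ∫⁻ x in Ω, ENNReal.ofReal (g x ^ 2) ≠ ⊤)
    (hH : Ω ⊆ halfSpace) {R : ℝ} (hR : 0 < R) (hfar : ∀ x ∈ halfSpace, R ≤ ‖x‖ → x ∈ Ω) :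
    ∫⁻ x in {x ∈ halfSpace | 2 * R ≤ ‖x‖}, ENNReal.ofReal (g x ^ 2) ≤
      absorbConst (1 / 32) K * ∫⁻ x in Ω, f x := by
  have hne : Ωᶜ.Nonempty := ⟨0, fun h => by simpa [halfSpace] using hH h⟩
  have hζ : IsHeight 1 (EuclideanSpace.single 2 (-1) : E3) (fun x => - x 2) := by
    refine ⟨by simp, fun x y => ?_, fun x s => by simp; ring⟩
    rw [one_mul, neg_sub_neg, abs_sub_comm, dist_eq_norm, ← Real.norm_eq_abs]
    exact PiLp.norm_apply_le (x - y) 2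
  have hc2 : Continuous fun x : E3 => x 2 := by fun_prop
  have hWm : MeasurableSet {x ∈ halfSpace | 2 * R ≤ ‖x‖} :=
    (hc2.measurable measurableSet_Iio).inter (measurableSet_le measurable_const measurable_norm)
  -- Depth is at least half the height, so η = 1/32 meets the 1/16 requirement. Stretching downwards
  -- preserves the half-space and increases the norm, so nothing leaves the region and I is empty.
  have h := lintegral_sq_le_of_push (η := 1 / 32) hΩ hne hg hf hosc hfin hζ (by norm_num) hWm
    (fun x hx => hfar x hx.1 (by linarith [hx.2])) MeasurableSet.empty ?_ ?_ ?_
  · simpa using h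
  · intro x hx
    left
    have hx2 : x 2 < 0 := hx.1
    have hp : ∀ i, push (1 / 32) (EuclideanSpace.single 2 (-1) : E3) (fun x => - x 2) x i =
        if i = 2 then 33 / 32 * x 2 else x i := by
      intro i
      fin_cases i <;> simp [push]
      ring
    refine ⟨?_, hx.2.trans ?_⟩
    · change push (1 / 32) (EuclideanSpace.single 2 (-1) : E3) (fun x => - x 2) x 2 < 0
      rw [hp]
      simp only [if_true]
      linarith
    · rw [EuclideanSpace.norm_eq, EuclideanSpace.norm_eq]
      refine Real.sqrt_le_sqrt (Finset.sum_le_sum fun i _ => ?_)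
      rw [hp]
      split_ifs with hi
      · subst hi
        simp only [Real.norm_eq_abs, sq_abs]
        nlinarith [sq_nonneg (x 2)]
      · exact le_rfl
  · exact fun x hx => neg_nonneg.2 (le_of_lt hx.1)
  · intro x hx
    have hx2 : x 2 < 0 := hx.1
    have := le_depth_far hH hfar hx.2
    linarith

/-! ### The estimate near the boundary -/

/-- The component of `x - P` orthogonal to `ν`. -/
noncomputable def perp (P ν x : E3) : E3 := (x - P) - inner ℝ (x - P) ν • ν

lemma perp_add_smul (P : E3) {ν : E3} (hν : ‖ν‖ = 1) (x : E3) (s : ℝ) :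
    perp P ν (x + s • ν) = perp P ν x := by
  have h1 : x + s • ν - P = (x - P) + s • ν := by abel
  rw [perp, perp, h1, inner_add_left, inner_smul_left, real_inner_self_eq_norm_sq, hν]
  simp only [conj_trivial]
  module

lemma norm_perp_le (P : E3) {ν : E3} (hν : ‖ν‖ = 1) (x : E3) : ‖perp P ν x‖ ≤ dist x P := by
  rw [dist_eq_norm]
  refine le_of_sq_le_sq ?_ (norm_nonneg _)
  rw [perp, norm_sub_sq_real, inner_smul_right, norm_smul, hν, mul_one, Real.norm_eq_abs, sq_abs]
  nlinarith [sq_nonneg (inner ℝ (x - P) ν)]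

/-- A complement point in the chart has nonpositive height, so the Lipschitz bound keeps it at
distance ζ x / Λ; a point outside the chart is at least r/2 away. -/
lemma le_depth_of_height (hne : Ωᶜ.Nonempty) (hζ : IsHeight Λ ν ζ) {P : E3} {r : ℝ}
    (hchart : ∀ x ∈ ball P r, x ∈ Ω ↔ 0 < ζ x) {x : E3} (hx : dist x P ≤ r / 2) :
    min (ζ x / Λ) (r / 2) ≤ depth Ω x := by
  refine (le_infDist hne).2 fun y hy => ?_
  have hΛ : 0 < Λ := zero_lt_one.trans_le hζ.one_le
  by_cases hxy : dist x y < r / 2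
  · have hyP : y ∈ ball P r := by
      rw [mem_ball]
      have := dist_triangle_left y P x
      linarith
    have hy0 : ζ y ≤ 0 := not_lt.1 fun h => hy ((hchart y hyP).2 h)
    refine (min_le_left _ _).trans ?_
    rw [div_le_iff₀ hΛ, mul_comm]
    have := (le_abs_self _).trans (hζ.lipschitz x y)
    linarith
  · exact (min_le_right _ _).trans (not_lt.1 hxy)

/-- The estimate near a boundary point, in terms of points that are well inside. -/
lemma lintegral_sq_near_le (hΩ : IsOpen Ω) (hne : Ωᶜ.Nonempty) (hg : Measurable g)
    (hf : Measurable f) (hosc : OscBound Ω g f K) (hfin : ∫⁻ x in Ω, ENNReal.ofReal (g x ^ 2) ≠ ⊤)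
    (hζ : IsHeight Λ ν ζ) {P : E3} {r : ℝ} (hr : 0 < r) (hP : ζ P = 0)
    (hchart : ∀ x ∈ ball P r, x ∈ Ω ↔ 0 < ζ x) :
    ∫⁻ x in Ω ∩ ball P (r / (16 * Λ)), ENNReal.ofReal (g x ^ 2) ≤
      absorbConst (1 / (16 * Λ)) K * ((∫⁻ x in Ω, f x) +
        ∫⁻ x in {x ∈ ball P r | r / (16 * Λ) ≤ depth Ω x}, ENNReal.ofReal (g x ^ 2)) := by
  have hΛ1 := hζ.one_le
  have hΛ : 0 < Λ := zero_lt_one.trans_le hΛ1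
  -- With Λρ = h = r/16, heights at the points `P + perp P ν x` are at most h in absolute value over
  -- the cylinder of radius ρ, so its points of height below 2h stay within 4h = r/4 of P.
  set ρ := r / (16 * Λ) with hρ
  set h := r / 16 with hh
  have hhρ : Λ * ρ = h := by rw [hρ, hh]; field_simp
  have hρ0 : 0 < ρ := by positivity
  have hh0 : 0 < h := by positivity
  have hρh : ρ ≤ h := by nlinarith
  have hηdef : 1 / (16 * Λ) ≤ 1 := by rw [div_le_one (by positivity)]; linarith
  set η := 1 / (16 * Λ) with hη
  have hη0 : 0 < η := by positivity
  have hcp : Continuous (perp P ν) := by unfold perp; fun_prop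
  have hcζ := hζ.continuous
  have hclose : ∀ x, ‖perp P ν x‖ < ρ → 0 ≤ ζ x → ζ x < 2 * h → dist x P ≤ r / 4 := by
    intro x hx h0 h2
    set s : ℝ := inner ℝ (x - P) ν with hs
    have e1 : x = (P + perp P ν x) + s • ν := by rw [perp]; abel
    have e2 : ζ x = ζ (P + perp P ν x) + s := by
      conv_lhs => rw [e1]
      exact hζ.shift _ _
    have e3 := hζ.lipschitz (P + perp P ν x) P
    rw [hP, sub_zero, dist_eq_norm, add_sub_cancel_left] at e3
    have e4 : Λ * ‖perp P ν x‖ ≤ h := by rw [← hhρ]; gcongr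
    have e5 := abs_le.1 (e3.trans e4)
    have e6 : |s| ≤ 3 * h := abs_le.2 ⟨by linarith [e5.2], by linarith [e5.1]⟩
    have e7 : dist x P ≤ ‖perp P ν x‖ + |s| := by
      have e8 : x - P = perp P ν x + s • ν := by rw [perp]; abel
      rw [dist_eq_norm, e8]
      refine (norm_add_le _ _).trans ?_
      rw [norm_smul, hζ.norm_eq, mul_one, Real.norm_eq_abs]
    have : r / 4 = 4 * h := by rw [hh]; ring
    linarith
  have hdepth : ∀ x, ‖perp P ν x‖ < ρ → 0 ≤ ζ x → ζ x < 2 * h → ζ x / Λ ≤ depth Ω x := by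
    intro x hx h0 h2
    have h3 := le_depth_of_height hne hζ hchart (x := x) (by linarith [hclose x hx h0 h2])
    rwa [min_eq_left] at h3
    exact (div_le_self h0 hΛ1).trans (by linarith)
  -- Since η ≤ 1, a push from the layer W of heights in (0, h) ends in W or in the layer I of
  -- heights in [h, 2h), where the depth is at least h/Λ = ρ.
  set W : Set E3 := {x | ‖perp P ν x‖ < ρ} ∩ {x | 0 < ζ x} ∩ {x | ζ x < h} with hW
  set I : Set E3 := {x | ‖perp P ν x‖ < ρ} ∩ {x | h ≤ ζ x} ∩ {x | ζ x < 2 * h} with hI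
  have m1 : MeasurableSet {x : E3 | ‖perp P ν x‖ < ρ} :=
    measurableSet_lt (by fun_prop) measurable_const
  have hWm : MeasurableSet W :=
    (m1.inter (measurableSet_lt measurable_const (by fun_prop))).inter
      (measurableSet_lt (by fun_prop) measurable_const)
  have hIm : MeasurableSet I :=
    (m1.inter (measurableSet_le measurable_const (by fun_prop))).inter
      (measurableSet_lt (by fun_prop) measurable_const)
  have key := lintegral_sq_le_of_push (W := W) (I := I) hΩ hne hg hf hosc hfin hζ hη0 hWm ?_ hIm
    ?_ ?_ ?_
  · calc _ ≤ ∫⁻ x in W, ENNReal.ofReal (g x ^ 2) := by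
          refine lintegral_mono_set ?_
          rintro x ⟨hxΩ, hxP⟩
          have hxP' : dist x P < ρ := hxP
          have hxr : x ∈ ball P r := by
            rw [mem_ball]
            have : h ≤ r := by rw [hh]; linarith
            linarith
          refine ⟨⟨(norm_perp_le P hζ.norm_eq x).trans_lt hxP', (hchart x hxr).1 hxΩ⟩, ?_⟩
          have h1 := (le_abs_self _).trans (hζ.lipschitz x P)
          rw [hP, sub_zero] at h1
          have h2 : Λ * dist x P < Λ * ρ := by gcongr
          exact (h1.trans_lt h2).trans_eq hhρ
      _ ≤ _ := key
      _ ≤ _ := by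
          gcongr
          rintro x ⟨⟨hx1, hx2⟩, hx3⟩
          have hx2' : h ≤ ζ x := hx2
          refine ⟨?_, ?_⟩
          · rw [mem_ball]
            have := hclose x hx1 (hh0.le.trans hx2') hx3
            linarith
          · refine le_trans ?_ (hdepth x hx1 (hh0.le.trans hx2') hx3)
            rw [le_div_iff₀ hΛ, mul_comm, hhρ]
            exact hx2'
  · rintro x ⟨⟨hx1, hx2⟩, hx3⟩
    have hx2' : 0 < ζ x := hx2
    have hx3' : ζ x < h := hx3
    refine (hchart x ?_).2 hx2
    rw [mem_ball]
    have := hclose x hx1 hx2'.le (by linarith)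
    linarith
  · rintro x ⟨⟨hx1, hx2⟩, hx3⟩
    have hx2' : 0 < ζ x := hx2
    have hx3' : ζ x < h := hx3
    have hp : ‖perp P ν (push η ν ζ x)‖ < ρ := by
      rw [push, perp_add_smul P hζ.norm_eq]; exact hx1
    have hz := height_push hζ η x
    have hz0 : 0 < ζ (push η ν ζ x) := by rw [hz]; positivity
    have hz2 : ζ (push η ν ζ x) < 2 * h := by rw [hz]; nlinarith
    by_cases hcase : ζ (push η ν ζ x) < h
    · exact Or.inl ⟨⟨hp, hz0⟩, hcase⟩
    · exact Or.inr ⟨⟨hp, not_lt.1 hcase⟩, hz2⟩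
  · exact fun x hx => le_of_lt hx.1.2
  · rintro x ⟨⟨hx1, hx2⟩, hx3⟩
    have hx2' : 0 < ζ x := hx2
    have hx3' : ζ x < h := hx3
    have h1 := hdepth x hx1 hx2'.le (by linarith)
    have : η * ζ x = ζ x / Λ / 16 := by rw [hη]; field_simp
    rw [this]
    linarith

end Absorb

/-! ### Domains with Lipschitz charts -/

/-- A connected open subset of the half-space that agrees with it outside the ball of radius `R`
and lies locally on one side of a Lipschitz graph, uniformly at scale `r`. -/
structure IsChartedDomain (r Λ R : ℝ) (Ω : Set E3) : Prop where
  isOpen : IsOpen Ω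
  isPreconnected : IsPreconnected Ω
  subset_halfSpace : Ω ⊆ halfSpace
  far : ∀ x ∈ halfSpace, R ≤ ‖x‖ → x ∈ Ω
  chart : ∀ P ∈ frontier Ω, ∃ ν ζ, IsHeight Λ ν ζ ∧ ζ P = 0 ∧ ∀ x ∈ ball P r, x ∈ Ω ↔ 0 < ζ x

namespace IsChartedDomain

variable {r Λ R : ℝ} {Ω : Set E3}

lemma compl_nonempty (h : IsChartedDomain r Λ R Ω) : Ωᶜ.Nonempty :=
  ⟨0, fun h0 => by simpa [halfSpace] using h.subset_halfSpace h0⟩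

lemma exists_frontier (h : IsChartedDomain r Λ R Ω) {x : E3} (hx : x ∈ Ω) :
    ∃ P ∈ frontier Ω, depth Ω x = dist x P :=
  exists_mem_frontier_infDist_compl_eq_dist hx fun hu => by
    obtain ⟨y, hy⟩ := h.compl_nonempty
    exact hy (hu ▸ mem_univ y)

end IsChartedDomain

/-- A short step between two points of depth at least `t`. -/
def Step (Ω : Set E3) (t σ : ℝ) (p q : E3) : Prop :=
  t ≤ depth Ω p ∧ t ≤ depth Ω q ∧ dist p q < σ

/-- Points joined by a chain of short steps. -/
def Chain (Ω : Set E3) (t σ : ℝ) : E3 → E3 → Prop := Relation.ReflTransGen (Step Ω t σ)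

section Chains

variable {r Λ R t σ : ℝ} {Ω : Set E3}

lemma Step.symm {p q : E3} (h : Step Ω t σ p q) : Step Ω t σ q p :=
  ⟨h.2.1, h.1, by rw [dist_comm]; exact h.2.2⟩

lemma Chain.symm {p q : E3} (h : Chain Ω t σ p q) : Chain Ω t σ q p := by
  induction h with
  | refl => exact Relation.ReflTransGen.refl
  | tail _ hs ih => exact Relation.ReflTransGen.head hs.symm ih

lemma Chain.trans {p q s : E3} (h : Chain Ω t σ p q) (h' : Chain Ω t σ q s) : Chain Ω t σ p s :=
  Relation.ReflTransGen.trans h h'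

/-- Being joined by a chain is an equivalence relation that holds between nearby points of A, hence
between all points of a connected set. -/
lemma chain_of_isPreconnected (hσ : 0 < σ) {A : Set E3} (hA : IsPreconnected A)
    (hsub : ∀ x ∈ A, t ≤ depth Ω x) {p q : E3} (hp : p ∈ A) (hq : q ∈ A) : Chain Ω t σ p q := by
  refine hA.induction₂ (Chain Ω t σ) (fun x hx => ?_) (fun _ _ _ _ _ _ h h' => h.trans h')
    (fun _ _ _ _ h => h.symm) hp hq
  filter_upwards [self_mem_nhdsWithin, mem_nhdsWithin_of_mem_nhds (ball_mem_nhds x hσ)] with y hy hxy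
  exact Relation.ReflTransGen.single ⟨hsub x hx, hsub y hy, by rwa [mem_ball, dist_comm] at hxy⟩

lemma chain_of_segment (hσ : 0 < σ) {p q : E3} (hsub : ∀ x ∈ segment ℝ p q, t ≤ depth Ω x) :
    Chain Ω t σ p q :=
  chain_of_isPreconnected hσ (convex_segment p q).isPreconnected hsub (left_mem_segment ℝ p q)
    (right_mem_segment ℝ p q)

/-- Descending from x by ζ x along ν reaches height zero, still inside the chart, hence a point of
the complement. -/
lemma depth_le_height {ν : E3} {ζ : E3 → ℝ} (hζ : IsHeight Λ ν ζ) {P x : E3}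
    (hP : ζ P = 0) (hchart : ∀ x ∈ ball P r, x ∈ Ω ↔ 0 < ζ x) (hx0 : 0 < ζ x)
    (hx : 2 * Λ * dist x P < r) : depth Ω x ≤ ζ x := by
  have h1 := (le_abs_self _).trans (hζ.lipschitz x P)
  rw [hP, sub_zero] at h1
  have hd : dist (x + (-ζ x) • ν) x = ζ x := by
    rw [dist_eq_norm, add_sub_cancel_left, norm_smul, hζ.norm_eq, mul_one, norm_neg,
      Real.norm_of_nonneg hx0.le]
  have hmem : x + (-ζ x) • ν ∈ ball P r := by
    rw [mem_ball]
    have h2 := dist_triangle (x + (-ζ x) • ν) x P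
    have h3 : dist x P ≤ Λ * dist x P := le_mul_of_one_le_left dist_nonneg hζ.one_le
    linarith
  have hn : x + (-ζ x) • ν ∈ Ωᶜ := fun h => by
    have := (hchart _ hmem).1 h
    rw [hζ.shift] at this
    linarith
  calc depth Ω x ≤ dist x (x + (-ζ x) • ν) := infDist_le_dist_of_mem hn
    _ = ζ x := by rw [dist_comm, hd]

/-- Every point has a point of fixed depth nearby. -/
lemma exists_deep_near (h : IsChartedDomain r Λ R Ω) {s : ℝ} (hs : 0 < s)
    (hΛ : 1 ≤ Λ) (hsr : r = 32 * Λ ^ 2 * s) {x : E3} (hx : x ∈ Ω) :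
    ∃ p, s ≤ depth Ω p ∧ dist p x ≤ Λ * s := by
  by_cases hxs : s ≤ depth Ω x
  · exact ⟨x, hxs, by rw [dist_self]; positivity⟩
  push Not at hxs
  obtain ⟨P, hPf, hPd⟩ := h.exists_frontier hx
  obtain ⟨ν, ζ, hζ, hζP, hchart⟩ := h.chart P hPf
  have hΛ2 : Λ ≤ Λ ^ 2 := by nlinarith
  have hΛs : Λ * s ≤ Λ ^ 2 * s := by gcongr
  have hsΛ : s ≤ Λ * s := le_mul_of_one_le_left hs.le hΛ
  have hxr : x ∈ ball P r := by rw [mem_ball]; linarith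
  have hx0 := (hchart x hxr).1 hx
  have hd : dist (x + (Λ * s) • ν) x = Λ * s := by
    rw [dist_eq_norm, add_sub_cancel_left, norm_smul, hζ.norm_eq, mul_one,
      Real.norm_of_nonneg (by positivity)]
  refine ⟨x + (Λ * s) • ν, ?_, hd.le⟩
  have h2 := dist_triangle (x + (Λ * s) • ν) x P
  refine le_trans ?_ (le_depth_of_height h.compl_nonempty hζ hchart (by linarith))
  refine le_min ?_ (by linarith)
  rw [hζ.shift, le_div_iff₀ (by linarith)]
  linarith

/-- Deep points that are close to each other are joined by a chain. -/
lemma chain_of_dist_le (h : IsChartedDomain r Λ R Ω) (hσ : 0 < σ) {s : ℝ} (hs : 0 < s)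
    (hΛ : 1 ≤ Λ) (hsr : r = 32 * Λ ^ 2 * s) {p q : E3} (hp : s ≤ depth Ω p) (hq : s ≤ depth Ω q)
    (hpq : dist p q ≤ 3 * Λ * s) : Chain Ω (s / Λ) σ p q := by
  have hΛ2 : Λ ≤ Λ ^ 2 := by nlinarith
  have hΛs : Λ * s ≤ Λ ^ 2 * s := by gcongr
  have hsΛ : s ≤ Λ * s := le_mul_of_one_le_left hs.le hΛ
  have hs' : s / Λ ≤ s := div_le_self hs.le hΛ
  have hΛ0 : 0 < Λ := by linarith
  -- If p is this deep, the straight segment to q loses at most 3Λs of depth. Otherwise both points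
  -- lie in a single chart.
  by_cases hdeep : 4 * Λ * s ≤ depth Ω p
  · refine chain_of_segment hσ fun y hy => ?_
    have h1 : dist y p ≤ dist p q := by
      have := (convex_closedBall p (dist p q)).segment_subset
        (mem_closedBall_self dist_nonneg) (by rw [mem_closedBall, dist_comm]) hy
      exact this
    have h2 := depth_le_add Ω p y
    rw [dist_comm] at h2
    linarith
  push Not at hdeep
  have hpΩ : p ∈ Ω := mem_of_depth_pos (hs.trans_le hp)
  have hqΩ : q ∈ Ω := mem_of_depth_pos (hs.trans_le hq)
  obtain ⟨P, hPf, hPd⟩ := h.exists_frontier hpΩ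
  obtain ⟨ν, ζ, hζ, hζP, hchart⟩ := h.chart P hPf
  have hpP : dist p P ≤ 7 * Λ * s := by linarith
  have hqP : dist q P ≤ 7 * Λ * s := by
    have := dist_triangle_left q P p
    linarith
  have hheight : ∀ x ∈ Ω, s ≤ depth Ω x → dist x P ≤ 7 * Λ * s → s ≤ ζ x := by
    intro x hx hxs hxP
    have hxr : x ∈ ball P r := by rw [mem_ball]; nlinarith
    have h2 : 2 * Λ * dist x P ≤ 2 * Λ * (7 * Λ * s) := by gcongr
    have h3 : 0 < Λ ^ 2 * s := by positivity
    exact hxs.trans (depth_le_height hζ hζP hchart ((hchart x hxr).1 hx) (by linarith))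
  -- The path rises by T from p, crosses over, and comes down to q. Crossing a distance of at most
  -- 3Λs changes height by at most 3Λ²s, which the lift T outweighs.
  set T := 4 * Λ ^ 2 * s with hT
  have hT0 : 0 ≤ T := by positivity
  have hdepth : ∀ y, dist y P ≤ 11 * Λ ^ 2 * s → s ≤ ζ y → s / Λ ≤ depth Ω y := by
    intro y hy hys
    have h3 : 0 < Λ ^ 2 * s := by positivity
    refine le_trans (le_min ?_ ?_)
      (le_depth_of_height h.compl_nonempty hζ hchart (x := y) (by linarith))
    · gcongr
    · linarith
  have hshift : ∀ x τ, 0 ≤ τ → τ ≤ T → dist x P ≤ 7 * Λ * s →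
      dist (x + τ • ν) P ≤ 11 * Λ ^ 2 * s := by
    intro x τ hτ hτT hx
    have h1 : dist (x + τ • ν) x = τ := by
      rw [dist_eq_norm, add_sub_cancel_left, norm_smul, hζ.norm_eq, mul_one,
        Real.norm_of_nonneg hτ]
    have h2 := dist_triangle (x + τ • ν) x P
    linarith
  have hup : ∀ x ∈ Ω, s ≤ depth Ω x → dist x P ≤ 7 * Λ * s →
      Chain Ω (s / Λ) σ x (x + T • ν) := by
    intro x hx hxs hxP
    refine chain_of_segment hσ fun y hy => ?_
    rw [segment_eq_image'] at hy
    obtain ⟨θ, ⟨hθ0, hθ1⟩, rfl⟩ := hy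
    simp only [add_sub_cancel_left, smul_smul]
    have hτ : 0 ≤ θ * T := by positivity
    refine hdepth _ (hshift x _ hτ (mul_le_of_le_one_left hT0 hθ1) hxP) ?_
    rw [hζ.shift]
    linarith [hheight x hx hxs hxP]
  refine (hup p hpΩ hp hpP).trans (Chain.trans ?_ (hup q hqΩ hq hqP).symm)
  refine chain_of_segment hσ fun y hy => hdepth y ?_ ?_
  · exact (convex_closedBall P (11 * Λ ^ 2 * s)).segment_subset (hshift p T hT0 le_rfl hpP)
      (hshift q T hT0 le_rfl hqP) hy
  · have h1 : dist y (p + T • ν) ≤ dist p q := by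
      have := (convex_closedBall (p + T • ν) (dist p q)).segment_subset
        (mem_closedBall_self dist_nonneg)
        (by rw [mem_closedBall, dist_add_right, dist_comm]) hy
      exact this
    have h2 := (neg_abs_le _).trans' (neg_le_neg (hζ.lipschitz y (p + T • ν)))
    rw [hζ.shift] at h2
    have h3 := hheight p hpΩ hp hpP
    have h4 : Λ * dist y (p + T • ν) ≤ Λ * (3 * Λ * s) := by
      gcongr
      exact h1.trans hpq
    have h5 : 0 < Λ ^ 2 * s := by positivity
    linarith

/-- All deep points are joined by chains. -/
lemma chain_of_deep (h : IsChartedDomain r Λ R Ω) (hσ : 0 < σ) {s : ℝ} (hs : 0 < s)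
    (hΛ : 1 ≤ Λ) (hsr : r = 32 * Λ ^ 2 * s) {p q : E3} (hp : s ≤ depth Ω p)
    (hq : s ≤ depth Ω q) : Chain Ω (s / Λ) σ p q := by
  have hΛs : 0 < Λ * s := by positivity
  -- The deep set itself need not be connected, so the connectedness of Ω is used through this
  -- relation on all its points. It holds locally because a and b are then within 3Λs, and
  -- `exists_deep_near` supplies the middle point for transitivity.
  let Q : E3 → E3 → Prop := fun x y => ∀ a b, s ≤ depth Ω a → s ≤ depth Ω b →
    dist a x ≤ Λ * s → dist b y ≤ Λ * s → Chain Ω (s / Λ) σ a b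
  have hQ : Q p q := by
    refine h.isPreconnected.induction₂ Q (fun x hx => ?_) ?_ ?_
      (mem_of_depth_pos (hs.trans_le hp)) (mem_of_depth_pos (hs.trans_le hq))
    · filter_upwards [mem_nhdsWithin_of_mem_nhds (ball_mem_nhds x hΛs)] with y hy
      intro a b ha hb hax hby
      refine chain_of_dist_le h hσ hs hΛ hsr ha hb ?_
      have h1 := dist_triangle4 a x y b
      rw [mem_ball, dist_comm] at hy
      rw [dist_comm b y] at hby
      linarith
    · intro x y z _ hy _ hxy hyz a c ha hc hax hcz
      obtain ⟨b, hb, hby⟩ := exists_deep_near h hs hΛ hsr hy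
      exact (hxy a b ha hb hax hby).trans (hyz b c hb hc hby hcz)
    · intro x y _ _ hxy a b ha hb hay hbx
      exact (hxy b a hb ha hbx hay).symm
  exact hQ p q hp hq (by rw [dist_self]; positivity) (by rw [dist_self]; positivity)

end Chains

/-! ### Propagation along chains -/

/-- A quantity that varies by bounded factors along steps and within the cells of a finite
partition varies by a bounded factor along chains of arbitrary length. -/
lemma le_of_reflTransGen {α ι : Type*} [Fintype ι] {step : α → α → Prop} (D : Set α)
    (hstepD : ∀ p q, step p q → p ∈ D ∧ q ∈ D) (cell : α → ι) (b : α → ℝ≥0∞)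
    (hcell : ∀ p ∈ D, ∀ q ∈ D, cell p = cell q → b p ≤ 4 * b q)
    (hstep : ∀ p q, step p q → b p ≤ 4 * b q ∧ b q ≤ 4 * b p)
    {p q : α} (hp : p ∈ D) (hq : q ∈ D) (h : Relation.ReflTransGen step p q) :
    b p ≤ 4 * 16 ^ Fintype.card ι * b q := by
  classical
  -- A path in the graph of cells visits each cell at most once, whatever the length of the chain.
  -- Each edge costs 4 for moving within a cell and 4 for the step.
  let Γ : SimpleGraph ι := SimpleGraph.fromRel fun i j => ∃ p q, step p q ∧ cell p = i ∧ cell q = j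
  have hreach : ∀ q, Relation.ReflTransGen step p q → Γ.Reachable (cell p) (cell q) := by
    intro q h
    induction h with
    | refl => exact SimpleGraph.Reachable.refl _
    | @tail a c _ hs ih =>
      by_cases hc : cell a = cell c
      · rwa [← hc]
      · refine ih.trans (SimpleGraph.Adj.reachable ?_)
        rw [SimpleGraph.fromRel_adj]
        exact ⟨hc, Or.inl ⟨a, c, hs, rfl, rfl⟩⟩
  have hwalk : ∀ {i j : ι} (w : Γ.Walk i j), ∀ p ∈ D, ∀ q ∈ D, cell p = i → cell q = j →
      b p ≤ 4 * 16 ^ w.length * b q := by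
    intro i j w
    induction w with
    | nil =>
      intro p hp q hq hpi hqi
      simpa using hcell p hp q hq (hpi.trans hqi.symm)
    | @cons i k j hadj w ih =>
      intro p hp q hq hpi hqj
      have : ∃ p' ∈ D, ∃ q' ∈ D, cell p' = i ∧ cell q' = k ∧ b p' ≤ 4 * b q' := by
        rw [SimpleGraph.fromRel_adj] at hadj
        rcases hadj.2 with ⟨p', q', hs, hi, hk⟩ | ⟨q', p', hs, hk, hi⟩
        · exact ⟨p', (hstepD _ _ hs).1, q', (hstepD _ _ hs).2, hi, hk, (hstep _ _ hs).1⟩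
        · exact ⟨p', (hstepD _ _ hs).2, q', (hstepD _ _ hs).1, hi, hk, (hstep _ _ hs).2⟩
      obtain ⟨p', hp', q', hq', hi, hk, hb⟩ := this
      calc b p ≤ 4 * b p' := hcell p hp p' hp' (hpi.trans hi.symm)
        _ ≤ 4 * (4 * (4 * 16 ^ w.length * b q)) := by
            gcongr
            exact hb.trans (by gcongr; exact ih q' hq' q hq hk hqj)
        _ = _ := by rw [SimpleGraph.Walk.length_cons, pow_succ]; ring
  obtain ⟨w, hw⟩ := (hreach q h).exists_isPath
  refine (hwalk w p hp q hq rfl rfl).trans ?_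
  gcongr
  · norm_num
  · exact hw.length_lt.le

/-! ### Propagation of the estimate through the interior -/

section Interior

variable {Ω : Set E3} {g : E3 → ℝ} {f : E3 → ℝ≥0∞} {K : ℝ≥0∞}

lemma ofReal_sq_le_two_mul (a c : ℝ) : ENNReal.ofReal (a ^ 2) ≤
    2 * ENNReal.ofReal ((a - c) ^ 2) + 2 * ENNReal.ofReal (c ^ 2) := by
  have := ofReal_sq_sub_le a 0 c
  simpa using this

/-- Both balls lie in the ball of radius t/4 about p, where g is close to a single constant a; as
they have equal volume, the integral of a² passes from one to the other. -/
lemma lintegral_sq_step_le (hg : Measurable g) (hosc : OscBound Ω g f K) {t : ℝ} (ht : 0 < t)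
    {p q : E3} (h : Step Ω t (t / 8) p q) :
    ∫⁻ x in ball p (t / 8), ENNReal.ofReal (g x ^ 2) ≤
      4 * (∫⁻ x in ball q (t / 8), ENNReal.ofReal (g x ^ 2)) + 6 * K * ∫⁻ x in Ω, f x := by
  obtain ⟨hp, -, hpq⟩ := h
  have hsub : closedBall p (3 * (t / 4)) ⊆ Ω := closedBall_subset_of_lt_depth (by linarith)
  obtain ⟨a, ha⟩ := hosc p (t / 4) (by positivity) hsub
  set F := ∫⁻ x in Ω, f x
  have ha' : ∫⁻ x in ball p (t / 4), ENNReal.ofReal ((g x - a) ^ 2) ≤ K * F :=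
    ha.trans (by gcongr; exact lintegral_mono_set hsub)
  have hpb : ∫⁻ x in ball p (t / 8), ENNReal.ofReal ((g x - a) ^ 2) ≤ K * F :=
    (lintegral_mono_set (ball_subset_ball (by linarith))).trans ha'
  have hqb : ∫⁻ x in ball q (t / 8), ENNReal.ofReal ((g x - a) ^ 2) ≤ K * F :=
    (lintegral_mono_set (ball_subset_ball' (by rw [dist_comm]; linarith))).trans ha'
  have hm : Measurable fun x => ENNReal.ofReal ((g x - a) ^ 2) := by fun_prop
  have hvol : ENNReal.ofReal (a ^ 2) * volume (ball q (t / 8)) ≤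
      2 * (K * F) + 2 * ∫⁻ x in ball q (t / 8), ENNReal.ofReal (g x ^ 2) := by
    rw [← setLIntegral_const]
    calc _ ≤ ∫⁻ x in ball q (t / 8), (2 * ENNReal.ofReal ((g x - a) ^ 2) +
          2 * ENNReal.ofReal (g x ^ 2)) := by
          refine lintegral_mono fun x => ?_
          have h1 := ofReal_sq_le_two_mul a (g x)
          rwa [show (a - g x) ^ 2 = (g x - a) ^ 2 by ring] at h1
      _ = 2 * (∫⁻ x in ball q (t / 8), ENNReal.ofReal ((g x - a) ^ 2)) +
          2 * ∫⁻ x in ball q (t / 8), ENNReal.ofReal (g x ^ 2) := by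
          rw [lintegral_add_left (hm.const_mul _), lintegral_const_mul' _ _ (by simp),
            lintegral_const_mul' _ _ (by simp)]
      _ ≤ _ := by gcongr
  calc _ ≤ ∫⁻ x in ball p (t / 8), (2 * ENNReal.ofReal ((g x - a) ^ 2) +
        2 * ENNReal.ofReal (a ^ 2)) := lintegral_mono fun x => ofReal_sq_le_two_mul _ _
    _ = 2 * (∫⁻ x in ball p (t / 8), ENNReal.ofReal ((g x - a) ^ 2)) +
        2 * (ENNReal.ofReal (a ^ 2) * volume (ball q (t / 8))) := by
        rw [lintegral_add_left (hm.const_mul _), lintegral_const_mul' _ _ (by simp),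
          setLIntegral_const, Measure.addHaar_ball_center _ p, Measure.addHaar_ball_center _ q,
          mul_assoc]
    _ ≤ 2 * (K * F) + 2 * (2 * (K * F) +
        2 * ∫⁻ x in ball q (t / 8), ENNReal.ofReal (g x ^ 2)) := by gcongr
    _ = _ := by ring

lemma lintegral_biUnion_finset_le (c₀ : Finset E3) (A : E3 → Set E3) (h : E3 → ℝ≥0∞) :
    ∫⁻ x in ⋃ c ∈ c₀, A c, h x ≤ ∑ c ∈ c₀, ∫⁻ x in A c, h x := by
  classical
  induction c₀ using Finset.induction_on with
  | empty => simp
  | insert c s hc ih =>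
    rw [Finset.set_biUnion_insert, Finset.sum_insert hc]
    exact (lintegral_union_le _ _ _).trans (by gcongr)

/-- Adding the error to both quantities makes the comparison purely multiplicative, the form that
iterates along chains. -/
lemma le_four_mul_add {a a' B B' : ℝ≥0∞} (hB : B' ≤ B) (h : a ≤ 4 * a' + B') :
    a + B ≤ 4 * (a' + B) := by
  calc a + B ≤ 4 * a' + B + B := by gcongr; exact h.trans (by gcongr)
    _ ≤ 4 * a' + B + B + 2 * B := le_self_add
    _ = _ := by ring

/-- Setting for the estimates: `g` is square integrable on a charted domain and its oscillation is
controlled by `f`. -/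
structure IsControlled (r Λ R : ℝ) (K : ℝ≥0∞) (Ω : Set E3) (g : E3 → ℝ) (f : E3 → ℝ≥0∞) :
    Prop where
  domain : IsChartedDomain r Λ R Ω
  measurable_left : Measurable g
  measurable_right : Measurable f
  osc : OscBound Ω g f K
  finite : ∫⁻ x in Ω, ENNReal.ofReal (g x ^ 2) ≠ ⊤

lemma IsControlled.far_le {r Λ R : ℝ} (hR : 0 < R) (h : IsControlled r Λ R K Ω g f) :
    ∫⁻ x in {x ∈ halfSpace | 2 * R ≤ ‖x‖}, ENNReal.ofReal (g x ^ 2) ≤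
      absorbConst (1 / 32) K * ∫⁻ x in Ω, f x :=
  lintegral_sq_far_le h.domain.isOpen h.measurable_left h.measurable_right h.osc h.finite
    h.domain.subset_halfSpace hR h.domain.far

/-- A deep point is joined by a chain to a point far below, where the far estimate applies. The
cells are fixed before Ω is chosen, so the loss depends only on r, Λ, R and K. -/
lemma exists_interior_bound {r Λ R : ℝ} (hr : 0 < r) (hΛ : 1 ≤ Λ) (hR : 0 < R) (hK : K ≠ ⊤) :
    ∃ C : ℝ≥0∞, C ≠ ⊤ ∧ ∀ Ω g f, IsControlled r Λ R K Ω g f →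
      ∫⁻ x in {x ∈ closedBall 0 (2 * R + 2 * r) | r / (32 * Λ ^ 2) ≤ depth Ω x},
        ENNReal.ofReal (g x ^ 2) ≤ C * ∫⁻ x in Ω, f x := by
  classical
  set s := r / (32 * Λ ^ 2) with hs
  have hs0 : 0 < s := by positivity
  have hsr : r = 32 * Λ ^ 2 * s := by rw [hs]; field_simp
  have hsler : s ≤ r := div_le_self hr.le (by nlinarith)
  set t := s / Λ with ht
  have ht0 : 0 < t := by positivity
  have hts : t ≤ s := div_le_self hs0.le hΛ
  obtain ⟨c₀, -, hc₀, hcov₀⟩ := (isCompact_closedBall (0 : E3) (2 * R + 2 * r)).finite_cover_balls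
    (e := t / 16) (by positivity)
  lift c₀ to Finset E3 using hc₀
  have hcov : ∀ p ∈ closedBall (0 : E3) (2 * R + 2 * r), ∃ c : c₀, p ∈ ball (c : E3) (t / 16) := by
    intro p hp
    obtain ⟨c, hc, hpc⟩ := mem_iUnion₂.1 (hcov₀ hp)
    exact ⟨⟨c, hc⟩, hpc⟩
  have : Nonempty c₀ := ⟨(hcov 0 (mem_closedBall_self (by positivity))).choose⟩
  choose! center hcenter using hcov
  -- The value `none` gathers everything outside the large ball; there the far estimate bounds the
  -- integral directly, however far apart two points are.
  let cell : E3 → Option c₀ := fun p =>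
    if p ∈ closedBall (0 : E3) (2 * R + 2 * r) then some (center p) else none
  set n := Fintype.card (Option c₀) with hn
  set M : ℝ≥0∞ := 6 * K + absorbConst (1 / 32) K with hM
  have hMt : M ≠ ⊤ := ENNReal.add_ne_top.2 ⟨by finiteness, absorbConst_ne_top hK⟩
  refine ⟨(c₀.card : ℝ≥0∞) * (4 * 16 ^ n * (2 * M)), by finiteness, fun Ω g f h => ?_⟩
  set F := ∫⁻ x in Ω, f x
  set a : E3 → ℝ≥0∞ := fun p => ∫⁻ x in ball p (t / 8), ENNReal.ofReal (g x ^ 2) with ha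
  set D : Set E3 := {p | t ≤ depth Ω p}
  have hstepD : ∀ p q, Step Ω t (t / 8) p q → p ∈ D ∧ q ∈ D := fun p q h => ⟨h.1, h.2.1⟩
  have hstep1 : ∀ p q, Step Ω t (t / 8) p q → a p + M * F ≤ 4 * (a q + M * F) := fun p q hpq =>
    le_four_mul_add (by gcongr; exact le_self_add)
      (lintegral_sq_step_le h.measurable_left h.osc ht0 hpq)
  have hfar : ∀ p ∈ D, 2 * R + 2 * r ≤ ‖p‖ → a p ≤ M * F := by
    intro p hp hpn
    have hpd : t ≤ depth Ω p := hp
    calc a p ≤ ∫⁻ x in {x ∈ halfSpace | 2 * R ≤ ‖x‖}, ENNReal.ofReal (g x ^ 2) := by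
          refine lintegral_mono_set fun x hx => ⟨h.domain.subset_halfSpace ?_, ?_⟩
          · exact closedBall_subset_of_lt_depth (r := t / 8) (by linarith)
              (ball_subset_closedBall hx)
          · rw [mem_ball, dist_comm, dist_eq_norm] at hx
            have := norm_sub_norm_le p x
            linarith
      _ ≤ absorbConst (1 / 32) K * F := h.far_le hR
      _ ≤ M * F := by gcongr; exact le_add_self
  have hcell : ∀ p ∈ D, ∀ q ∈ D, cell p = cell q → a p + M * F ≤ 4 * (a q + M * F) := by
    intro p hp q hq hpq
    by_cases hpb : p ∈ closedBall (0 : E3) (2 * R + 2 * r) <;>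
    by_cases hqb : q ∈ closedBall (0 : E3) (2 * R + 2 * r) <;>
    simp only [cell, hpb, hqb, if_true, if_false, Option.some.injEq, reduceCtorEq] at hpq
    · refine hstep1 p q ⟨hp, hq, ?_⟩
      have h1 := mem_ball.1 (hcenter p hpb)
      have h2 := mem_ball.1 (hcenter q hqb)
      rw [hpq] at h1
      have := dist_triangle_right p q (center q : E3)
      linarith
    · refine le_four_mul_add le_rfl ((hfar p hp ?_).trans le_add_self)
      rw [mem_closedBall_zero_iff, not_le] at hpb
      exact hpb.le
  have hdeep : ∀ p, s ≤ depth Ω p → a p ≤ 4 * 16 ^ n * (2 * M) * F := by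
    intro p hp
    set L := 2 * R + 2 * r + 2 * s with hL
    -- The reference point on the negative vertical axis; its depth is at least L/2 = R + r + s.
    set q : E3 := EuclideanSpace.single 2 (-L) with hq
    have hL0 : 0 < L := by positivity
    have hqn : ‖q‖ = L := by simp [hq, abs_of_pos hL0]
    have hqd : s ≤ depth Ω q := by
      have h1 := le_depth_far h.domain.subset_halfSpace h.domain.far (x := q) (by linarith)
      have h2 : q 2 = -L := by simp [hq]
      rw [h2] at h1
      linarith
    have hqa : a q ≤ M * F := hfar q (hts.trans hqd) (by linarith)
    have hchain := chain_of_deep h.domain (σ := t / 8) (by positivity) hs0 hΛ hsr hp hqd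
    have key := le_of_reflTransGen D hstepD cell (fun p => a p + M * F) hcell
      (fun p q hpq => ⟨hstep1 p q hpq, hstep1 q p hpq.symm⟩) (hts.trans hp) (hts.trans hqd) hchain
    calc a p ≤ a p + M * F := le_self_add
      _ ≤ 4 * 16 ^ n * (a q + M * F) := key
      _ ≤ 4 * 16 ^ n * (M * F + M * F) := by gcongr
      _ = _ := by ring
  calc _ ≤ ∫⁻ x in ⋃ c ∈ c₀, {x ∈ ball c (t / 16) | s ≤ depth Ω x},
        ENNReal.ofReal (g x ^ 2) := by
        refine lintegral_mono_set fun x hx => ?_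
        exact mem_iUnion₂.2 ⟨center x, (center x).2, hcenter x hx.1, hx.2⟩
    _ ≤ ∑ c ∈ c₀, ∫⁻ x in {x ∈ ball c (t / 16) | s ≤ depth Ω x}, ENNReal.ofReal (g x ^ 2) :=
        lintegral_biUnion_finset_le _ _ _
    _ ≤ ∑ _c ∈ c₀, 4 * 16 ^ n * (2 * M) * F := by
        refine Finset.sum_le_sum fun c _ => ?_
        rcases eq_empty_or_nonempty {x ∈ ball c (t / 16) | s ≤ depth Ω x} with he | ⟨p, hp⟩
        · rw [he]; simp
        · refine (lintegral_mono_set fun x hx => ?_).trans (hdeep p hp.2)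
          have h1 := mem_ball.1 hx.1
          have h2 := mem_ball.1 hp.1
          rw [mem_ball]
          have := dist_triangle_right x p c
          linarith
    _ = _ := by rw [Finset.sum_const, nsmul_eq_mul]; ring

/-- On charted domains, square integrable functions are controlled by their interior
oscillation. -/
theorem exists_bound_of_isControlled {r Λ R : ℝ} (hr : 0 < r) (hΛ : 1 ≤ Λ) (hR : 0 < R)
    (hK : K ≠ ⊤) : ∃ C : ℝ≥0∞, C ≠ ⊤ ∧ ∀ Ω g f, IsControlled r Λ R K Ω g f →
      ∫⁻ x in Ω, ENNReal.ofReal (g x ^ 2) ≤ C * ∫⁻ x in Ω, f x := by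
  obtain ⟨C₁, hC₁, hint⟩ := exists_interior_bound hr hΛ hR hK
  set s := r / (32 * Λ ^ 2) with hs
  set ρ := r / (16 * Λ) with hρ
  have hρ0 : 0 < ρ := by positivity
  have hsρ : s ≤ ρ / 2 := by
    rw [hs, hρ, div_div]
    gcongr r / ?_
    nlinarith
  have hρr : ρ ≤ r := div_le_self hr.le (by linarith)
  obtain ⟨c₀, -, hc₀, hcov⟩ := (isCompact_closedBall (0 : E3) (2 * R)).finite_cover_balls
    (e := ρ / 4) (by positivity)
  lift c₀ to Finset E3 using hc₀
  set A₁ := absorbConst (1 / 32) K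
  set A₂ := absorbConst (1 / (16 * Λ)) K
  have hA₁ : A₁ ≠ ⊤ := absorbConst_ne_top hK
  have hA₂ : A₂ ≠ ⊤ := absorbConst_ne_top hK
  refine ⟨A₁ + (c₀.card : ℝ≥0∞) * (C₁ + A₂ * (1 + C₁)), by finiteness, fun Ω g f h => ?_⟩
  have hint' := hint Ω g f h
  set F := ∫⁻ x in Ω, f x
  have hpiece : ∀ c : E3, ∫⁻ x in Ω ∩ (ball c (ρ / 4) ∩ closedBall 0 (2 * R)),
      ENNReal.ofReal (g x ^ 2) ≤ (C₁ + A₂ * (1 + C₁)) * F := by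
    intro c
    -- A piece is either entirely deep or has a point within s ≤ ρ/2 of some boundary point P; since
    -- its diameter is at most ρ/2, it then lies in `ball P ρ`.
    by_cases hall : ∀ x ∈ Ω ∩ (ball c (ρ / 4) ∩ closedBall 0 (2 * R)), s ≤ depth Ω x
    · calc _ ≤ ∫⁻ x in {x ∈ closedBall 0 (2 * R + 2 * r) | s ≤ depth Ω x},
            ENNReal.ofReal (g x ^ 2) := lintegral_mono_set fun x hx =>
              ⟨closedBall_subset_closedBall (by linarith) hx.2.2, hall x hx⟩
        _ ≤ C₁ * F := hint'
        _ ≤ _ := by gcongr; exact le_self_add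
    · push Not at hall
      obtain ⟨x, ⟨hxΩ, hxc, hxR⟩, hxs⟩ := hall
      obtain ⟨P, hPf, hPd⟩ := h.domain.exists_frontier hxΩ
      obtain ⟨ν, ζ, hζ, hζP, hchart⟩ := h.domain.chart P hPf
      rw [mem_ball] at hxc
      rw [mem_closedBall] at hxR
      calc _ ≤ ∫⁻ x in Ω ∩ ball P ρ, ENNReal.ofReal (g x ^ 2) := by
            refine lintegral_mono_set fun y hy => ⟨hy.1, ?_⟩
            have h1 := mem_ball.1 hy.2.1
            have h2 := dist_triangle4 y c x P
            rw [dist_comm c x] at h2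
            rw [mem_ball]
            linarith
        _ ≤ A₂ * (F + ∫⁻ x in {x ∈ ball P r | ρ ≤ depth Ω x}, ENNReal.ofReal (g x ^ 2)) :=
            lintegral_sq_near_le h.domain.isOpen h.domain.compl_nonempty h.measurable_left
              h.measurable_right h.osc h.finite hζ hr hζP hchart
        _ ≤ A₂ * (F + C₁ * F) := by
            gcongr
            refine (lintegral_mono_set (fun y hy => ?_)).trans hint'
            refine ⟨?_, ?_⟩
            · have h1 := mem_ball.1 hy.1
              have h2 := dist_triangle4 y P x 0
              rw [dist_comm P x] at h2
              rw [mem_closedBall]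
              linarith
            · have h1 : ρ ≤ depth Ω y := hy.2
              linarith
        _ = A₂ * (1 + C₁) * F := by ring
        _ ≤ _ := by gcongr; exact le_add_self
  calc _ ≤ ∫⁻ x in {x ∈ halfSpace | 2 * R ≤ ‖x‖} ∪
        ⋃ c ∈ c₀, Ω ∩ (ball c (ρ / 4) ∩ closedBall 0 (2 * R)), ENNReal.ofReal (g x ^ 2) := by
        refine lintegral_mono_set fun x hx => ?_
        by_cases hxR : 2 * R ≤ ‖x‖
        · exact Or.inl ⟨h.domain.subset_halfSpace hx, hxR⟩
        · have hxb : x ∈ closedBall (0 : E3) (2 * R) := by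
            rw [mem_closedBall_zero_iff]; linarith
          obtain ⟨c, hc, hxc⟩ := mem_iUnion₂.1 (hcov hxb)
          exact Or.inr (mem_iUnion₂.2 ⟨c, hc, hx, hxc, hxb⟩)
    _ ≤ A₁ * F + ∑ _c ∈ c₀, (C₁ + A₂ * (1 + C₁)) * F := by
        refine (lintegral_union_le _ _ _).trans (add_le_add (h.far_le hR) ?_)
        refine (lintegral_biUnion_finset_le _ _ _).trans (Finset.sum_le_sum fun c _ => hpiece c)
    _ = _ := by rw [Finset.sum_const, nsmul_eq_mul]; ring

end Interior

/-! ### The exterior of a cavity is a charted domain -/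

lemma norm_horizontal_sub_le (x y : E3) : ‖horizontal x - horizontal y‖ ≤ ‖x - y‖ := by
  rw [EuclideanSpace.norm_eq, EuclideanSpace.norm_eq]
  refine Real.sqrt_le_sqrt ?_
  simp only [Fin.sum_univ_two, Fin.sum_univ_three, PiLp.sub_apply, horizontal]
  simp only [Matrix.cons_val_zero, Matrix.cons_val_one]
  nlinarith [sq_nonneg ‖x 2 - y 2‖]

/-- Near a boundary point of a set of Lipschitz class, the set lies below the zero level of a
height function. -/
lemma HasLipschitzBoundary.exists_height {r₀ E₀ : ℝ} {C : Set E3} (hr₀ : 0 < r₀)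
    (h : HasLipschitzBoundary r₀ E₀ C) {P : E3} (hP : P ∈ frontier C) :
    ∃ ν ζ, IsHeight (1 + E₀) ν ζ ∧ ζ P = 0 ∧ ∀ x ∈ ball P r₀, x ∈ C ↔ ζ x < 0 := by
  obtain ⟨T, ψ, hTP, hψ0, ⟨M, L, -, hL, hML⟩, hC⟩ := h P hP
  -- Extension to the whole plane makes the height function globally defined and Lipschitz.
  obtain ⟨ψ', hψ'L, hψ'⟩ := hL.extend_real
  have hLE : (L : ℝ) ≤ E₀ := by linarith [M.coe_nonneg]
  have hE₀ : 0 ≤ E₀ := L.coe_nonneg.trans hLE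
  -- The direction is reversed: C is the epigraph, and height must grow towards its exterior.
  set e : E3 := EuclideanSpace.single 2 (-1) with he
  set ν : E3 := T.linearIsometryEquiv.symm e with hν
  have hT : ∀ x (s : ℝ), T (x + s • ν) = T x + s • e := by
    intro x s
    have := T.map_vadd x (s • ν)
    rw [vadd_eq_add, vadd_eq_add, add_comm] at this
    rw [this, map_smul, hν, LinearIsometryEquiv.apply_symm_apply, add_comm]
  have hh : ∀ (x : E3) (s : ℝ), horizontal (x + s • e) = horizontal x := by
    intro x s
    simp [horizontal, he]
  refine ⟨ν, fun x => ψ' (horizontal (T x)) - T x 2, ⟨?_, ?_, ?_⟩, ?_, ?_⟩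
  · rw [hν, LinearIsometryEquiv.norm_map, he]; simp
  · intro x y
    have h1 : |ψ' (horizontal (T x)) - ψ' (horizontal (T y))| ≤ E₀ * dist x y := by
      rw [← Real.dist_eq]
      refine (hψ'L.dist_le_mul _ _).trans ?_
      have : dist (horizontal (T x)) (horizontal (T y)) ≤ dist x y := by
        rw [← T.dist_map x y, dist_eq_norm, dist_eq_norm]
        exact norm_horizontal_sub_le _ _
      gcongr
    have h2 : |T x 2 - T y 2| ≤ dist x y := by
      rw [← T.dist_map x y, dist_eq_norm, ← Real.norm_eq_abs]
      exact PiLp.norm_apply_le (T x - T y) 2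
    calc |ψ' (horizontal (T x)) - T x 2 - (ψ' (horizontal (T y)) - T y 2)|
        = |(ψ' (horizontal (T x)) - ψ' (horizontal (T y))) - (T x 2 - T y 2)| := by
          congr 1; ring
      _ ≤ _ := abs_sub _ _
      _ ≤ (1 + E₀) * dist x y := by linarith
  · intro x s
    rw [hT, hh]
    simp [he]
    ring
  · have h0 : horizontal (0 : E3) = 0 := by
      ext i; fin_cases i <;> simp [horizontal]
    simp only [hTP, h0]
    rw [← hψ' (mem_ball_self hr₀), hψ0]
    simp
  · intro x hx
    have hTx : T x ∈ ball (0 : E3) r₀ := by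
      rw [mem_ball, ← hTP, T.dist_map]; exact hx
    have hhx : horizontal (T x) ∈ ball (0 : E2) r₀ := by
      rw [mem_ball_zero_iff] at hTx ⊢
      have h0 : horizontal (0 : E3) = 0 := by
        ext i; fin_cases i <;> simp [horizontal]
      have := norm_horizontal_sub_le (T x) 0
      rw [h0, sub_zero, sub_zero] at this
      exact this.trans_lt hTx
    have h1 : x ∈ C ↔ T x ∈ (T '' C) ∩ ball 0 r₀ := by
      rw [mem_inter_iff, and_iff_left hTx, T.injective.mem_set_image]
    rw [h1, hC, sub_neg, ← hψ' hhx]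
    exact and_iff_right hTx

/-- Positive height is an open condition excluding C, and from height at most zero any small descent
along ν enters C. -/
lemma mem_closure_iff_height_nonpos {Λ r : ℝ} {C : Set E3} {ν P : E3} {ζ : E3 → ℝ}
    (hζ : IsHeight Λ ν ζ) (hC : ∀ x ∈ ball P r, x ∈ C ↔ ζ x < 0) {x : E3} (hx : x ∈ ball P r) :
    x ∈ closure C ↔ ζ x ≤ 0 := by
  constructor
  · intro hxc
    by_contra hpos
    push Not at hpos
    have hopen : {y | 0 < ζ y} ∩ ball P r ∈ 𝓝 x :=
      inter_mem ((isOpen_lt continuous_const hζ.continuous).mem_nhds hpos)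
        (isOpen_ball.mem_nhds hx)
    obtain ⟨y, ⟨hy1, hy2⟩, hyC⟩ := mem_closure_iff_nhds.1 hxc _ hopen
    have hy1' : 0 < ζ y := hy1
    linarith [(hC y hy2).1 hyC]
  · intro hx0
    have hcont : Tendsto (fun s : ℝ => x + (-s) • ν) (𝓝[>] 0) (𝓝 x) := by
      have : Continuous fun s : ℝ => x + (-s) • ν := by fun_prop
      have h0 := this.tendsto 0
      simp only [neg_zero, zero_smul, add_zero] at h0
      exact h0.mono_left nhdsWithin_le_nhds
    refine mem_closure_of_tendsto hcont ?_
    filter_upwards [self_mem_nhdsWithin, hcont (isOpen_ball.mem_nhds hx)] with s hs hsb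
    have hs' : 0 < s := hs
    rw [hC _ hsb, hζ.shift]
    linarith

/-- The plane and the closure of the cavity are at least D₀ apart, so a chart of radius at most D₀/2
meets only one of the two boundary pieces. The cavity lies within radius 2D₀ < 3D₀. -/
lemma IsCavity.isChartedDomain {r₀ E₀ D₀ : ℝ} {C : Set E3} (hr₀ : 0 < r₀) (hE₀ : 0 < E₀)
    (hD₀ : 1 < D₀) (h : IsCavity r₀ E₀ D₀ C) :
    IsChartedDomain (min r₀ (D₀ / 2)) (1 + E₀) (3 * D₀) (exterior C) := by
  have hc2 : Continuous fun x : E3 => x 2 := by fun_prop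
  have hopenH : IsOpen halfSpace := isOpen_lt hc2 continuous_const
  have hopen : IsOpen (exterior C) := hopenH.sdiff isClosed_closure
  have hclosed : ∀ x ∈ closure C, ‖x‖ ≤ 2 * D₀ := by
    intro x hx
    have : closure C ⊆ closedBall 0 (2 * D₀) :=
      closure_minimal (fun y hy => ball_subset_closedBall (h.subset_halfBall hy).1)
        isClosed_closedBall
    simpa using this hx
  have hdist : ∀ x ∈ closure C, ∀ y ∈ boundaryPlane, D₀ ≤ dist x y := by
    intro x hx y hy
    have : closure C ⊆ {x | D₀ ≤ dist x y} :=
      closure_minimal (fun z hz => h.le_dist z hz y hy)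
        (isClosed_le continuous_const (by fun_prop))
    exact this hx
  refine ⟨hopen, h.exterior_connected.isPreconnected, fun x hx => hx.1, fun x hx hxR => ?_, ?_⟩
  · refine ⟨hx, fun hxc => ?_⟩
    have := hclosed x hxc
    linarith
  intro P hP
  rw [hopen.frontier_eq] at hP
  have hP2 : P 2 ≤ 0 := by
    have : closure (exterior C) ⊆ {x : E3 | x 2 ≤ 0} :=
      closure_minimal (fun y hy => show y 2 ≤ 0 from le_of_lt hy.1) (isClosed_le hc2 continuous_const)
    exact this hP.1
  rcases hP2.eq_or_lt with hP0 | hPneg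
  · refine ⟨EuclideanSpace.single 2 (-1), fun x => - x 2, ⟨by simp, fun x y => ?_, fun x s => ?_⟩,
      by simp [hP0], fun x hx => ?_⟩
    · have h1 : |x 2 - y 2| ≤ dist x y := by
        rw [dist_eq_norm, ← Real.norm_eq_abs]
        exact PiLp.norm_apply_le (x - y) 2
      rw [neg_sub_neg, abs_sub_comm]
      nlinarith [dist_nonneg (x := x) (y := y)]
    · simp; ring
    · have hxc : x ∉ closure C := fun hxc => by
        have h1 := hdist x hxc P hP0
        have h2 : dist x P < D₀ / 2 := (mem_ball.1 hx).trans_le (min_le_right _ _)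
        linarith
      rw [neg_pos]
      exact and_iff_left hxc
  · have hPc : P ∈ closure C := by
      by_contra hcon
      exact hP.2 ⟨hPneg, hcon⟩
    have hPf : P ∈ frontier C := by
      rw [h.isOpen.frontier_eq]
      refine ⟨hPc, fun hPC => ?_⟩
      obtain ⟨y, hy1, hy2⟩ := mem_closure_iff_nhds.1 hP.1 C (h.isOpen.mem_nhds hPC)
      exact hy2.2 (subset_closure hy1)
    obtain ⟨ν, ζ, hζ, hζP, hC⟩ := h.lipschitz.exists_height hr₀ hPf
    refine ⟨ν, ζ, hζ, hζP, fun x hx => ?_⟩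
    have hx1 : x ∈ ball P r₀ := ball_subset_ball (min_le_left _ _) hx
    have hx2 : dist x P < D₀ / 2 := (mem_ball.1 hx).trans_le (min_le_right _ _)
    have hxneg : x ∈ halfSpace := by
      have hproj : P + (- P 2) • (EuclideanSpace.single 2 1 : E3) ∈ boundaryPlane := by
        simp [boundaryPlane]
      have h1 := hdist P hPc _ hproj
      rw [dist_comm, dist_eq_norm, add_sub_cancel_left, norm_smul, Real.norm_eq_abs,
        abs_of_pos (by linarith)] at h1
      have h2 : |x 2 - P 2| ≤ dist x P := by
        rw [dist_eq_norm, ← Real.norm_eq_abs]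
        exact PiLp.norm_apply_le (x - P) 2
      have h3 := le_abs_self (x 2 - P 2)
      have h4 : ‖(EuclideanSpace.single 2 1 : E3)‖ = 1 := by simp
      rw [h4] at h1
      change x 2 < 0
      linarith
    have h5 := mem_closure_iff_height_nonpos hζ hC hx1
    constructor
    · intro hxe
      exact not_le.1 fun hle => hxe.2 (h5.2 hle)
    · exact fun hpos => ⟨hxneg, fun hxc => absurd (h5.1 hxc) (not_le.2 hpos)⟩

/-! ### Weak gradients -/

lemma integral_mul_testFunction {Ω : Set E3} {k φ : E3 → ℝ} (hφ : tsupport φ ⊆ Ω) :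
    ∫ x in Ω, k x * φ x = ∫ x in tsupport φ, k x * φ x := by
  have hz : ∀ x ∉ tsupport φ, k x * φ x = 0 := fun x hx => by
    rw [image_eq_zero_of_notMem_tsupport hx, mul_zero]
  rw [setIntegral_eq_integral_of_forall_compl_eq_zero fun x hx => hz x fun h => hx (hφ h),
    setIntegral_eq_integral_of_forall_compl_eq_zero hz]

/-- Fundamental lemma of the calculus of variations. It lets any weak gradient be replaced by a
Borel, square integrable one. -/
lemma HasWeakGradient.ae_eq {Ω : Set E3} (hΩ : IsOpen Ω) {u : E3 → E3}
    {G G' : E3 → Matrix (Fin 3) (Fin 3) ℝ} (h : HasWeakGradient Ω u G)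
    (h' : HasWeakGradient Ω u G') : ∀ᵐ x ∂(volume.restrict Ω), G x = G' x := by
  have key : ∀ i j, ∀ᵐ x ∂(volume.restrict Ω), G x i j = G' x i j := by
    intro i j
    rw [ae_restrict_iff' hΩ.measurableSet]
    have hz := hΩ.ae_eq_zero_of_integral_contDiff_smul_eq_zero (μ := volume)
      (f := fun x => G x i j - G' x i j) ((h.2.1 i j).sub (h'.2.1 i j)) ?_
    · filter_upwards [hz] with x hx hxΩ
      exact sub_eq_zero.1 (hx hxΩ)
    · intro φ hφ hφc hφΩ
      have e1 := h.2.2 φ hφ hφc hφΩ i j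
      have e2 := h'.2.2 φ hφ hφc hφΩ i j
      rw [e1, neg_inj, integral_mul_testFunction hφΩ, integral_mul_testFunction hφΩ] at e2
      obtain ⟨B, hB⟩ := hφc.exists_bound_of_continuous hφ.continuous
      have hint : ∀ k : E3 → ℝ, LocallyIntegrableOn k Ω →
          IntegrableOn (fun x => k x * φ x) (tsupport φ) := fun k hk =>
        Integrable.mul_bdd (c := B) (hk.integrableOn_compact_subset hφΩ hφc)
          hφ.continuous.aestronglyMeasurable (Eventually.of_forall hB)
      have e3 : ∫ x, φ x • (G x i j - G' x i j) =
          ∫ x in tsupport φ, (G x i j * φ x - G' x i j * φ x) := by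
        rw [setIntegral_eq_integral_of_forall_compl_eq_zero]
        · exact integral_congr_ae (Eventually.of_forall fun x => by
            simp only [smul_eq_mul]; ring)
        · intro x hx
          rw [image_eq_zero_of_notMem_tsupport hx]; ring
      rw [e3, integral_sub (hint _ (h.2.1 i j)) (hint _ (h'.2.1 i j)), e2, sub_self]
  have hall := ae_all_iff.2 fun i => ae_all_iff.2 fun j => key i j
  filter_upwards [hall] with x hx
  ext i j
  exact hx i j

/-- A square integrable weak gradient has a Borel measurable representative. -/
lemma MemWeightedH1.exists_measurable_gradient {Ω : Set E3} {u : E3 → E3}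
    (h : MemWeightedH1 Ω u) : ∃ G : E3 → Matrix (Fin 3) (Fin 3) ℝ,
      HasWeakGradient Ω u G ∧ (∀ i j, Measurable fun x => G x i j) ∧
      ∀ i j, MemLp (fun x => G x i j) 2 (volume.restrict Ω) := by
  obtain ⟨-, G, hG, hL⟩ := h
  set G' : E3 → Matrix (Fin 3) (Fin 3) ℝ := fun x => Matrix.of fun i j =>
    (hL i j).aestronglyMeasurable.mk (fun x => G x i j) x with hG'
  have hae : ∀ i j, (fun x => G x i j) =ᵐ[volume.restrict Ω] fun x => G' x i j := fun i j =>
    (hL i j).aestronglyMeasurable.ae_eq_mk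
  have hL' : ∀ i j, MemLp (fun x => G' x i j) 2 (volume.restrict Ω) := fun i j =>
    (memLp_congr_ae (hae i j)).1 (hL i j)
  refine ⟨G', ⟨hG.1, fun i j => ?_, fun φ h1 h2 h3 i j => ?_⟩, fun i j => ?_, hL'⟩
  · exact locallyIntegrableOn_of_locallyIntegrable_restrict
      ((hL' i j).locallyIntegrable (by norm_num))
  · rw [hG.2.2 φ h1 h2 h3 i j]
    congr 1
    refine integral_congr_ae ?_
    filter_upwards [hae i j] with x hx
    rw [hx]
  · exact (hL i j).aestronglyMeasurable.stronglyMeasurable_mk.measurable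

end ElasticCavity

/-! ### Summing the scalar estimate over the entries of the gradient. -/

theorem mainTheorem4 (r₀ E₀ D₀ : ℝ) (hr₀ : 0 < r₀) (hE₀ : 0 < E₀) (hD₀ : 1 < D₀) :
    ∃ c : ℝ, 0 < c ∧
      ∀ C : Set ElasticCavity.E3, ElasticCavity.IsCavity r₀ E₀ D₀ C →
      ∀ u : ElasticCavity.E3 → ElasticCavity.E3,
        ElasticCavity.MemWeightedH1 (ElasticCavity.exterior C) u →
      ∀ G : ElasticCavity.E3 → Matrix (Fin 3) (Fin 3) ℝ,
        ElasticCavity.HasWeakGradient (ElasticCavity.exterior C) u G →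
        ∫ x in ElasticCavity.exterior C, ElasticCavity.normSq (G x) ≤
          c * ∫ x in ElasticCavity.exterior C,
            ElasticCavity.normSq (ElasticCavity.symPart (G x)) := by
  open ElasticCavity in
  obtain ⟨K, hK, hkorn⟩ := exists_ball_korn
  obtain ⟨B, hB, hbound⟩ := exists_bound_of_isControlled (r := min r₀ (D₀ / 2)) (Λ := 1 + E₀)
    (R := 3 * D₀) (K := K) (lt_min hr₀ (by linarith)) (by linarith) (by linarith) hK
  -- The 9 counts the matrix entries; the 1 only ensures positivity.
  refine ⟨9 * B.toReal + 1, by positivity, fun C hC u hu G hG => ?_⟩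
  have hdom := hC.isChartedDomain hr₀ hE₀ hD₀
  set Ω := exterior C
  obtain ⟨G', hG', hm, hL⟩ := hu.exists_measurable_gradient
  have hae := hG.ae_eq hdom.isOpen hG'
  have i1 : ∫ x in Ω, normSq (G x) = ∫ x in Ω, normSq (G' x) :=
    integral_congr_ae (hae.mono fun x hx => by simp only [hx])
  have i2 : ∫ x in Ω, normSq (symPart (G x)) = ∫ x in Ω, normSq (symPart (G' x)) :=
    integral_congr_ae (hae.mono fun x hx => by simp only [hx])
  rw [i1, i2]
  have hsq : ∀ i j, Integrable (fun x => G' x i j ^ 2) (volume.restrict Ω) := fun i j =>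
    (hL i j).integrable_sq
  have hint : Integrable (fun x => normSq (G' x)) (volume.restrict Ω) :=
    integrable_finsetSum _ fun i _ => integrable_finsetSum _ fun j _ => hsq i j
  have hsm : Measurable fun x => normSq (symPart (G' x)) := by
    simp only [normSq, symPart, Matrix.smul_apply, Matrix.add_apply, Matrix.transpose_apply]
    exact Finset.measurable_fun_sum _ fun i _ => Finset.measurable_fun_sum _ fun j _ =>
      (((hm i j).add (hm j i)).const_mul _).pow_const 2
  have hint2 : Integrable (fun x => normSq (symPart (G' x))) (volume.restrict Ω) :=
    hint.mono' hsm.aestronglyMeasurable (Filter.Eventually.of_forall fun x => by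
      rw [Real.norm_of_nonneg (normSq_nonneg _)]; exact normSq_symPart_le _)
  -- Square integrability of the gradient enters here, as the finiteness on which the absorption
  -- depends.
  have hentry : ∀ i j, ∫⁻ x in Ω, ENNReal.ofReal (G' x i j ^ 2) ≤
      B * ∫⁻ x in Ω, ENNReal.ofReal (normSq (symPart (G' x))) := fun i j =>
    hbound Ω (fun x => G' x i j) _
      ⟨hdom, hm i j, hsm.ennreal_ofReal, fun z r hr hz => hkorn Ω u G' hG' z r hr hz i j, by
        rw [← ofReal_integral_eq_lintegral_ofReal (hsq i j)
          (Filter.Eventually.of_forall fun _ => sq_nonneg _)]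
        exact ENNReal.ofReal_ne_top⟩
  have htot : ∫⁻ x in Ω, ENNReal.ofReal (normSq (G' x)) ≤
      9 * B * ∫⁻ x in Ω, ENNReal.ofReal (normSq (symPart (G' x))) := by
    simp_rw [ofReal_normSq_eq (G' _)]
    rw [lintegral_finsetSum _ fun i _ => Finset.measurable_fun_sum _ fun j _ =>
      ((hm i j).pow_const 2).ennreal_ofReal]
    simp_rw [lintegral_finsetSum _ fun j _ => ((hm _ j).pow_const 2).ennreal_ofReal]
    refine (Finset.sum_le_sum fun i _ => Finset.sum_le_sum fun j _ => hentry i j).trans ?_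
    simp only [Finset.sum_const, Finset.card_univ, Fintype.card_fin, nsmul_eq_mul]
    refine le_of_eq ?_
    push_cast
    ring
  rw [← ofReal_integral_eq_lintegral_ofReal hint
      (Filter.Eventually.of_forall fun _ => normSq_nonneg _),
    ← ofReal_integral_eq_lintegral_ofReal hint2
      (Filter.Eventually.of_forall fun _ => normSq_nonneg _)] at htot
  have hI0 : 0 ≤ ∫ x in Ω, normSq (symPart (G' x)) := integral_nonneg fun _ => normSq_nonneg _
  have hfin : 9 * B * ENNReal.ofReal (∫ x in Ω, normSq (symPart (G' x))) ≠ ⊤ :=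
    ENNReal.mul_ne_top (ENNReal.mul_ne_top (by simp) hB) ENNReal.ofReal_ne_top
  have hreal := ENNReal.toReal_mono hfin htot
  rw [ENNReal.toReal_mul, ENNReal.toReal_mul, ENNReal.toReal_ofReal hI0,
    ENNReal.toReal_ofReal (integral_nonneg fun _ => normSq_nonneg _)] at hreal
  have h9 : (9 : ENNReal).toReal = 9 := by simp
  rw [h9] at hreal
  linarith
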